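/- Let $G$ be a locally compact Hausdorff group with unit $e$, with left Haar measure $dr$ and modular function $\Delta$, normalized by $\int_G f(rt)\,dr=\Delta(t)^{-1}\int_G f(r)\,dr$ for $f\in C_c(G)$. Let $\mathcal A=(A_t)_{t\in G}$ be a Fell bundle ($C^*$-algebraic bundle) over $G$. **Kernels.** Let $k_c(\mathcal A)$ be the space of compactly supported continuous maps $k:G\times G\to\mathcal A$ with $k(r,s)\in A_{rs^{-1}}$. It is a normed $*$-algebra with $(k_1k_2)(r,s)=\int_G k_1(r,u)k_2(u,s)\,du$, $k^*(r,s)=k(s,r)^*$ and $\|k\|_2=\bigl(\int_G\int_G\|k(r,s)\|^2\,ds\,dr\bigr)^{1/2}$. Let $HS(\mathcal A)$ be the Banach $*$-algebra which is its completion, and let $\mathbb k(\mathcal A)=C^*(HS(\mathcal A))$ be the enveloping $C^*$-algebra. For $t\in G$ let $\beta_t:\mathbb k(\mathcal A)\to\mathbb k(\mathcal A)$ be the $*$-homomorphism which extends $\beta_t(k)(r,s)=\Delta(t)\,k(rt,st)$, $k\in k_c(\mathcal A)$. **Modules.** For $t\in G$ let $C_c^t(\mathcal A)$ be the space of compactly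 supported continuous maps $\xi:G\to\mathcal A$ with $\xi(r)\in A_{rt}$, and let $L^2_t(\mathcal A)$ be the right Hilbert $A_e$-module obtained by completing it for $(\xi a)(r)=\xi(r)a$ and $\langle\xi,\eta\rangle=\int_G\xi(r)^*\eta(r)\,dr$. Put $L^2(\mathcal A)=L^2_e(\mathcal A)$. Let $I_t(\mathcal A)=\mathcal K(L^2_t(\mathcal A))$ be the $C^*$-algebra of compact operators, that is, the closed linear span of the operators $\theta_{x,y}:z\mapsto x\langle y,z\rangle$, and put $I(\mathcal A)=I_e(\mathcal A)$. **Statement.** 1. For every $t\in G$ there is exactly one $*$-homomorphism $\iota_t:I_t(\mathcal A)\to\mathbb k(\mathcal A)$ such that, for all $\xi,\eta\in C_c^t(\mathcal A)$, $\iota_t(\theta_{\xi,\eta})$ is the class of the kernel $(r,s)\mapsto\xi(r)\eta(s)^*$; and $\iota_t$ is isometric. Through $\iota_t$ the algebra $I_t(\mathcal A)$ is regarded as a $C^*$-subalgebra of $\mathbb k(\mathcal A)$. 2. For every $t\in G$, with these identifications, $I_t(\mathcal A)=\beta_t(I(\mathcal A))$; that is, $\iota_t(I_t(\mathcal A))=\beta_t(\iota_e(I(\mathcal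 A)))$. 3. For every $t\in G$, the map $\rho_t(\xi)(r)=\Delta(t)^{1/2}\xi(rt)$, $\xi\in C_c^e(\mathcal A)$, extends to a unitary operator (an $A_e$-linear surjective isometry which preserves the inner products) $\rho_t:L^2(\mathcal A)\to L^2_t(\mathcal A)$; the map $T\mapsto\rho_tT\rho_t^*$ is a $*$-isomorphism $\rho_t^l:I(\mathcal A)\to I_t(\mathcal A)$; and $\beta_t(\iota_e(T))=\iota_t(\rho_t^l(T))$ for all $T\in I(\mathcal A)$. -/

import Mathlib

open MeasureTheory Filter Topology
open scoped ENNReal NNReal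

universe u v

noncomputable section

/-! ### Hilbert modules -/

section HilbertModule

/-- A right module with an inner product over a `C*`-algebra `A`; the inner product is
conjugate-linear in the first and linear in the second variable. -/
structure InnerCore (A E : Type*) [NonUnitalCStarAlgebra A] [AddCommGroup E] [Module ℂ E] where
  /-- the right action `(ξ, a) ↦ ξ a` -/
  rsmul : E →ₗ[ℂ] A →ₗ[ℂ] E
  /-- the `A`-valued inner product -/
  inner : E →ₗ⋆[ℂ] E →ₗ[ℂ] A
  rsmul_rsmul (x : E) (a b : A) : rsmul (rsmul x a) b = rsmul x (a * b)
  inner_rsmul (x y : E) (a : A) : inner x (rsmul y a) = inner x y * a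
  star_inner (x y : E) : star (inner x y) = inner y x
  /-- `⟪x, x⟫` is a positive element of `A` -/
  inner_self_pos (x : E) : ∃ c : A, inner x x = star c * c

namespace InnerCore

variable {A E : Type*} [NonUnitalCStarAlgebra A] [AddCommGroup E] [Module ℂ E]
  (C : InnerCore A E)

lemma inner_rsmul_left (x y : E) (a : A) : C.inner (C.rsmul x a) y = star a * C.inner x y := by
  rw [← C.star_inner, C.inner_rsmul, star_mul, C.star_inner]

/-- The (semi)norm `‖x‖ = ‖⟪x, x⟫‖ ^ (1 / 2)`. -/
def nrm (x : E) : ℝ := √‖C.inner x x‖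

lemma nrm_sq (x : E) : C.nrm x ^ 2 = ‖C.inner x x‖ := Real.sq_sqrt (norm_nonneg _)

lemma norm_inner_le (x y : E) : ‖C.inner x y‖ ≤ C.nrm x * C.nrm y := by
  let _ := CStarAlgebra.spectralOrder A
  let _ := CStarAlgebra.spectralOrderedRing A
  have hpos : ∀ z, 0 ≤ C.inner z z := fun z => by
    obtain ⟨c, hc⟩ := C.inner_self_pos z
    rw [hc]; exact star_mul_self_nonneg c
  have key : ∀ s : ℝ, 0 ≤ s → ‖C.inner x x‖ ≤ s →
      ‖C.inner x y‖ ^ 2 * s ≤ s ^ 2 * ‖C.inner y y‖ := by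
    intro s hs hxs
    set b := C.inner x y with hb
    have h0 := hpos (C.rsmul x b - (s : ℂ) • y)
    have e : C.inner (C.rsmul x b - (s : ℂ) • y) (C.rsmul x b - (s : ℂ) • y) =
        star b * C.inner x x * b - s • (star b * b) - s • (star b * b)
          + (s ^ 2) • C.inner y y := by
      have hyx : C.inner y x = star b := by rw [hb, C.star_inner]
      simp only [map_sub, LinearMap.sub_apply, C.inner_rsmul, C.inner_rsmul_left, map_smul,
        LinearMap.map_smulₛₗ, LinearMap.smul_apply, hyx, ← hb, Complex.conj_ofReal]
      simp only [Complex.coe_smul, smul_sub, smul_smul, mul_assoc, pow_two]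
      abel
    have hle : star b * C.inner x x * b ≤ s • (star b * b) := by
      refine (CStarAlgebra.star_left_conjugate_le_norm_smul (hb := ?_)).trans ?_
      · exact (C.star_inner x x)
      · exact smul_le_smul_of_nonneg_right hxs (star_mul_self_nonneg b)
    have h1 : s • (star b * b) ≤ (s ^ 2) • C.inner y y := by
      rw [e] at h0
      have h2 : 0 ≤ (s ^ 2) • C.inner y y - s • (star b * b) := by
        refine h0.trans ?_
        rw [← sub_nonneg] at hle ⊢
        convert hle using 1
        abel
      exact sub_nonneg.1 h2
    have h3 := CStarAlgebra.norm_le_norm_of_nonneg_of_le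
      (smul_nonneg hs (star_mul_self_nonneg b)) h1
    rw [norm_smul, norm_smul, CStarRing.norm_star_mul_self, Real.norm_of_nonneg hs,
      Real.norm_of_nonneg (sq_nonneg s)] at h3
    nlinarith [h3]
  have key2 : ‖C.inner x y‖ ^ 2 ≤ ‖C.inner x x‖ * ‖C.inner y y‖ := by
    refine le_of_forall_pos_le_add fun ε hε => ?_
    have hd : 0 < ε / (‖C.inner y y‖ + 1) := by positivity
    set s := ‖C.inner x x‖ + ε / (‖C.inner y y‖ + 1) with hsdef
    have hs : 0 < s := by positivity
    have := key s hs.le (by linarith)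
    have h4 : ‖C.inner x y‖ ^ 2 ≤ s * ‖C.inner y y‖ := by
      have : s * ‖C.inner x y‖ ^ 2 ≤ s * (s * ‖C.inner y y‖) := by nlinarith
      exact le_of_mul_le_mul_left this hs
    refine h4.trans ?_
    rw [hsdef, add_mul]
    gcongr
    rw [div_mul_eq_mul_div, div_le_iff₀ (by positivity)]
    nlinarith [norm_nonneg (C.inner y y)]
  rw [nrm, nrm, ← Real.sqrt_mul (norm_nonneg _)]
  exact Real.le_sqrt_of_sq_le key2

/-- The seminormed group structure induced by the inner product. -/
abbrev toSeminormedAddCommGroup : SeminormedAddCommGroup E :=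
  AddGroupSeminorm.toSeminormedAddCommGroup
    { toFun := C.nrm
      map_zero' := by simp [nrm]
      neg' := fun x => by simp [nrm]
      add_le' := fun x y => by
        refine le_of_sq_le_sq ?_ (add_nonneg (Real.sqrt_nonneg _) (Real.sqrt_nonneg _))
        rw [C.nrm_sq]
        have h : C.inner (x + y) (x + y) =
            C.inner x x + C.inner x y + (C.inner y x + C.inner y y) := by
          simp only [map_add, LinearMap.add_apply]; abel
        rw [h]
        have h1 := norm_add_le (C.inner x x + C.inner x y) (C.inner y x + C.inner y y)
        have h2 := norm_add_le (C.inner x x) (C.inner x y)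
        have h3 := norm_add_le (C.inner y x) (C.inner y y)
        have h4 := C.norm_inner_le x y
        have h5 := C.norm_inner_le y x
        nlinarith [C.nrm_sq x, C.nrm_sq y] }

end InnerCore

/-- A right pre-Hilbert module over the `C*`-algebra `A`, with its norm
`‖x‖ = ‖⟪x, x⟫‖ ^ (1 / 2)`. It is a Hilbert module if it is separated and complete. -/
class PreHilbertModule (A E : Type*) [NonUnitalCStarAlgebra A] [SeminormedAddCommGroup E]
    [NormedSpace ℂ E] extends InnerCore A E where
  norm_sq (x : E) : ‖x‖ ^ 2 = ‖inner x x‖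

namespace PreHilbertModule

section Pre

variable (A : Type*) {E : Type*} [NonUnitalCStarAlgebra A] [SeminormedAddCommGroup E]
  [NormedSpace ℂ E] [H : PreHilbertModule A E]

lemma nrm_eq (x : E) : H.nrm x = ‖x‖ := by
  rw [InnerCore.nrm, ← H.norm_sq, Real.sqrt_sq (norm_nonneg _)]

/-- The inner product as a bounded sesquilinear map. -/
def innerL : E →L⋆[ℂ] E →L[ℂ] A :=
  LinearMap.mkContinuous₂ H.inner 1 fun x y => by
    rw [one_mul, ← nrm_eq A x, ← nrm_eq A y]; exact H.norm_inner_le x y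

/-- The right action as a bounded bilinear map. -/
def rsmulL : E →L[ℂ] A →L[ℂ] E :=
  LinearMap.mkContinuous₂ H.rsmul 1 fun x a => by
    refine le_of_sq_le_sq ?_ (by positivity)
    rw [H.norm_sq, H.inner_rsmul, H.inner_rsmul_left, one_mul, mul_pow, H.norm_sq]
    calc ‖star a * H.inner x x * a‖ ≤ ‖star a‖ * ‖H.inner x x‖ * ‖a‖ :=
          (norm_mul_le _ _).trans (mul_le_mul_of_nonneg_right (norm_mul_le _ _) (norm_nonneg _))
      _ = _ := by rw [norm_star]; ring

variable {A}

lemma star_innerL (x y : E) : star (innerL A x y) = innerL A y x := H.star_inner x y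
lemma innerL_rsmulL (x y : E) (a : A) : innerL A x (rsmulL A y a) = innerL A x y * a :=
  H.inner_rsmul x y a
lemma innerL_rsmulL_left (x y : E) (a : A) :
    innerL A (rsmulL A x a) y = star a * innerL A x y :=
  H.inner_rsmul_left x y a
lemma norm_sq_eq (x : E) : ‖x‖ ^ 2 = ‖innerL A x x‖ := H.norm_sq x
lemma rsmulL_rsmulL (x : E) (a b : A) : rsmulL A (rsmulL A x a) b = rsmulL A x (a * b) :=
  H.rsmul_rsmul x a b
lemma norm_innerL_le (x y : E) : ‖innerL A x y‖ ≤ ‖x‖ * ‖y‖ := by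
  rw [← nrm_eq A x, ← nrm_eq A y]; exact H.norm_inner_le x y

end Pre

/-! #### Completion -/

section Completion

open UniformSpace

variable (A E : Type*) [NonUnitalCStarAlgebra A] [SeminormedAddCommGroup E]
  [NormedSpace ℂ E] [H : PreHilbertModule A E]

/-- Continuous extension of the right action to the completion. -/
def rsmulCompl : Completion E →L[ℂ] A →L[ℂ] Completion E :=
  ((ContinuousLinearMap.compL ℂ A E (Completion E) Completion.toComplL).comp
    (rsmulL A (E := E))).extend (Completion.toComplL (𝕜 := ℂ) (E := E))

/-- Continuous extension of the inner product to the completion. -/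
def innerCompl : Completion E →L⋆[ℂ] Completion E →L[ℂ] A :=
  (((innerL A (E := E)).extend (Completion.toComplL (𝕜 := ℂ) (E := E))).flip.extend
    (Completion.toComplL (𝕜 := ℂ) (E := E))).flip

lemma isUI : IsUniformInducing (Completion.toComplL (𝕜 := ℂ) (E := E)) :=
  Completion.isUniformInducing_coe E

lemma dR : DenseRange (Completion.toComplL (𝕜 := ℂ) (E := E)) :=
  Completion.denseRange_coe

variable {E}

lemma rsmulCompl_coe (x : E) (a : A) : rsmulCompl A E x a = (rsmulL A x a : E) := by
  have := ContinuousLinearMap.extend_eq ((ContinuousLinearMap.compL ℂ A E (Completion E)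
    Completion.toComplL).comp (rsmulL A (E := E))) (dR E) (isUI E) x
  exact congrArg (fun f => f a) this

lemma innerCompl_coe (x y : E) : innerCompl A E x y = innerL A x y := by
  have h1 := ContinuousLinearMap.extend_eq (((innerL A (E := E)).extend
    (Completion.toComplL (𝕜 := ℂ) (E := E))).flip) (dR E) (isUI E) y
  have h2 := ContinuousLinearMap.extend_eq (innerL A (E := E)) (dR E) (isUI E) x
  have h3 := congrArg (fun f => f (x : Completion E)) h1
  exact h3.trans (congrArg (fun f => f y) h2)

instance completion : PreHilbertModule A (Completion E) where
  rsmul := ContinuousLinearMap.toLinearMap₁₂ (rsmulCompl A E)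
  inner := ContinuousLinearMap.toLinearMap₁₂ (innerCompl A E)
  rsmul_rsmul x a b := by
    change rsmulCompl A E (rsmulCompl A E x a) b = rsmulCompl A E x (a * b)
    induction x using Completion.induction_on with
    | hp => exact isClosed_eq (by fun_prop) (by fun_prop)
    | ih x => simp only [rsmulCompl_coe, rsmulL_rsmulL]
  inner_rsmul x y a := by
    change innerCompl A E x (rsmulCompl A E y a) = innerCompl A E x y * a
    induction x, y using Completion.induction_on₂ with
    | hp => exact isClosed_eq (by fun_prop) (by fun_prop)
    | ih x y => simp only [rsmulCompl_coe, innerCompl_coe, innerL_rsmulL]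
  star_inner x y := by
    change star (innerCompl A E x y) = innerCompl A E y x
    induction x, y using Completion.induction_on₂ with
    | hp => exact isClosed_eq (by fun_prop) (by fun_prop)
    | ih x y => simp only [innerCompl_coe, star_innerL]
  inner_self_pos x := by
    let _ := CStarAlgebra.spectralOrder A
    let _ := CStarAlgebra.spectralOrderedRing A
    change ∃ c, innerCompl A E x x = star c * c
    rw [← CStarAlgebra.nonneg_iff_eq_star_mul_self]
    induction x using Completion.induction_on with
    | hp => exact isClosed_le (by fun_prop) (by fun_prop)
    | ih x =>
      obtain ⟨c, hc⟩ := H.inner_self_pos x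
      rw [innerCompl_coe]
      exact hc ▸ star_mul_self_nonneg c
  norm_sq x := by
    change ‖x‖ ^ 2 = ‖innerCompl A E x x‖
    induction x using Completion.induction_on with
    | hp => exact isClosed_eq (by fun_prop) (by fun_prop)
    | ih x => rw [innerCompl_coe, Completion.norm_coe]; exact H.norm_sq x

end Completion

/-! #### Adjointable and compact operators -/

section Operators

variable (A E : Type*) [NonUnitalCStarAlgebra A] [NormedAddCommGroup E]
  [NormedSpace ℂ E] [H : PreHilbertModule A E]

/-- The algebra of adjointable operators on a Hilbert module, as a subalgebra of the algebra of
all bounded operators. -/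
def adjointableSubalgebra : Subalgebra ℂ (E →L[ℂ] E) where
  carrier := {T | ∃ S : E →L[ℂ] E, ∀ x y, innerL A (T x) y = innerL A x (S y)}
  mul_mem' := by
    rintro T T' ⟨S, hS⟩ ⟨S', hS'⟩
    exact ⟨S' * S, fun x y => by simp [hS, hS']⟩
  add_mem' := by
    rintro T T' ⟨S, hS⟩ ⟨S', hS'⟩
    exact ⟨S + S', fun x y => by simp [hS, hS']⟩
  algebraMap_mem' c := ⟨algebraMap ℂ _ (star c), fun x y => by
    simp [Algebra.algebraMap_eq_smul_one]⟩

/-- The algebra `ℒ(E)` of adjointable operators on a Hilbert module `E`, with the operator norm. -/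
def Adjointable : Type _ := adjointableSubalgebra A E

variable {A E}

namespace Adjointable

instance : NormedRing (Adjointable A E) :=
  inferInstanceAs (NormedRing (adjointableSubalgebra A E))
instance : NormedAlgebra ℂ (Adjointable A E) :=
  inferInstanceAs (NormedAlgebra ℂ (adjointableSubalgebra A E))

/-- The underlying bounded operator. -/
def op (T : Adjointable A E) : E →L[ℂ] E := T.1

lemma ext_op {T S : Adjointable A E} (h : ∀ x, T.op x = S.op x) : T = S :=
  Subtype.ext (ContinuousLinearMap.ext h)

lemma norm_op (T : Adjointable A E) : ‖T.op‖ = ‖T‖ := rfl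
lemma dist_op (T S : Adjointable A E) : dist T.op S.op = dist T S := rfl

end Adjointable

lemma ext_inner {x y : E} (h : ∀ z, innerL A z x = innerL A z y) : x = y := by
  have : ‖x - y‖ ^ 2 = 0 := by
    rw [norm_sq_eq (A := A), map_sub, h, sub_self, norm_zero]
  simpa [sub_eq_zero] using this

/-- The adjoint of an adjointable operator. -/
instance : Star (Adjointable A E) where
  star T := ⟨T.2.choose, T.1, fun x y => by
    have h := T.2.choose_spec y x
    rw [← star_innerL, ← h, star_innerL]⟩

lemma inner_star (T : Adjointable A E) (x y : E) :
    innerL A (T.op x) y = innerL A x ((star T).op y) := T.2.choose_spec x y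

lemma star_eq_of_inner {T S : Adjointable A E}
    (h : ∀ x y, innerL A (T.op x) y = innerL A x (S.op y)) : star T = S :=
  Adjointable.ext_op fun y => ext_inner (A := A) fun x => by rw [← inner_star, h]

instance : StarRing (Adjointable A E) where
  star_involutive T := star_eq_of_inner fun x y => by
    rw [← star_innerL, ← inner_star, star_innerL]
  star_mul T S := star_eq_of_inner fun x y => by
    change innerL A (T.op (S.op x)) y = innerL A x ((star S).op ((star T).op y))
    rw [inner_star, inner_star]
  star_add T S := star_eq_of_inner fun x y => by
    change innerL A (T.op x + S.op x) y = innerL A x ((star T).op y + (star S).op y)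
    rw [map_add, map_add, add_apply, inner_star, inner_star]

instance : StarModule ℂ (Adjointable A E) where
  star_smul c T := star_eq_of_inner fun x y => by
    change innerL A (c • T.op x) y = innerL A x (star c • (star T).op y)
    simp [inner_star]

instance : CStarRing (Adjointable A E) where
  norm_mul_self_le T := by
    have h : ∀ x, ‖T.op x‖ ≤ √‖star T * T‖ * ‖x‖ := fun x => by
      refine le_of_sq_le_sq ?_ (by positivity)
      rw [mul_pow, Real.sq_sqrt (norm_nonneg _), norm_sq_eq (A := A), inner_star]
      refine (norm_innerL_le _ _).trans ?_
      have h1 : ‖(star T).op (T.op x)‖ ≤ ‖star T * T‖ * ‖x‖ := (star T * T).op.le_opNorm x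
      nlinarith [norm_nonneg x]
    have h2 := ContinuousLinearMap.opNorm_le_bound T.op (Real.sqrt_nonneg _) h
    rw [Adjointable.norm_op] at h2
    calc ‖T‖ * ‖T‖ ≤ √‖star T * T‖ * √‖star T * T‖ :=
          mul_le_mul h2 h2 (norm_nonneg _) (Real.sqrt_nonneg _)
      _ = ‖star T * T‖ := Real.mul_self_sqrt (norm_nonneg _)

instance [CompleteSpace E] : CompleteSpace (Adjointable A E) := by
  refine Metric.complete_of_cauchySeq_tendsto fun T hT => ?_
  have h1 : CauchySeq fun n => (T n).op := by
    rw [Metric.cauchySeq_iff] at hT ⊢; exact hT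
  have h2 : CauchySeq fun n => (star (T n)).op := by
    have e : ∀ m n, dist (star (T m)).op (star (T n)).op = dist (T m) (T n) := fun m n => by
      rw [Adjointable.dist_op, dist_eq_norm, dist_eq_norm, ← star_sub, norm_star]
    rw [Metric.cauchySeq_iff] at hT ⊢
    simpa only [e] using hT
  obtain ⟨U, hU⟩ := cauchySeq_tendsto_of_complete h1
  obtain ⟨V, hV⟩ := cauchySeq_tendsto_of_complete h2
  have hUV : ∀ x y, innerL A (U x) y = innerL A x (V y) := fun x y => by
    have ha : Tendsto (fun n => innerL A ((T n).op x) y) atTop (𝓝 (innerL A (U x) y)) :=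
      ((((innerL A (E := E)).flip y).continuous.comp
        (ContinuousLinearMap.apply ℂ E x).continuous).tendsto U).comp hU
    have hb : Tendsto (fun n => innerL A x ((star (T n)).op y)) atTop (𝓝 (innerL A x (V y))) :=
      (((innerL A x).continuous.comp
        (ContinuousLinearMap.apply ℂ E y).continuous).tendsto V).comp hV
    refine tendsto_nhds_unique ha (hb.congr fun n => ?_)
    rw [inner_star]
  have h3 := tendsto_iff_dist_tendsto_zero.1 hU
  refine ⟨⟨U, V, hUV⟩, tendsto_iff_dist_tendsto_zero.2 ?_⟩
  exact h3

/-- The adjointable operators on a Hilbert module form a `C*`-algebra. -/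
instance [CompleteSpace E] : CStarAlgebra (Adjointable A E) where

/-- The rank-one operator `θ_{x, y} : z ↦ x ⟪y, z⟫`. -/
def theta (x y : E) : Adjointable A E :=
  ⟨(rsmulL A x).comp (innerL A y), (rsmulL A y).comp (innerL A x), fun z w => by
    simp [innerL_rsmulL, innerL_rsmulL_left, star_innerL]⟩

lemma theta_op (x y z : E) : (theta (A := A) x y).op z = rsmulL A x (innerL A y z) := rfl

lemma star_theta (x y : E) : star (theta (A := A) x y) = theta y x :=
  star_eq_of_inner fun z w => by
    simp [theta_op, innerL_rsmulL, innerL_rsmulL_left, star_innerL]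

lemma mul_theta (T : Adjointable A E) (x y : E) : T * theta x y = theta (T.op x) y := by
  have hT : ∀ a : A, T.op (rsmulL A x a) = rsmulL A (T.op x) a := fun a =>
    ext_inner (A := A) fun z => by
      have h := inner_star (star T)
      rw [star_star] at h
      rw [← h, innerL_rsmulL, innerL_rsmulL, h]
  exact Adjointable.ext_op fun z => hT _

variable (A E) [CompleteSpace E]

/-- The `*`-algebra of finite-rank operators: the linear span of the rank-one operators. -/
def finiteRank : NonUnitalStarSubalgebra ℂ (Adjointable A E) where
  __ := Submodule.span ℂ (Set.range fun p : E × E => theta (A := A) p.1 p.2)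
  mul_mem' := by
    intro T S _ hS
    induction hS using Submodule.span_induction with
    | mem S hS =>
      obtain ⟨p, rfl⟩ := hS
      rw [mul_theta]
      exact Submodule.subset_span ⟨(T.op p.1, p.2), rfl⟩
    | zero => rw [mul_zero]; exact Submodule.zero_mem _
    | add x y _ _ hx hy => rw [mul_add]; exact Submodule.add_mem _ hx hy
    | smul c x _ hx => rw [mul_smul_comm]; exact Submodule.smul_mem _ _ hx
  star_mem' := by
    intro S hS
    induction hS using Submodule.span_induction with
    | mem S hS =>
      obtain ⟨p, rfl⟩ := hS
      rw [star_theta]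
      exact Submodule.subset_span ⟨(p.2, p.1), rfl⟩
    | zero => rw [star_zero]; exact Submodule.zero_mem _
    | add x y _ _ hx hy => rw [star_add]; exact Submodule.add_mem _ hx hy
    | smul c x _ hx => rw [star_smul]; exact Submodule.smul_mem _ _ hx

/-- The compact operators as a `C*`-subalgebra of the adjointable operators: the norm closure of the
linear span of the rank-one operators. -/
def compacts : NonUnitalStarSubalgebra ℂ (Adjointable A E) := (finiteRank A E).topologicalClosure

instance : IsClosed (compacts A E : Set (Adjointable A E)) :=
  NonUnitalStarSubalgebra.isClosed_topologicalClosure _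

/-- The `C*`-algebra `𝒦(E)` of compact operators on a Hilbert module. -/
def CompactOp : Type _ := compacts A E

instance : NonUnitalCStarAlgebra (CompactOp A E) :=
  inferInstanceAs (NonUnitalCStarAlgebra (compacts A E))

variable {A E}

/-- The underlying bounded operator of a compact operator. -/
def CompactOp.op (T : CompactOp A E) : E →L[ℂ] E := Adjointable.op T.1

variable (A) in
/-- The rank-one operator `θ_{x, y} : z ↦ x ⟪y, z⟫` as an element of `𝒦(E)`. -/
def thetaK (x y : E) : CompactOp A E :=
  ⟨theta x y, subset_closure (Submodule.subset_span ⟨(x, y), rfl⟩)⟩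

lemma thetaK_op (x y z : E) : (thetaK A x y).op z = rsmulL A x (innerL A y z) := rfl

end Operators

end PreHilbertModule

end HilbertModule

/-! ### Completion of a normed `*`-algebra -/

section StarCompletion

open UniformSpace

/-- The completion of a normed `*`-algebra, as a Banach `*`-algebra. -/
def StarCompletion (B : Type*) [SeminormedAddCommGroup B] : Type _ := Completion B

namespace StarCompletion

section Group
variable {B : Type*} [SeminormedAddCommGroup B] [NormedSpace ℂ B]

instance : NormedAddCommGroup (StarCompletion B) := inferInstanceAs (NormedAddCommGroup (Completion B))
instance : NormedSpace ℂ (StarCompletion B) := inferInstanceAs (NormedSpace ℂ (Completion B))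
instance : CompleteSpace (StarCompletion B) := inferInstanceAs (CompleteSpace (Completion B))

/-- The canonical map of a normed `*`-algebra into its completion. -/
def of : B →L[ℂ] StarCompletion B := Completion.toComplL

lemma isUniformInducing_of : IsUniformInducing (of (B := B)) := Completion.isUniformInducing_coe B
lemma denseRange_of : DenseRange (of (B := B)) := Completion.denseRange_coe
lemma norm_of (b : B) : ‖of b‖ = ‖b‖ := Completion.norm_coe b

end Group

variable {B : Type*} [NonUnitalSeminormedRing B] [NormedSpace ℂ B] [IsScalarTower ℂ B B]
  [SMulCommClass ℂ B B]

/-- Continuous extension of the product to the completion. -/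
def mulCompl : StarCompletion B →L[ℂ] StarCompletion B →L[ℂ] StarCompletion B :=
  ((((ContinuousLinearMap.compL ℂ B B (StarCompletion B) of).comp
    (ContinuousLinearMap.mul ℂ B)).extend (of (B := B))).flip.extend (of (B := B))).flip

lemma mulCompl_of (x y : B) : mulCompl (of x) (of y) = of (x * y) := by
  set f := (ContinuousLinearMap.compL ℂ B B (StarCompletion B) of).comp
    (ContinuousLinearMap.mul ℂ B)
  have h1 := ContinuousLinearMap.extend_eq ((f.extend (of (B := B))).flip) denseRange_of
    isUniformInducing_of y
  have h2 := ContinuousLinearMap.extend_eq f denseRange_of isUniformInducing_of x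
  exact (congrArg (fun g => g (of x)) h1).trans (congrArg (fun g => g y) h2)

instance : Mul (StarCompletion B) := ⟨fun x y => mulCompl x y⟩

lemma mul_def (x y : StarCompletion B) : x * y = mulCompl x y := rfl
lemma of_mul (x y : B) : of (x * y) = of x * of y := (mulCompl_of x y).symm

instance : NonUnitalNormedRing (StarCompletion B) where
  __ := (inferInstance : NormedAddCommGroup (StarCompletion B))
  left_distrib x y z := by simp only [mul_def, map_add]
  right_distrib x y z := by simp only [mul_def, map_add, add_apply]
  zero_mul x := by simp only [mul_def, map_zero, zero_apply]
  mul_zero x := by simp only [mul_def, map_zero]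
  mul_assoc x y z := by
    refine denseRange_of.induction_on₃ (p := fun x y z : StarCompletion B => x * y * z = x * (y * z))
      ?_ (fun x y z => by simp only [← of_mul, mul_assoc]) x y z
    simp only [mul_def]
    exact isClosed_eq (by fun_prop) (by fun_prop)
  norm_mul_le x y := by
    refine denseRange_of.induction_on₂ (p := fun x y : StarCompletion B => ‖x * y‖ ≤ ‖x‖ * ‖y‖)
      ?_ (fun x y => by simp only [← of_mul, norm_of]; exact norm_mul_le x y) x y
    simp only [mul_def]
    exact isClosed_le (by fun_prop) (by fun_prop)

instance : IsScalarTower ℂ (StarCompletion B) (StarCompletion B) where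
  smul_assoc c x y := by simp only [smul_eq_mul, mul_def, map_smul, smul_apply]

instance : SMulCommClass ℂ (StarCompletion B) (StarCompletion B) where
  smul_comm c x y := by simp only [smul_eq_mul, mul_def, map_smul]

variable [StarRing B] [StarModule ℂ B] [NormedStarGroup B]

/-- Continuous extension of the involution to the completion. -/
def starCompl : StarCompletion B →L⋆[ℂ] StarCompletion B :=
  ((of (B := B)).comp ((starₗᵢ ℂ : B ≃ₗᵢ⋆[ℂ] B).toContinuousLinearEquiv : B →L⋆[ℂ] B)).extend
    (of (B := B))

lemma starCompl_of (x : B) : starCompl (of x) = of (star x) :=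
  ContinuousLinearMap.extend_eq ((of (B := B)).comp
    ((starₗᵢ ℂ : B ≃ₗᵢ⋆[ℂ] B).toContinuousLinearEquiv : B →L⋆[ℂ] B)) denseRange_of
    isUniformInducing_of x

instance : Star (StarCompletion B) := ⟨fun x => starCompl x⟩

lemma star_def (x : StarCompletion B) : star x = starCompl x := rfl
lemma of_star (x : B) : of (star x) = star (of x) := (starCompl_of x).symm

instance : StarRing (StarCompletion B) where
  star_involutive x := by
    refine denseRange_of.induction_on (p := fun x : StarCompletion B => star (star x) = x) x
      ?_ (fun x => by simp only [← of_star, star_star])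
    simp only [star_def]
    exact isClosed_eq (by fun_prop) (by fun_prop)
  star_mul x y := by
    refine denseRange_of.induction_on₂
      (p := fun x y : StarCompletion B => star (x * y) = star y * star x)
      ?_ (fun x y => by simp only [← of_star, ← of_mul, star_mul]) x y
    simp only [star_def, mul_def]
    exact isClosed_eq (by fun_prop) (by fun_prop)
  star_add x y := by simp only [star_def, map_add]

instance : StarModule ℂ (StarCompletion B) where
  star_smul c x := by simp only [star_def, map_smulₛₗ]; rfl

/-- Extension to the completions of a contractive `*`-homomorphism. -/
def map {B' : Type*} [NonUnitalSeminormedRing B'] [NormedSpace ℂ B'] [IsScalarTower ℂ B' B']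
    [SMulCommClass ℂ B' B'] [StarRing B'] [StarModule ℂ B'] [NormedStarGroup B']
    (φ : B →⋆ₙₐ[ℂ] B') (hφ : ∀ b, ‖φ b‖ ≤ ‖b‖) : StarCompletion B →⋆ₙₐ[ℂ] StarCompletion B' :=
  let f : B →L[ℂ] StarCompletion B' := (of (B := B')).comp
    (LinearMap.mkContinuous (φ : B →ₗ[ℂ] B') 1 fun b => by rw [one_mul]; exact hφ b)
  have hf : ∀ b, f.extend (of (B := B)) (of b) = of (φ b) := fun b =>
    ContinuousLinearMap.extend_eq f denseRange_of isUniformInducing_of b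
  { toFun := f.extend (of (B := B))
    map_smul' := fun c x => map_smul _ c x
    map_zero' := map_zero _
    map_add' := map_add _
    map_mul' := fun x y => by
      refine denseRange_of.induction_on₂ (p := fun x y : StarCompletion B =>
        f.extend (of (B := B)) (x * y) = f.extend (of (B := B)) x * f.extend (of (B := B)) y)
        ?_ (fun x y => by simp only [← of_mul, hf, map_mul]) x y
      simp only [mul_def]
      exact isClosed_eq (by fun_prop) (by fun_prop)
    map_star' := fun x => by
      refine denseRange_of.induction_on (p := fun x : StarCompletion B =>
        f.extend (of (B := B)) (star x) = star (f.extend (of (B := B)) x)) x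
        ?_ (fun x => by simp only [← of_star, hf, map_star])
      simp only [star_def]
      exact isClosed_eq (by fun_prop) (by fun_prop) }

lemma map_of {B' : Type*} [NonUnitalSeminormedRing B'] [NormedSpace ℂ B'] [IsScalarTower ℂ B' B']
    [SMulCommClass ℂ B' B'] [StarRing B'] [StarModule ℂ B'] [NormedStarGroup B']
    (φ : B →⋆ₙₐ[ℂ] B') (hφ : ∀ b, ‖φ b‖ ≤ ‖b‖) (b : B) : map φ hφ (of b) = of (φ b) :=
  ContinuousLinearMap.extend_eq ((of (B := B')).comp
    (LinearMap.mkContinuous (φ : B →ₗ[ℂ] B') 1 fun b => by rw [one_mul]; exact hφ b))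
    denseRange_of isUniformInducing_of b

lemma norm_map_le {B' : Type*} [NonUnitalSeminormedRing B'] [NormedSpace ℂ B']
    [IsScalarTower ℂ B' B'] [SMulCommClass ℂ B' B'] [StarRing B'] [StarModule ℂ B']
    [NormedStarGroup B'] (φ : B →⋆ₙₐ[ℂ] B') (hφ : ∀ b, ‖φ b‖ ≤ ‖b‖) (x : StarCompletion B) :
    ‖map φ hφ x‖ ≤ ‖x‖ := by
  have hc : Continuous (map φ hφ) :=
    (((of (B := B')).comp (LinearMap.mkContinuous (φ : B →ₗ[ℂ] B') 1
      fun b => by rw [one_mul]; exact hφ b)).extend (of (B := B))).continuous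
  refine denseRange_of.induction_on (p := fun x : StarCompletion B => ‖map φ hφ x‖ ≤ ‖x‖) x
    (isClosed_le hc.norm continuous_norm) fun b => ?_
  rw [map_of, norm_of, norm_of]
  exact hφ b

end StarCompletion
end StarCompletion

/-! ### The enveloping `C*`-algebra of a Banach `*`-algebra -/

section Envelope

/-- A `*`-representation of the Banach `*`-algebra `B` on a Hilbert space. (A `*`-representation of
a Banach `*`-algebra with isometric involution is automatically contractive.) -/
structure HilbertRep (B : Type u) [NonUnitalNormedRing B] [NormedSpace ℂ B] [StarRing B] where
  /-- the Hilbert space -/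
  H : Type u
  [instNormed : NormedAddCommGroup H]
  [instInner : InnerProductSpace ℂ H]
  [instComplete : CompleteSpace H]
  /-- the action of `B` on `H` -/
  π : B →⋆ₙₐ[ℂ] (H →L[ℂ] H)
  norm_le (b : B) : ‖π b‖ ≤ ‖b‖

attribute [instance] HilbertRep.instNormed HilbertRep.instInner HilbertRep.instComplete

variable (B : Type u) [NonUnitalNormedRing B] [NormedSpace ℂ B] [StarRing B]

/-- The `C*`-algebra of all bounded families of operators on the Hilbert spaces of all
`*`-representations of `B`. -/
def RepProduct : Type (u + 1) := lp (fun ρ : HilbertRep B => ρ.H →L[ℂ] ρ.H) ∞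

instance : NonUnitalCStarAlgebra (RepProduct B) :=
  inferInstanceAs (NonUnitalCStarAlgebra (lp (fun ρ : HilbertRep B => ρ.H →L[ℂ] ρ.H) ∞))

variable {B}

namespace RepProduct

/-- The component at the representation `ρ`. -/
def comp (x : RepProduct B) (ρ : HilbertRep B) : ρ.H →L[ℂ] ρ.H := x.1 ρ

/-- A bounded family of operators. -/
def mk (x : ∀ ρ : HilbertRep B, ρ.H →L[ℂ] ρ.H) (C : ℝ) (hC : ∀ ρ, ‖x ρ‖ ≤ C) : RepProduct B :=
  ⟨x, memℓp_infty ⟨C, by rintro _ ⟨ρ, rfl⟩; exact hC ρ⟩⟩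

lemma ext {x y : RepProduct B} (h : ∀ ρ, x.comp ρ = y.comp ρ) : x = y :=
  Subtype.ext (funext h)

lemma norm_comp_le (x : RepProduct B) (ρ : HilbertRep B) : ‖x.comp ρ‖ ≤ ‖x‖ :=
  lp.norm_apply_le_norm ENNReal.top_ne_zero x ρ

lemma norm_le {x : RepProduct B} {C : ℝ} (hC : 0 ≤ C) (h : ∀ ρ, ‖x.comp ρ‖ ≤ C) : ‖x‖ ≤ C :=
  lp.norm_le_of_forall_le hC h

end RepProduct

variable (B) in
/-- The universal representation: the direct sum of all `*`-representations of `B`. -/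
def universalRep : B →⋆ₙₐ[ℂ] RepProduct B where
  toFun b := RepProduct.mk (fun ρ => ρ.π b) ‖b‖ fun ρ => ρ.norm_le b
  map_smul' c b := RepProduct.ext fun ρ => map_smul ρ.π c b
  map_zero' := RepProduct.ext fun ρ => map_zero ρ.π
  map_add' a b := RepProduct.ext fun ρ => map_add ρ.π a b
  map_mul' a b := RepProduct.ext fun ρ => map_mul ρ.π a b
  map_star' b := RepProduct.ext fun ρ => map_star ρ.π b

variable (B) in
/-- The enveloping `C*`-algebra `C*(B)`, as the norm closure of the image of `B` in its universal
representation. Thus the norm of (the image of) `b` is the supremum of `‖π b‖` over all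
`*`-representations `π` of `B`. -/
def envelopeSubalgebra : NonUnitalStarSubalgebra ℂ (RepProduct B) :=
  (NonUnitalStarAlgHom.range (universalRep B)).topologicalClosure

instance : IsClosed (envelopeSubalgebra B : Set (RepProduct B)) :=
  NonUnitalStarSubalgebra.isClosed_topologicalClosure _

variable (B) in
/-- The enveloping `C*`-algebra `C*(B)` of the Banach `*`-algebra `B`. -/
def Envelope : Type (u + 1) := envelopeSubalgebra B

instance : NonUnitalCStarAlgebra (Envelope B) :=
  inferInstanceAs (NonUnitalCStarAlgebra (envelopeSubalgebra B))

/-- The inclusion of `C*(B)` into the product of all representations. -/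
def Envelope.subtype : Envelope B →⋆ₙₐ[ℂ] RepProduct B :=
  NonUnitalStarSubalgebraClass.subtype (envelopeSubalgebra B)

/-- Restriction of the codomain of a homomorphism to the enveloping `C*`-algebra. -/
def Envelope.codRestrict {C : Type*} [NonUnitalNonAssocSemiring C] [Module ℂ C] [Star C]
    (φ : C →⋆ₙₐ[ℂ] RepProduct B) (h : ∀ c, φ c ∈ envelopeSubalgebra B) : C →⋆ₙₐ[ℂ] Envelope B :=
  NonUnitalStarAlgHom.codRestrict φ (envelopeSubalgebra B) h

/-- The canonical `*`-homomorphism of `B` into its enveloping `C*`-algebra. -/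
def toEnvelope : B →⋆ₙₐ[ℂ] Envelope B :=
  Envelope.codRestrict (universalRep B) fun b => subset_closure ⟨b, rfl⟩

variable {B' : Type u} [NonUnitalNormedRing B'] [NormedSpace ℂ B'] [StarRing B']

/-- The pull-back of a representation along a contractive `*`-homomorphism. -/
def HilbertRep.comp (ρ : HilbertRep B') (φ : B →⋆ₙₐ[ℂ] B') (hφ : ∀ b, ‖φ b‖ ≤ ‖b‖) :
    HilbertRep B where
  H := ρ.H
  π := ρ.π.comp φ
  norm_le b := (ρ.norm_le _).trans (hφ b)

/-- The map on products of representations induced by pulling back representations. -/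
def repProductMap (φ : B →⋆ₙₐ[ℂ] B') (hφ : ∀ b, ‖φ b‖ ≤ ‖b‖) :
    RepProduct B →⋆ₙₐ[ℂ] RepProduct B' where
  toFun x := RepProduct.mk (fun ρ => x.comp (ρ.comp φ hφ)) ‖x‖ fun ρ =>
    x.norm_comp_le (ρ.comp φ hφ)
  map_smul' _ _ := rfl
  map_zero' := rfl
  map_add' _ _ := rfl
  map_mul' _ _ := rfl
  map_star' _ := rfl

lemma continuous_repProductMap (φ : B →⋆ₙₐ[ℂ] B') (hφ : ∀ b, ‖φ b‖ ≤ ‖b‖) :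
    Continuous (repProductMap φ hφ) :=
  AddMonoidHomClass.continuous_of_bound (repProductMap φ hφ) 1 fun x => by
    rw [one_mul]
    exact RepProduct.norm_le (norm_nonneg _) fun ρ => x.norm_comp_le (ρ.comp φ hφ)

/-- Functoriality of the enveloping `C*`-algebra: the continuous extension of `φ`. -/
def envelopeMap (φ : B →⋆ₙₐ[ℂ] B') (hφ : ∀ b, ‖φ b‖ ≤ ‖b‖) : Envelope B →⋆ₙₐ[ℂ] Envelope B' :=
  Envelope.codRestrict ((repProductMap φ hφ).comp Envelope.subtype) fun x => by
    refine map_mem_closure (f := repProductMap φ hφ)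
      (t := (NonUnitalStarAlgHom.range (universalRep B') : Set (RepProduct B')))
      (continuous_repProductMap φ hφ) x.2 ?_
    rintro _ ⟨b, rfl⟩
    exact ⟨φ b, rfl⟩

lemma envelopeMap_toEnvelope (φ : B →⋆ₙₐ[ℂ] B') (hφ : ∀ b, ‖φ b‖ ≤ ‖b‖) (b : B) :
    envelopeMap φ hφ (toEnvelope b) = toEnvelope (φ b) := rfl

end Envelope

/-- The fibre `p ⁻¹ {t}` of a map `p : T → G` over the point `t`. -/
@[ext]
structure BundleFiber {T : Type v} {G : Type u} (p : T → G) (t : G) where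
  val : T
  proj_val : p val = t

/-- A Fell bundle (`C*`-algebraic bundle in the sense of Fell and Doran) over a topological group:
a Banach bundle `proj : Tot → G` together with a continuous associative multiplication and a
continuous involution covering those of `G`, satisfying the `C*`-axioms. -/
structure FellBundle (G : Type u) [Group G] [TopologicalSpace G] where
  /-- the total space of the bundle -/
  Tot : Type v
  [topTot : TopologicalSpace Tot]
  [semigroupTot : Semigroup Tot]
  [starTot : StarMul Tot]
  /-- the bundle projection -/
  proj : Tot → G
  [normedFiber : ∀ t, NormedAddCommGroup (BundleFiber proj t)]
  [normedSpaceFiber : ∀ t, NormedSpace ℂ (BundleFiber proj t)]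
  [completeFiber : ∀ t, CompleteSpace (BundleFiber proj t)]
  continuous_proj : Continuous proj
  isOpenMap_proj : IsOpenMap proj
  continuous_norm_tot : Continuous fun a : Tot => ‖(⟨a, rfl⟩ : BundleFiber proj (proj a))‖
  continuous_add_tot : Continuous fun x : {x : Tot × Tot // proj x.1 = proj x.2} =>
    ((⟨x.1.1, x.2⟩ : BundleFiber proj (proj x.1.2)) + ⟨x.1.2, rfl⟩).val
  continuous_smul_tot (c : ℂ) : Continuous fun a : Tot =>
    (c • (⟨a, rfl⟩ : BundleFiber proj (proj a))).val
  /-- if `proj aᵢ → t` and `‖aᵢ‖ → 0` then `aᵢ → 0` in the fibre over `t` -/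
  nhds_zero (t : G) : comap proj (𝓝 t) ⊓
    comap (fun a : Tot => ‖(⟨a, rfl⟩ : BundleFiber proj (proj a))‖) (𝓝 0) ≤
      𝓝 (0 : BundleFiber proj t).val
  proj_mul (a b : Tot) : proj (a * b) = proj a * proj b
  proj_star (a : Tot) : proj (star a) = (proj a)⁻¹
  continuous_mul_tot : Continuous fun x : Tot × Tot => x.1 * x.2
  continuous_star_tot : Continuous fun a : Tot => star a
  fib_add_mul {r s : G} (a b : BundleFiber proj r) (c : BundleFiber proj s) :
    (⟨(a + b).val * c.val, by rw [proj_mul, (a + b).2, c.2]⟩ : BundleFiber proj (r * s)) =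
      ⟨a.val * c.val, by rw [proj_mul, a.2, c.2]⟩ + ⟨b.val * c.val, by rw [proj_mul, b.2, c.2]⟩
  fib_mul_add {r s : G} (a : BundleFiber proj r) (b c : BundleFiber proj s) :
    (⟨a.val * (b + c).val, by rw [proj_mul, a.2, (b + c).2]⟩ : BundleFiber proj (r * s)) =
      ⟨a.val * b.val, by rw [proj_mul, a.2, b.2]⟩ + ⟨a.val * c.val, by rw [proj_mul, a.2, c.2]⟩
  fib_smul_mul {r s : G} (z : ℂ) (a : BundleFiber proj r) (b : BundleFiber proj s) :
    (⟨(z • a).val * b.val, by rw [proj_mul, (z • a).2, b.2]⟩ : BundleFiber proj (r * s)) =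
      z • ⟨a.val * b.val, by rw [proj_mul, a.2, b.2]⟩
  fib_mul_smul {r s : G} (z : ℂ) (a : BundleFiber proj r) (b : BundleFiber proj s) :
    (⟨a.val * (z • b).val, by rw [proj_mul, a.2, (z • b).2]⟩ : BundleFiber proj (r * s)) =
      z • ⟨a.val * b.val, by rw [proj_mul, a.2, b.2]⟩
  fib_star_add {r : G} (a b : BundleFiber proj r) :
    (⟨star (a + b).val, by rw [proj_star, (a + b).2]⟩ : BundleFiber proj r⁻¹) =
      ⟨star a.val, by rw [proj_star, a.2]⟩ + ⟨star b.val, by rw [proj_star, b.2]⟩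
  fib_star_smul {r : G} (z : ℂ) (a : BundleFiber proj r) :
    (⟨star (z • a).val, by rw [proj_star, (z • a).2]⟩ : BundleFiber proj r⁻¹) =
      star z • ⟨star a.val, by rw [proj_star, a.2]⟩
  fib_norm_mul_le {r s : G} (a : BundleFiber proj r) (b : BundleFiber proj s) :
    ‖(⟨a.val * b.val, by rw [proj_mul, a.2, b.2]⟩ : BundleFiber proj (r * s))‖ ≤ ‖a‖ * ‖b‖
  fib_norm_star {r : G} (a : BundleFiber proj r) :
    ‖(⟨star a.val, by rw [proj_star, a.2]⟩ : BundleFiber proj r⁻¹)‖ = ‖a‖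
  fib_norm_star_mul_self {r : G} (a : BundleFiber proj r) :
    ‖(⟨star a.val * a.val, by rw [proj_mul, proj_star, a.2, inv_mul_cancel]⟩ :
      BundleFiber proj (1 : G))‖ = ‖a‖ ^ 2
  /-- `a* a` is a positive element of the `C*`-algebra which is the fibre over the unit -/
  fib_star_mul_self_pos {r : G} (a : BundleFiber proj r) :
    ∃ c : BundleFiber proj (1 : G), star a.val * a.val = star c.val * c.val

namespace FellBundle

attribute [instance] FellBundle.topTot FellBundle.semigroupTot FellBundle.starTot
  FellBundle.normedFiber FellBundle.normedSpaceFiber FellBundle.completeFiber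

section Basic

variable {G : Type u} [Group G] [TopologicalSpace G] (𝒜 : FellBundle.{u, v} G)

/-- The fibre `A_t` of the bundle over `t`. -/
abbrev Fiber (t : G) : Type v := BundleFiber 𝒜.proj t

variable {𝒜}

/-- Transport along an equality of base points; the underlying point of the total space is
unchanged. -/
def Fiber.cast {r s : G} (h : r = s) : 𝒜.Fiber r ≃ₗᵢ[ℂ] 𝒜.Fiber s where
  toFun a := ⟨a.val, a.proj_val.trans h⟩
  invFun a := ⟨a.val, a.proj_val.trans h.symm⟩
  map_add' a b := by subst h; rfl
  map_smul' c a := by subst h; rfl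
  left_inv a := rfl
  right_inv a := rfl
  norm_map' a := by subst h; rfl

@[simp] lemma Fiber.cast_val {r s : G} (h : r = s) (a : 𝒜.Fiber r) :
    (Fiber.cast h a).val = a.val := rfl

/-- The bundle multiplication as a bounded bilinear map `A_r × A_s → A_u`, where `u = r s`. -/
def mulL {r s u : G} (h : r * s = u) : 𝒜.Fiber r →L[ℂ] 𝒜.Fiber s →L[ℂ] 𝒜.Fiber u :=
  LinearMap.mkContinuous₂
    (LinearMap.mk₂ ℂ
      (fun a b => (⟨a.val * b.val, by rw [𝒜.proj_mul, a.2, b.2, h]⟩ : 𝒜.Fiber u))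
      (fun a b c => by subst h; exact 𝒜.fib_add_mul a b c)
      (fun z a b => by subst h; exact 𝒜.fib_smul_mul z a b)
      (fun a b c => by subst h; exact 𝒜.fib_mul_add a b c)
      (fun z a b => by subst h; exact 𝒜.fib_mul_smul z a b)) 1
    (fun a b => by subst h; rw [one_mul]; exact 𝒜.fib_norm_mul_le a b)

@[simp] lemma mulL_val {r s u : G} (h : r * s = u) (a : 𝒜.Fiber r) (b : 𝒜.Fiber s) :
    (mulL h a b).val = a.val * b.val := rfl

lemma norm_mulL_le {r s u : G} (h : r * s = u) (a : 𝒜.Fiber r) (b : 𝒜.Fiber s) :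
    ‖mulL h a b‖ ≤ ‖a‖ * ‖b‖ := by subst h; exact 𝒜.fib_norm_mul_le a b

/-- The bundle involution as a conjugate-linear isometry `A_r → A_u`, where `u = r⁻¹`. -/
def starL {r u : G} (h : r⁻¹ = u) : 𝒜.Fiber r →ₗᵢ⋆[ℂ] 𝒜.Fiber u where
  toFun a := ⟨star a.val, by rw [𝒜.proj_star, a.2, h]⟩
  map_add' a b := by subst h; exact 𝒜.fib_star_add a b
  map_smul' c a := by subst h; exact 𝒜.fib_star_smul c a
  norm_map' a := by subst h; exact 𝒜.fib_norm_star a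

@[simp] lemma starL_val {r u : G} (h : r⁻¹ = u) (a : 𝒜.Fiber r) :
    (starL h a).val = star a.val := rfl

/-! ### Continuity of sections along a map -/

lemma norm_mk_val {t : G} (a : 𝒜.Fiber t) :
    ‖(⟨a.val, rfl⟩ : 𝒜.Fiber (𝒜.proj a.val))‖ = ‖a‖ := by
  obtain ⟨a, rfl⟩ := a; rfl

lemma norm_sub_mk {t : G} (a b : 𝒜.Fiber t) :
    ‖(⟨a.val, a.2.trans b.2.symm⟩ : 𝒜.Fiber (𝒜.proj b.val)) - ⟨b.val, rfl⟩‖ = ‖a - b‖ := by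
  obtain ⟨b, rfl⟩ := b; rfl

variable {X : Type*} {φ : X → G} {l : Filter X} {t : G}

lemma tendsto_norm {f : ∀ x, 𝒜.Fiber (φ x)} {a : 𝒜.Fiber t}
    (hf : Tendsto (fun x => (f x).val) l (𝓝 a.val)) : Tendsto (fun x => ‖f x‖) l (𝓝 ‖a‖) := by
  have := (𝒜.continuous_norm_tot.tendsto a.val).comp hf
  simpa only [Function.comp_def, norm_mk_val] using this

lemma add_val_eq {t : G} (a b : 𝒜.Fiber t) :
    ((⟨a.val, a.2.trans b.2.symm⟩ : 𝒜.Fiber (𝒜.proj b.val)) + ⟨b.val, rfl⟩).val = (a + b).val := by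
  obtain ⟨b, rfl⟩ := b; rfl

lemma tendsto_add {f g : ∀ x, 𝒜.Fiber (φ x)} {a b : 𝒜.Fiber t}
    (hf : Tendsto (fun x => (f x).val) l (𝓝 a.val))
    (hg : Tendsto (fun x => (g x).val) l (𝓝 b.val)) :
    Tendsto (fun x => (f x + g x).val) l (𝓝 (a + b).val) := by
  have h1 : Tendsto (fun x => (⟨((f x).val, (g x).val), (f x).2.trans (g x).2.symm⟩ :
      {x : 𝒜.Tot × 𝒜.Tot // 𝒜.proj x.1 = 𝒜.proj x.2})) l
      (𝓝 ⟨(a.val, b.val), a.2.trans b.2.symm⟩) := by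
    rw [tendsto_subtype_rng]; exact hf.prodMk_nhds hg
  have := (𝒜.continuous_add_tot.tendsto _).comp h1
  simpa only [Function.comp_def, add_val_eq] using this

lemma smul_val_eq {t : G} (c : ℂ) (a : 𝒜.Fiber t) :
    (c • (⟨a.val, rfl⟩ : 𝒜.Fiber (𝒜.proj a.val))).val = (c • a).val := by
  obtain ⟨a, rfl⟩ := a; rfl

lemma tendsto_smul (c : ℂ) {f : ∀ x, 𝒜.Fiber (φ x)} {a : 𝒜.Fiber t}
    (hf : Tendsto (fun x => (f x).val) l (𝓝 a.val)) :
    Tendsto (fun x => (c • f x).val) l (𝓝 (c • a).val) := by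
  have := ((𝒜.continuous_smul_tot c).tendsto _).comp hf
  simpa only [Function.comp_def, smul_val_eq] using this

lemma tendsto_sub {f g : ∀ x, 𝒜.Fiber (φ x)} {a b : 𝒜.Fiber t}
    (hf : Tendsto (fun x => (f x).val) l (𝓝 a.val))
    (hg : Tendsto (fun x => (g x).val) l (𝓝 b.val)) :
    Tendsto (fun x => (f x - g x).val) l (𝓝 (a - b).val) := by
  have := tendsto_add hf (tendsto_smul (-1) hg)
  simpa only [neg_smul, one_smul, ← sub_eq_add_neg] using this

lemma tendsto_zero {f : ∀ x, 𝒜.Fiber (φ x)} (hφ : Tendsto φ l (𝓝 t))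
    (hf : Tendsto (fun x => ‖f x‖) l (𝓝 0)) :
    Tendsto (fun x => (f x).val) l (𝓝 (0 : 𝒜.Fiber t).val) := by
  refine Tendsto.mono_right (tendsto_inf.2 ⟨tendsto_comap_iff.2 ?_, tendsto_comap_iff.2 ?_⟩)
    (𝒜.nhds_zero t)
  · simpa only [Function.comp_def, BundleFiber.proj_val] using hφ
  · simpa only [Function.comp_def, norm_mk_val] using hf

variable [TopologicalSpace X]

/-- On a single fibre, the topology of the total space is the norm topology. -/
lemma continuous_val_iff {t : G} {f : X → 𝒜.Fiber t} :
    Continuous (fun x => (f x).val) ↔ Continuous f := by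
  simp only [continuous_iff_continuousAt, ContinuousAt]
  refine forall_congr' fun x₀ => ⟨fun h => ?_, fun h => ?_⟩
  · have := tendsto_norm (tendsto_sub h (tendsto_const_nhds (x := (f x₀).val)))
    rw [sub_self, norm_zero] at this
    exact tendsto_iff_norm_sub_tendsto_zero.2 this
  · have := tendsto_add (tendsto_zero (φ := fun _ => t) tendsto_const_nhds
      (tendsto_iff_norm_sub_tendsto_zero.1 h)) (tendsto_const_nhds (x := (f x₀).val))
    simpa only [sub_add_cancel, zero_add] using this

lemma continuousAt_of_approx {σ : ∀ x, 𝒜.Fiber (φ x)} {x₀ : X} (hφ : ContinuousAt φ x₀)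
    (h : ∀ ε > 0, ∃ τ : ∀ x, 𝒜.Fiber (φ x), ContinuousAt (fun x => (τ x).val) x₀ ∧
      ∀ᶠ x in 𝓝 x₀, ‖σ x - τ x‖ ≤ ε) : ContinuousAt (fun x => (σ x).val) x₀ := by
  rw [ContinuousAt, tendsto_def]
  intro W hW
  -- addition near `(0, σ x₀)`
  have hadd : Tendsto (fun x : {x : 𝒜.Tot × 𝒜.Tot // 𝒜.proj x.1 = 𝒜.proj x.2} =>
      ((⟨x.1.1, x.2⟩ : 𝒜.Fiber (𝒜.proj x.1.2)) + ⟨x.1.2, rfl⟩).val)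
      (𝓝 ⟨((0 : 𝒜.Fiber (φ x₀)).val, (σ x₀).val), (0 : 𝒜.Fiber (φ x₀)).2.trans (σ x₀).2.symm⟩)
      (𝓝 (σ x₀).val) := by
    have := 𝒜.continuous_add_tot.tendsto
      ⟨((0 : 𝒜.Fiber (φ x₀)).val, (σ x₀).val), (0 : 𝒜.Fiber (φ x₀)).2.trans (σ x₀).2.symm⟩
    simpa only [add_val_eq, zero_add] using this
  have h1 := hadd hW
  rw [nhds_subtype_eq_comap, mem_map, mem_comap] at h1
  obtain ⟨S, hS, hSW⟩ := h1
  rw [nhds_prod_eq, mem_prod_iff] at hS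
  obtain ⟨V, hV, U, hU, hVU⟩ := hS
  have hV' := 𝒜.nhds_zero (φ x₀) hV
  rw [mem_inf_iff_superset] at hV'
  obtain ⟨N₁, hN₁, N₂, hN₂, hN⟩ := hV'
  obtain ⟨N, hNt, hNN⟩ := mem_comap.1 hN₁
  obtain ⟨D, hD, hDD⟩ := mem_comap.1 hN₂
  obtain ⟨δ, hδ, hδD⟩ := Metric.mem_nhds_iff.1 hD
  obtain ⟨τ, hτ, hστ⟩ := h (δ / 3) (by positivity)
  -- the norm of the difference near `(τ x₀, σ x₀)`
  have hsub : ∀ᶠ y : {x : 𝒜.Tot × 𝒜.Tot // 𝒜.proj x.1 = 𝒜.proj x.2} in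
      𝓝 ⟨((τ x₀).val, (σ x₀).val), (τ x₀).2.trans (σ x₀).2.symm⟩,
      ‖(⟨y.1.1, y.2⟩ : 𝒜.Fiber (𝒜.proj y.1.2)) - ⟨y.1.2, rfl⟩‖ < 2 * δ / 3 := by
    have h1 : Tendsto (fun y : {x : 𝒜.Tot × 𝒜.Tot // 𝒜.proj x.1 = 𝒜.proj x.2} => y.1.1)
        (𝓝 ⟨((τ x₀).val, (σ x₀).val), (τ x₀).2.trans (σ x₀).2.symm⟩) (𝓝 (τ x₀).val) :=
      (continuous_fst.comp continuous_subtype_val).tendsto _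
    have h2 : Tendsto (fun y : {x : 𝒜.Tot × 𝒜.Tot // 𝒜.proj x.1 = 𝒜.proj x.2} => y.1.2)
        (𝓝 ⟨((τ x₀).val, (σ x₀).val), (τ x₀).2.trans (σ x₀).2.symm⟩) (𝓝 (σ x₀).val) :=
      (continuous_snd.comp continuous_subtype_val).tendsto _
    have h3 := tendsto_norm (tendsto_sub
      (φ := fun y : {x : 𝒜.Tot × 𝒜.Tot // 𝒜.proj x.1 = 𝒜.proj x.2} => 𝒜.proj y.1.2)
      (f := fun y => ⟨y.1.1, y.2⟩) (g := fun y => ⟨y.1.2, rfl⟩) h1 h2)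
    refine h3.eventually (gt_mem_nhds ?_)
    rw [norm_sub_rev]
    exact lt_of_le_of_lt hστ.self_of_nhds (by linarith)
  rw [nhds_subtype_eq_comap, eventually_comap] at hsub
  rw [nhds_prod_eq] at hsub
  obtain ⟨B, hB, U', hU', hBU⟩ := mem_prod_iff.1 hsub
  have hUN : U ∩ U' ∩ 𝒜.proj ⁻¹' N ∈ 𝓝 (σ x₀).val := by
    refine inter_mem (inter_mem hU hU') (𝒜.continuous_proj.continuousAt ?_)
    rw [(σ x₀).2]; exact hNt
  have himg := 𝒜.isOpenMap_proj.image_mem_nhds hUN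
  rw [(σ x₀).2] at himg
  filter_upwards [hφ himg, hτ hB, hστ] with x hx hxB hxε
  obtain ⟨c, ⟨⟨hcU, hcU'⟩, hcN⟩, hc⟩ := hx
  have hlt : ‖τ x - ⟨c, hc⟩‖ < 2 * δ / 3 := by
    have := hBU (Set.mk_mem_prod hxB hcU') ⟨((τ x).val, c), (τ x).2.trans hc.symm⟩ rfl
    rwa [norm_sub_mk (τ x) ⟨c, hc⟩] at this
  have hz : ‖σ x - ⟨c, hc⟩‖ < δ := by
    calc ‖σ x - ⟨c, hc⟩‖ = ‖(σ x - τ x) + (τ x - ⟨c, hc⟩)‖ := by rw [sub_add_sub_cancel]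
      _ ≤ ‖σ x - τ x‖ + ‖τ x - ⟨c, hc⟩‖ := norm_add_le _ _
      _ < δ := by linarith
  have hzV : (σ x - ⟨c, hc⟩).val ∈ V := by
    refine hN ⟨hNN ?_, hDD (hδD ?_)⟩
    · rw [Set.mem_preimage, (σ x - ⟨c, hc⟩).2, ← hc]; exact hcN
    · rw [mem_ball_zero_iff, norm_norm]
      exact (norm_mk_val (σ x - ⟨c, hc⟩)).trans_lt hz
  have hmem := hSW (a := ⟨((σ x - ⟨c, hc⟩).val, c), (σ x - ⟨c, hc⟩).2.trans hc.symm⟩)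
    (hVU (Set.mk_mem_prod hzV hcU))
  have e := add_val_eq (σ x - ⟨c, hc⟩) ⟨c, hc⟩
  rw [sub_add_cancel] at e
  rw [Set.mem_preimage, ← e]
  exact hmem

end Basic

/-! ### Compactly supported continuous sections along a map -/

section Sections

variable {G : Type u} [Group G] [TopologicalSpace G] (𝒜 : FellBundle.{u, v} G)
variable {X : Type*} [TopologicalSpace X]

/-- The space of compactly supported continuous maps `f : X → 𝒜` with `f x ∈ A_{φ x}`. -/
def Cc (φ : C(X, G)) : Submodule ℂ (∀ x, 𝒜.Fiber (φ x)) where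
  carrier := {f | Continuous (fun x => (f x).val) ∧ HasCompactSupport fun x => ‖f x‖}
  zero_mem' := by
    refine ⟨continuous_iff_continuousAt.2 fun x => ?_, ?_⟩
    · exact tendsto_zero (f := fun x => (0 : 𝒜.Fiber (φ x))) (φ.continuous.tendsto x) (by simp)
    · simpa using! HasCompactSupport.zero (α := X) (β := ℝ)
  add_mem' := by
    rintro f g ⟨hf, hf'⟩ ⟨hg, hg'⟩
    refine ⟨continuous_iff_continuousAt.2 fun x => ?_, (hf'.add hg').mono fun x hx => ?_⟩
    · exact tendsto_add (hf.tendsto x) (hg.tendsto x)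
    · contrapose! hx
      simp only [Pi.add_apply, Function.mem_support, not_not] at hx ⊢
      exact le_antisymm ((norm_add_le _ _).trans hx.le) (norm_nonneg _)
  smul_mem' := by
    rintro c f ⟨hf, hf'⟩
    refine ⟨continuous_iff_continuousAt.2 fun x => tendsto_smul c (hf.tendsto x),
      hf'.mono fun x hx => ?_⟩
    contrapose! hx
    simp only [Function.mem_support, not_not] at hx ⊢
    rw [Pi.smul_apply, norm_smul, hx, mul_zero]

variable {𝒜}

lemma continuous_norm_section {φ : X → G} {f : ∀ x, 𝒜.Fiber (φ x)}
    (hf : Continuous fun x => (f x).val) : Continuous fun x => ‖f x‖ :=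
  continuous_iff_continuousAt.2 fun x => tendsto_norm (hf.tendsto x)

variable {Y : Type*} [TopologicalSpace Y] [T2Space Y] [MeasurableSpace Y] [BorelSpace Y]
  {μ : Measure Y} [IsFiniteMeasureOnCompacts μ]

lemma integrable_section {t : G} {f : Y → 𝒜.Fiber t} (hf : Continuous fun y => (f y).val)
    {K : Set Y} (hK : IsCompact K) (h0 : ∀ y, y ∉ K → f y = 0) : Integrable f μ :=
  (continuous_val_iff.1 hf).integrable_of_hasCompactSupport (HasCompactSupport.intro hK h0)

/-- A parametric integral of sections is a continuous section. -/
lemma continuous_integral_section {φ : X → G} (hφ : Continuous φ) {F : ∀ x, Y → 𝒜.Fiber (φ x)}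
    (hF : Continuous fun p : X × Y => (F p.1 p.2).val) {K : Set Y} (hK : IsCompact K)
    (h0 : ∀ x y, y ∉ K → F x y = 0) :
    Continuous fun x => (∫ y, F x y ∂μ).val := by
  refine continuous_iff_continuousAt.2 fun x₀ => continuousAt_of_approx hφ.continuousAt ?_
  have hFy : ∀ y, Continuous fun x => (F x y).val := fun y =>
    hF.comp (Continuous.prodMk continuous_id continuous_const)
  have hFi : ∀ x, Integrable (F x) μ := fun x => integrable_section
    (hF.comp (Continuous.prodMk continuous_const continuous_id)) hK (h0 x)
  intro ε hε
  have hKfin : μ K < ∞ := hK.measure_lt_top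
  set δ : ℝ := ε / (μ.real K + 1) with hδdef
  have hδ : 0 < δ := by positivity
  -- local approximation by step functions
  have key : ∃ S : Set Y, MeasurableSet S ∧ K ⊆ S ∧ ∀ E : Set Y, MeasurableSet E → E ⊆ S → E ⊆ K →
      ∃ τ : ∀ x, 𝒜.Fiber (φ x), ContinuousAt (fun x => (τ x).val) x₀ ∧
        ∀ᶠ x in 𝓝 x₀, ‖(∫ y in E, F x y ∂μ) - τ x‖ ≤ δ * μ.real E := by
    refine hK.induction_on (p := fun T => ∃ S : Set Y, MeasurableSet S ∧ T ⊆ S ∧ ∀ E : Set Y,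
      MeasurableSet E → E ⊆ S → E ⊆ K →
      ∃ τ : ∀ x, 𝒜.Fiber (φ x), ContinuousAt (fun x => (τ x).val) x₀ ∧
        ∀ᶠ x in 𝓝 x₀, ‖(∫ y in E, F x y ∂μ) - τ x‖ ≤ δ * μ.real E) ?_ ?_ ?_ ?_
    · refine ⟨∅, MeasurableSet.empty, subset_rfl, fun E _ hE _ => ⟨fun x => 0, ?_, ?_⟩⟩
      · exact tendsto_zero (f := fun x => (0 : 𝒜.Fiber (φ x))) (hφ.tendsto x₀) (by simp)
      · rw [Set.subset_empty_iff.1 hE]; simp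
    · rintro s t hst ⟨S, hS, htS, h⟩
      exact ⟨S, hS, hst.trans htS, h⟩
    · rintro s t ⟨S, hS, hsS, h⟩ ⟨T, hT, htT, h'⟩
      refine ⟨S ∪ T, hS.union hT, Set.union_subset_union hsS htT, fun E hE hEST hEK => ?_⟩
      obtain ⟨τ, hτ, hτE⟩ := h (E ∩ S) (hE.inter hS) Set.inter_subset_right
        (Set.inter_subset_left.trans hEK)
      obtain ⟨τ', hτ', hτE'⟩ := h' (E \ S) (hE.diff hS)
        (fun y hy => (hEST hy.1).resolve_left hy.2) (Set.sdiff_subset.trans hEK)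
      refine ⟨fun x => τ x + τ' x, tendsto_add hτ hτ', ?_⟩
      filter_upwards [hτE, hτE'] with x h1 h2
      have hfin : μ E ≠ ∞ := ((measure_mono hEK).trans_lt hKfin).ne
      rw [← integral_inter_add_sdiff hS (hFi x).integrableOn, add_sub_add_comm,
        ← measureReal_inter_add_sdiff (s := E) hS hfin, mul_add]
      exact (norm_add_le _ _).trans (add_le_add h1 h2)
    · intro y₀ _
      have hn : Tendsto (fun p : X × Y => ‖F p.1 p.2 - F p.1 y₀‖) (𝓝 (x₀, y₀)) (𝓝 0) := by
        have h2 : Continuous fun p : X × Y => (F p.1 y₀).val := (hFy y₀).comp continuous_fst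
        have := tendsto_norm (φ := fun p : X × Y => φ p.1) (tendsto_sub
          (f := fun p : X × Y => F p.1 p.2) (g := fun p : X × Y => F p.1 y₀)
          (hF.tendsto (x₀, y₀)) (h2.tendsto (x₀, y₀)))
        simpa using this
      have hev := hn.eventually (gt_mem_nhds hδ)
      rw [nhds_prod_eq] at hev
      obtain ⟨N, hN, U, hU, hNU⟩ := mem_prod_iff.1 hev
      obtain ⟨V, hVU, hV, hyV⟩ := mem_nhds_iff.1 hU
      refine ⟨V, mem_nhdsWithin_of_mem_nhds (hV.mem_nhds hyV), V, hV.measurableSet, subset_rfl,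
        fun E hE hEV hEK => ?_⟩
      have hfin : μ E < ∞ := (measure_mono hEK).trans_lt hKfin
      refine ⟨fun x => (μ.real E : ℂ) • F x y₀, tendsto_smul _ ((hFy y₀).tendsto x₀), ?_⟩
      filter_upwards [hN] with x hx
      have hc : ∫ _ in E, F x y₀ ∂μ = (μ.real E : ℂ) • F x y₀ := by
        rw [setIntegral_const, Complex.coe_smul]
      rw [← hc, ← integral_sub (hFi x).integrableOn (integrableOn_const hfin.ne)]
      refine norm_setIntegral_le_of_norm_le_const hfin fun y hy => ?_
      exact (hNU (Set.mk_mem_prod hx (hVU (hEV hy)))).le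
  obtain ⟨S, -, hKS, h⟩ := key
  obtain ⟨τ, hτ, hτK⟩ := h K hK.measurableSet hKS subset_rfl
  refine ⟨τ, hτ, hτK.mono fun x hx => ?_⟩
  rw [setIntegral_eq_integral_of_forall_compl_eq_zero (h0 x)] at hx
  refine hx.trans ?_
  rw [hδdef, div_mul_eq_mul_div, div_le_iff₀ (by positivity)]
  nlinarith [measureReal_nonneg (μ := μ) (s := K)]

end Sections

/-! ### The fibre over the unit as a `C*`-algebra -/

section UnitFiber

variable {G : Type u} [Group G] [TopologicalSpace G] {𝒜 : FellBundle.{u, v} G}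

instance : Mul (𝒜.Fiber 1) := ⟨fun a b => mulL (mul_one 1) a b⟩
instance : Star (𝒜.Fiber 1) := ⟨fun a => starL inv_one a⟩

lemma fiber_mul_def (a b : 𝒜.Fiber 1) : a * b = mulL (mul_one 1) a b := rfl
lemma fiber_star_def (a : 𝒜.Fiber 1) : star a = starL inv_one a := rfl

/-- The fibre `A_e` over the unit, with the operations of the bundle, is a `C*`-algebra. -/
instance : NonUnitalCStarAlgebra (𝒜.Fiber 1) where
  __ := (inferInstance : NormedAddCommGroup (𝒜.Fiber 1))
  __ := (inferInstance : NormedSpace ℂ (𝒜.Fiber 1))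
  __ := (inferInstance : CompleteSpace (𝒜.Fiber 1))
  left_distrib a b c := by simp only [fiber_mul_def, map_add]
  right_distrib a b c := by simp only [fiber_mul_def, map_add, add_apply]
  zero_mul a := by simp only [fiber_mul_def, map_zero, zero_apply]
  mul_zero a := by simp only [fiber_mul_def, map_zero]
  mul_assoc a b c := BundleFiber.ext (mul_assoc a.val b.val c.val)
  norm_mul_le a b := norm_mulL_le _ a b
  star_involutive a := BundleFiber.ext (star_star a.val)
  star_mul a b := BundleFiber.ext (star_mul a.val b.val)
  star_add a b := by simp only [fiber_star_def, map_add]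
  norm_mul_self_le a := by
    have h := 𝒜.fib_norm_star_mul_self a
    rw [← pow_two, ← h]
    exact le_rfl
  smul_assoc c a b := by simp only [smul_eq_mul, fiber_mul_def, map_smul, smul_apply]
  smul_comm c a b := by simp only [smul_eq_mul, fiber_mul_def, map_smul]
  star_smul c a := by simp only [fiber_star_def, map_smulₛₗ]; rfl

end UnitFiber

/-! ### The `*`-algebra of compactly supported continuous kernels -/

section Kernels

variable {G : Type u} [Group G] [TopologicalSpace G] [IsTopologicalGroup G]

variable (G) in
/-- The map `(r, s) ↦ r s⁻¹`. -/
def kerMap : C(G × G, G) := ⟨fun x => x.1 * x.2⁻¹, by fun_prop⟩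

variable (𝒜 : FellBundle.{u, v} G) [MeasurableSpace G]

/-- The space `k_c(𝒜)` of continuous kernels of compact support: compactly supported continuous
maps `k : G × G → 𝒜` such that `k (r, s) ∈ A_{r s⁻¹}`. The product and the norm of kernels depend on
the Haar measure `μ`, which is therefore a parameter. -/
def Kernel (_μ : Measure G) : Type (max u v) := 𝒜.Cc (kerMap G)

namespace Kernel

variable {𝒜} {μ : Measure G}

instance : AddCommGroup (Kernel 𝒜 μ) := inferInstanceAs (AddCommGroup (𝒜.Cc (kerMap G)))
instance : Module ℂ (Kernel 𝒜 μ) := inferInstanceAs (Module ℂ (𝒜.Cc (kerMap G)))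

/-- The value `k (r, s) ∈ A_{r s⁻¹}` of a kernel. -/
def app (k : Kernel 𝒜 μ) (r s : G) : 𝒜.Fiber (r * s⁻¹) := k.1 (r, s)

@[ext] lemma ext {k l : Kernel 𝒜 μ} (h : ∀ r s, k.app r s = l.app r s) : k = l :=
  Subtype.ext (funext fun x => h x.1 x.2)

@[simp] lemma add_app (k l : Kernel 𝒜 μ) (r s : G) : (k + l).app r s = k.app r s + l.app r s := rfl
@[simp] lemma zero_app (r s : G) : (0 : Kernel 𝒜 μ).app r s = 0 := rfl
@[simp] lemma neg_app (k : Kernel 𝒜 μ) (r s : G) : (-k).app r s = -k.app r s := rfl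
@[simp] lemma smul_app (c : ℂ) (k : Kernel 𝒜 μ) (r s : G) : (c • k).app r s = c • k.app r s := rfl

lemma continuous_app (k : Kernel 𝒜 μ) : Continuous fun x : G × G => (k.app x.1 x.2).val := k.2.1

lemma exists_compact (k : Kernel 𝒜 μ) :
    ∃ K : Set G, IsCompact K ∧ ∀ r s, r ∉ K ∨ s ∉ K → k.app r s = 0 := by
  have hc : IsCompact (tsupport fun x : G × G => ‖k.app x.1 x.2‖) := k.2.2
  refine ⟨Prod.fst '' (tsupport fun x : G × G => ‖k.app x.1 x.2‖) ∪
    Prod.snd '' (tsupport fun x : G × G => ‖k.app x.1 x.2‖),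
    (hc.image continuous_fst).union (hc.image continuous_snd), fun r s h => ?_⟩
  by_contra h0
  have hmem : (r, s) ∈ tsupport fun x : G × G => ‖k.app x.1 x.2‖ :=
    subset_closure (by simpa using h0)
  rcases h with h | h
  · exact h (Or.inl ⟨_, hmem, rfl⟩)
  · exact h (Or.inr ⟨_, hmem, rfl⟩)

variable [T2Space G]

/-- Constructor for kernels. -/
def mk' (f : ∀ r s : G, 𝒜.Fiber (r * s⁻¹)) (hf : Continuous fun x : G × G => (f x.1 x.2).val)
    (hK : ∃ K : Set G, IsCompact K ∧ ∀ r s, r ∉ K ∨ s ∉ K → f r s = 0) : Kernel 𝒜 μ :=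
  ⟨fun x => f x.1 x.2, hf, by
    obtain ⟨K, hK, h0⟩ := hK
    refine HasCompactSupport.intro (hK.prod hK) fun x hx => ?_
    rw [Set.mem_prod, not_and_or] at hx
    exact (congrArg norm (h0 x.1 x.2 hx)).trans norm_zero⟩

@[simp] lemma mk'_app (f : ∀ r s : G, 𝒜.Fiber (r * s⁻¹)) (hf hK) (r s : G) :
    (mk' f hf hK : Kernel 𝒜 μ).app r s = f r s := rfl

/-- The involution `k* (r, s) = k (s, r)*`. -/
instance : Star (Kernel 𝒜 μ) where
  star k := mk' (fun r s => starL (by group) (k.app s r))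
    (𝒜.continuous_star_tot.comp (k.continuous_app.comp continuous_swap)) (by
      obtain ⟨K, hK, h0⟩ := k.exists_compact
      exact ⟨K, hK, fun r s h => by rw [h0 s r h.symm, map_zero]⟩)

lemma star_app (k : Kernel 𝒜 μ) (r s : G) :
    (star k).app r s = starL (by group) (k.app s r) := rfl

variable [BorelSpace G] [IsFiniteMeasureOnCompacts μ]

lemma continuous_mul_app (k l : Kernel 𝒜 μ) : Continuous fun p : (G × G) × G =>
    (k.app p.1.1 p.2).val * (l.app p.2 p.1.2).val := by
  refine 𝒜.continuous_mul_tot.comp (Continuous.prodMk ?_ ?_)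
  · exact k.continuous_app.comp
      (Continuous.prodMk (continuous_fst.comp continuous_fst) continuous_snd)
  · exact l.continuous_app.comp
      (Continuous.prodMk continuous_snd (continuous_snd.comp continuous_fst))

/-- The convolution product `(k * l) (r, s) = ∫ k (r, t) l (t, s) dt`. -/
instance : Mul (Kernel 𝒜 μ) where
  mul k l := mk' (fun r s => ∫ t, mulL (by group) (k.app r t) (l.app t s) ∂μ)
    (by
      obtain ⟨K, hK, h0⟩ := k.exists_compact
      refine continuous_integral_section (φ := fun x : G × G => x.1 * x.2⁻¹) (by fun_prop)
        (F := fun x t => mulL (by group) (k.app x.1 t) (l.app t x.2)) ?_ hK ?_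
      · exact continuous_mul_app k l
      · intro x y hy
        rw [h0 _ _ (Or.inr hy), map_zero, zero_apply])
    (by
      obtain ⟨K, hK, h0⟩ := k.exists_compact
      obtain ⟨L, hL, h0'⟩ := l.exists_compact
      refine ⟨K ∪ L, hK.union hL, fun r s h => ?_⟩
      refine integral_eq_zero_of_ae (ae_of_all _ fun t => ?_)
      rcases h with h | h
      · simp [h0 r t (Or.inl fun h' => h (Or.inl h'))]
      · simp [h0' t s (Or.inr fun h' => h (Or.inr h'))])

lemma mul_app (k l : Kernel 𝒜 μ) (r s : G) :
    (k * l).app r s = ∫ t, mulL (by group) (k.app r t) (l.app t s) ∂μ := rfl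

lemma integrable_mul_app (k l : Kernel 𝒜 μ) (r s : G) {u : G} (h : ∀ t, r * t⁻¹ * (t * s⁻¹) = u) :
    Integrable (fun t => mulL (h t) (k.app r t) (l.app t s)) μ := by
  obtain ⟨K, hK, h0⟩ := k.exists_compact
  refine integrable_section ?_ hK fun y hy => ?_
  · exact (continuous_mul_app k l).comp
      (Continuous.prodMk (continuous_const (y := (r, s))) continuous_id)
  · rw [h0 _ _ (Or.inr hy), map_zero, zero_apply]

/-- The real-linear isometry underlying the involution of the bundle. -/
def starR {r u : G} (h : r⁻¹ = u) : 𝒜.Fiber r →L[ℝ] 𝒜.Fiber u :=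
  LinearMap.mkContinuous
    { toFun := fun a => starL h a
      map_add' := fun a b => map_add _ a b
      map_smul' := fun c a => by
        rw [← Complex.coe_smul, map_smulₛₗ, Complex.conj_ofReal, Complex.coe_smul]; rfl } 1
    fun a => by
      rw [one_mul]; exact (LinearIsometry.norm_map (starL h) a).le

lemma mul_assoc_aux (k l m : Kernel 𝒜 μ) : k * l * m = k * (l * m) := by
  ext1 r s
  obtain ⟨K, hK, h0⟩ := k.exists_compact
  obtain ⟨L, hL, h0'⟩ := l.exists_compact
  have e1 : ∀ u, mulL (by group) ((k * l).app r u) (m.app u s) =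
      ∫ t, mulL (by group : r * u⁻¹ * (u * s⁻¹) = r * s⁻¹)
        (mulL (by group) (k.app r t) (l.app t u)) (m.app u s) ∂μ := fun u => by
    rw [mul_app]
    exact (((mulL (by group : r * u⁻¹ * (u * s⁻¹) = r * s⁻¹)).flip
      (m.app u s)).integral_comp_comm (integrable_mul_app k l r u fun t => by group)).symm
  have e2 : ∀ t, mulL (by group) (k.app r t) ((l * m).app t s) =
      ∫ u, mulL (by group : r * t⁻¹ * (t * s⁻¹) = r * s⁻¹) (k.app r t)
        (mulL (by group) (l.app t u) (m.app u s)) ∂μ := fun t => by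
    rw [mul_app]
    exact ((mulL (by group : r * t⁻¹ * (t * s⁻¹) = r * s⁻¹)
      (k.app r t)).integral_comp_comm (integrable_mul_app l m t s fun t => by group)).symm
  rw [mul_app, mul_app]
  simp_rw [e1, e2]
  rw [integral_integral_swap_of_hasCompactSupport]
  · refine integral_congr_ae (ae_of_all _ fun t => integral_congr_ae (ae_of_all _ fun u => ?_))
    exact BundleFiber.ext (mul_assoc _ _ _)
  · refine continuous_val_iff.1 ?_
    refine 𝒜.continuous_mul_tot.comp (Continuous.prodMk (𝒜.continuous_mul_tot.comp
      (Continuous.prodMk ?_ ?_)) ?_)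
    · exact k.continuous_app.comp (Continuous.prodMk continuous_const continuous_snd)
    · exact l.continuous_app.comp (Continuous.prodMk continuous_snd continuous_fst)
    · exact m.continuous_app.comp (Continuous.prodMk continuous_fst continuous_const)
  · refine HasCompactSupport.intro (hL.prod hK) fun x hx => ?_
    rw [Set.mem_prod, not_and_or] at hx
    rcases hx with hx | hx
    · simp [Function.uncurry, h0' x.2 x.1 (Or.inr hx)]
    · simp [Function.uncurry, h0 r x.2 (Or.inr hx)]

instance : NonUnitalRing (Kernel 𝒜 μ) where
  __ := (inferInstance : AddCommGroup (Kernel 𝒜 μ))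
  left_distrib k l m := by
    ext1 r s
    rw [add_app, mul_app, mul_app, mul_app, ← integral_add (integrable_mul_app _ _ _ _ _)
      (integrable_mul_app _ _ _ _ _)]
    simp only [add_app, map_add]
  right_distrib k l m := by
    ext1 r s
    rw [add_app, mul_app, mul_app, mul_app, ← integral_add (integrable_mul_app _ _ _ _ _)
      (integrable_mul_app _ _ _ _ _)]
    simp only [add_app, map_add, _root_.add_apply]
  zero_mul k := by ext1 r s; simp [mul_app]
  mul_zero k := by ext1 r s; simp [mul_app]
  mul_assoc := mul_assoc_aux

instance : StarRing (Kernel 𝒜 μ) where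
  star_involutive k := by
    ext1 r s
    exact BundleFiber.ext (star_star _)
  star_mul k l := by
    ext1 r s
    rw [star_app, mul_app, mul_app]
    refine ((starR (by group)).integral_comp_comm
      (integrable_mul_app k l s r fun t => by group)).symm.trans ?_
    refine integral_congr_ae (ae_of_all _ fun t => ?_)
    exact BundleFiber.ext (star_mul _ _)
  star_add k l := by
    ext1 r s
    simp only [star_app, add_app, map_add]

instance : StarModule ℂ (Kernel 𝒜 μ) where
  star_smul c k := by
    ext1 r s
    simp only [star_app, smul_app, map_smulₛₗ]; rfl

instance : IsScalarTower ℂ (Kernel 𝒜 μ) (Kernel 𝒜 μ) where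
  smul_assoc c k l := by
    ext1 r s
    simp only [smul_eq_mul, mul_app, smul_app, map_smul, _root_.smul_apply, integral_smul]

instance : SMulCommClass ℂ (Kernel 𝒜 μ) (Kernel 𝒜 μ) where
  smul_comm c k l := by
    ext1 r s
    simp only [smul_eq_mul, mul_app, smul_app, map_smul, integral_smul]

end Kernel

end Kernels

/-! ### The Hilbert–Schmidt norm and the modular function -/

section Positive

variable {X : Type*} [TopologicalSpace X]

open CompactlySupported in
/-- The Cauchy–Schwarz inequality for a positive functional. -/
lemma functional_cauchy_schwarz (Λ : C_c(X, ℝ) →ₗ[ℝ] ℝ) (hΛ : ∀ f, (∀ x, 0 ≤ f x) → 0 ≤ Λ f)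
    (f g : C_c(X, ℝ)) : Λ (f * g) ^ 2 ≤ Λ (f * f) * Λ (g * g) := by
  have h : ∀ x : ℝ, 0 ≤ Λ (g * g) * (x * x) + (2 * Λ (f * g)) * x + Λ (f * f) := fun x => by
    have h0 := hΛ ((f + x • g) * (f + x • g)) fun y => mul_self_nonneg _
    have e : (f + x • g) * (f + x • g) = f * f + (2 * x) • (f * g) + (x * x) • (g * g) := by
      ext y
      simp
      ring
    rw [e, map_add, map_add, map_smul, map_smul, smul_eq_mul, smul_eq_mul] at h0
    linarith
  have := discrim_le_zero h
  rw [discrim] at this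
  nlinarith

end Positive

section Haar

variable {G : Type u} [Group G] [TopologicalSpace G] [IsTopologicalGroup G]
  [LocallyCompactSpace G]

/-- The modular function `Δ` of `G`, normalized by `∫ f (r t) dr = Δ(t)⁻¹ ∫ f (r) dr` for a left Haar
measure `dr`. (Mathlib's modular character is the inverse of this one.) -/
def modular (t : G) : ℝ := ((Measure.modularCharacterFun t : ℝ≥0) : ℝ)⁻¹

lemma modular_pos (t : G) : 0 < modular t :=
  inv_pos.2 (NNReal.coe_pos.2 (Measure.modularCharacterFun_pos t))

lemma integral_mul_right_modular [MeasurableSpace G] [BorelSpace G] (μ : Measure G)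
    [μ.IsHaarMeasure] {E : Type*} [NormedAddCommGroup E] [NormedSpace ℝ E] [CompleteSpace E]
    {f : G → E} (hf : Continuous f) (hf' : HasCompactSupport f) (t : G) :
    ∫ r, f (r * t) ∂μ = (modular t)⁻¹ • ∫ r, f r ∂μ := by
  have hft : Continuous fun r => f (r * t) := hf.comp (continuous_mul_const t)
  have hft' : HasCompactSupport fun r => f (r * t) := hf'.comp_homeomorph (Homeomorph.mulRight t)
  refine (SeparatingDual.eq_iff_forall_dual_eq (R := ℝ)).2 fun L => ?_
  rw [map_smul, ← L.integral_comp_comm (hft.integrable_of_hasCompactSupport hft'),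
    ← L.integral_comp_comm (hf.integrable_of_hasCompactSupport hf')]
  have hg : Continuous fun r => L (f r) := L.continuous.comp hf
  have hg' : HasCompactSupport fun r => L (f r) := hf'.comp_left (map_zero L)
  have h1 : ∫ r, L (f (r * t)) ∂μ = ∫ r, L (f r) ∂(Measure.map (· * t) μ) :=
    (integral_map (continuous_mul_const t).aemeasurable hg.aestronglyMeasurable).symm
  rw [h1, Measure.integral_isMulLeftInvariant_eq_smul_of_hasCompactSupport _ μ hg hg',
    integral_smul_nnreal_measure, ← Measure.modularCharacterFun_eq_haarScalarFactor, modular,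
    inv_inv]
  rfl

end Haar

section HilbertSchmidt

variable {G : Type u} [Group G] [TopologicalSpace G] [IsTopologicalGroup G]
  [T2Space G] [MeasurableSpace G] [BorelSpace G] {𝒜 : FellBundle.{u, v} G}
  {μ : Measure G} [IsFiniteMeasureOnCompacts μ]

open CompactlySupported

lemma compl_of_cc (f : C_c(G × G, ℝ)) :
    ∃ K : Set G, IsCompact K ∧ ∀ r s, r ∉ K ∨ s ∉ K → f (r, s) = 0 := by
  have hc : IsCompact (tsupport f) := f.hasCompactSupport
  refine ⟨Prod.fst '' tsupport f ∪ Prod.snd '' tsupport f,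
    (hc.image continuous_fst).union (hc.image continuous_snd), fun r s h => ?_⟩
  by_contra h0
  have hmem : (r, s) ∈ tsupport f := subset_closure h0
  rcases h with h | h
  · exact h (Or.inl ⟨_, hmem, rfl⟩)
  · exact h (Or.inr ⟨_, hmem, rfl⟩)

lemma integrable_cc_right (f : C_c(G × G, ℝ)) (r : G) : Integrable (fun s => f (r, s)) μ := by
  obtain ⟨K, hK, h0⟩ := compl_of_cc f
  exact (f.continuous.comp (Continuous.prodMk continuous_const continuous_id)
    ).integrable_of_hasCompactSupport (HasCompactSupport.intro hK fun s hs => h0 r s (Or.inr hs))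

lemma continuous_cc_integral (f : C_c(G × G, ℝ)) : Continuous fun r => ∫ s, f (r, s) ∂μ := by
  obtain ⟨K, hK, h0⟩ := compl_of_cc f
  rw [← continuousOn_univ]
  exact continuousOn_integral_of_compact_support hK f.continuous.continuousOn
    fun r s _ hs => h0 r s (Or.inr hs)

lemma hasCompactSupport_cc_integral (f : C_c(G × G, ℝ)) :
    HasCompactSupport fun r => ∫ s, f (r, s) ∂μ := by
  obtain ⟨K, hK, h0⟩ := compl_of_cc f
  refine HasCompactSupport.intro hK fun r hr => ?_
  simp [h0 r _ (Or.inl hr)]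

lemma integrable_cc_integral (f : C_c(G × G, ℝ)) : Integrable (fun r => ∫ s, f (r, s) ∂μ) μ :=
  (continuous_cc_integral f).integrable_of_hasCompactSupport (hasCompactSupport_cc_integral f)

variable (μ) in
/-- Integration over `G × G` of compactly supported continuous functions. -/
def integral₂ : C_c(G × G, ℝ) →ₗ[ℝ] ℝ where
  toFun f := ∫ r, ∫ s, f (r, s) ∂μ ∂μ
  map_add' f g := by
    rw [← integral_add (integrable_cc_integral f) (integrable_cc_integral g)]
    refine integral_congr_ae (ae_of_all _ fun r => ?_)
    exact integral_add (integrable_cc_right f r) (integrable_cc_right g r)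
  map_smul' c f := by
    simp [integral_const_mul]

variable (μ) in
/-- Integration over `G` of compactly supported continuous functions. -/
def integral₁ : C_c(G, ℝ) →ₗ[ℝ] ℝ where
  toFun f := ∫ r, f r ∂μ
  map_add' f g := integral_add (f.continuous.integrable_of_hasCompactSupport f.hasCompactSupport)
    (g.continuous.integrable_of_hasCompactSupport g.hasCompactSupport)
  map_smul' c f := by simp [integral_const_mul]

lemma integral₂_nonneg (f : C_c(G × G, ℝ)) (hf : ∀ x, 0 ≤ f x) : 0 ≤ integral₂ μ f :=
  integral_nonneg fun r => integral_nonneg fun s => hf (r, s)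

lemma integral₂_mono {f g : C_c(G × G, ℝ)} (h : ∀ x, f x ≤ g x) :
    integral₂ μ f ≤ integral₂ μ g := by
  have := integral₂_nonneg (μ := μ) (g - f) fun x => by simpa using h x
  rw [map_sub] at this
  linarith

namespace Kernel

/-- The function `(r, s) ↦ ‖k (r, s)‖`. -/
def normFn (k : Kernel 𝒜 μ) : C_c(G × G, ℝ) where
  toFun x := ‖k.app x.1 x.2‖
  continuous_toFun := continuous_norm_section (φ := fun x : G × G => x.1 * x.2⁻¹)
    (f := fun x => k.app x.1 x.2) k.continuous_app
  hasCompactSupport' := k.2.2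

lemma normFn_apply (k : Kernel 𝒜 μ) (r s : G) : k.normFn (r, s) = ‖k.app r s‖ := rfl

/-- The Hilbert–Schmidt norm `‖k‖₂ = (∫∫ ‖k (r, s)‖² dr ds) ^ (1 / 2)`. -/
def hsNorm (k : Kernel 𝒜 μ) : ℝ := √(∫ r, ∫ s, ‖k.app r s‖ ^ 2 ∂μ ∂μ)

lemma integral₂_normFn (k : Kernel 𝒜 μ) :
    integral₂ μ (k.normFn * k.normFn) = ∫ r, ∫ s, ‖k.app r s‖ ^ 2 ∂μ ∂μ := by
  simp [integral₂, normFn_apply, pow_two]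

lemma hsNorm_sq (k : Kernel 𝒜 μ) : k.hsNorm ^ 2 = integral₂ μ (k.normFn * k.normFn) := by
  rw [integral₂_normFn, hsNorm, Real.sq_sqrt]
  exact integral_nonneg fun r => integral_nonneg fun s => sq_nonneg _

lemma hsNorm_nonneg (k : Kernel 𝒜 μ) : 0 ≤ k.hsNorm := Real.sqrt_nonneg _

lemma hsNorm_add_le (k l : Kernel 𝒜 μ) : (k + l).hsNorm ≤ k.hsNorm + l.hsNorm := by
  refine le_of_sq_le_sq ?_ (add_nonneg k.hsNorm_nonneg l.hsNorm_nonneg)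
  have hcs := functional_cauchy_schwarz (integral₂ μ) integral₂_nonneg k.normFn l.normFn
  rw [← hsNorm_sq, ← hsNorm_sq, ← mul_pow] at hcs
  have hcs' := abs_le_of_sq_le_sq hcs (mul_nonneg k.hsNorm_nonneg l.hsNorm_nonneg)
  have hle : integral₂ μ ((k + l).normFn * (k + l).normFn) ≤
      integral₂ μ (k.normFn * k.normFn + (2 : ℝ) • (k.normFn * l.normFn) +
        l.normFn * l.normFn) := by
    refine integral₂_mono fun x => ?_
    have h1 : ‖k.app x.1 x.2 + l.app x.1 x.2‖ ≤ ‖k.app x.1 x.2‖ + ‖l.app x.1 x.2‖ :=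
      norm_add_le _ _
    have h2 := norm_nonneg (k.app x.1 x.2 + l.app x.1 x.2)
    change ‖k.app x.1 x.2 + l.app x.1 x.2‖ * ‖k.app x.1 x.2 + l.app x.1 x.2‖ ≤
      ‖k.app x.1 x.2‖ * ‖k.app x.1 x.2‖ + 2 * (‖k.app x.1 x.2‖ * ‖l.app x.1 x.2‖) +
        ‖l.app x.1 x.2‖ * ‖l.app x.1 x.2‖
    nlinarith
  rw [map_add, map_add, map_smul, smul_eq_mul, ← hsNorm_sq, ← hsNorm_sq, ← hsNorm_sq] at hle
  nlinarith [le_of_abs_le hcs']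

lemma hsNorm_smul (c : ℂ) (k : Kernel 𝒜 μ) : (c • k).hsNorm = ‖c‖ * k.hsNorm := by
  rw [hsNorm, hsNorm]
  simp_rw [smul_app, norm_smul, mul_pow, integral_const_mul]
  rw [Real.sqrt_mul (sq_nonneg _), Real.sqrt_sq (norm_nonneg _)]

lemma integral_swap_normFn (k : Kernel 𝒜 μ) :
    ∫ r, ∫ s, ‖k.app s r‖ ^ 2 ∂μ ∂μ = ∫ r, ∫ s, ‖k.app r s‖ ^ 2 ∂μ ∂μ := by
  refine integral_integral_swap_of_hasCompactSupport
    (f := fun r s => ‖k.app s r‖ ^ 2) ?_ ?_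
  · exact (k.normFn.continuous.comp continuous_swap).pow 2
  · obtain ⟨K, hK, h0⟩ := k.exists_compact
    refine HasCompactSupport.intro (hK.prod hK) fun x hx => ?_
    rw [Set.mem_prod, not_and_or] at hx
    simp [Function.uncurry, h0 x.2 x.1 hx.symm]

lemma hsNorm_star (k : Kernel 𝒜 μ) : (star k).hsNorm = k.hsNorm := by
  rw [hsNorm, hsNorm, ← integral_swap_normFn k]
  simp only [star_app, LinearIsometry.norm_map]

lemma sq_norm_mul_app_le (k l : Kernel 𝒜 μ) (r s : G) : ‖(k * l).app r s‖ ^ 2 ≤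
    (∫ t, ‖k.app r t‖ ^ 2 ∂μ) * ∫ t, ‖l.app t s‖ ^ 2 ∂μ := by
  obtain ⟨K, hK, h0⟩ := k.exists_compact
  obtain ⟨L, hL, h0'⟩ := l.exists_compact
  let f : C_c(G, ℝ) := ⟨⟨fun t => ‖k.app r t‖,
    k.normFn.continuous.comp (Continuous.prodMk continuous_const continuous_id)⟩,
    HasCompactSupport.intro hK fun t ht => by simp [h0 r t (Or.inr ht)]⟩
  let g : C_c(G, ℝ) := ⟨⟨fun t => ‖l.app t s‖,
    l.normFn.continuous.comp (Continuous.prodMk continuous_id continuous_const)⟩,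
    HasCompactSupport.intro hL fun t ht => by simp [h0' t s (Or.inl ht)]⟩
  have hcs := functional_cauchy_schwarz (integral₁ μ)
    (fun f hf => integral_nonneg fun t => hf t) f g
  have e1 : integral₁ μ (f * f) = ∫ t, ‖k.app r t‖ ^ 2 ∂μ := by
    simp only [pow_two]; rfl
  have e2 : integral₁ μ (g * g) = ∫ t, ‖l.app t s‖ ^ 2 ∂μ := by
    simp only [pow_two]; rfl
  rw [e1, e2] at hcs
  refine le_trans (pow_le_pow_left₀ (norm_nonneg _) ?_ 2) hcs
  rw [mul_app]
  refine norm_integral_le_of_norm_le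
    ((f * g).continuous.integrable_of_hasCompactSupport (f * g).hasCompactSupport)
    (ae_of_all _ fun t => ?_)
  exact norm_mulL_le _ _ _

lemma hsNorm_mul_le (k l : Kernel 𝒜 μ) : (k * l).hsNorm ≤ k.hsNorm * l.hsNorm := by
  refine le_of_sq_le_sq ?_ (mul_nonneg k.hsNorm_nonneg l.hsNorm_nonneg)
  rw [mul_pow, hsNorm_sq, hsNorm_sq, hsNorm_sq, integral₂_normFn, integral₂_normFn k,
    integral₂_normFn l, ← integral_swap_normFn l]
  have hi : ∀ m : Kernel 𝒜 μ, Integrable (fun r => ∫ s, ‖m.app r s‖ ^ 2 ∂μ) μ := fun m => by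
    have := integrable_cc_integral (μ := μ) (m.normFn * m.normFn)
    simpa [normFn_apply, ← pow_two] using this
  have hj : ∀ (m : Kernel 𝒜 μ) (r : G), Integrable (fun s => ‖m.app r s‖ ^ 2) μ := fun m r => by
    have := integrable_cc_right (μ := μ) (m.normFn * m.normFn) r
    simpa [normFn_apply, ← pow_two] using this
  have hl : Integrable (fun s => ∫ t, ‖l.app t s‖ ^ 2 ∂μ) μ := by
    have := hi (star l)
    simpa only [star_app, LinearIsometry.norm_map] using this
  rw [← integral_mul_const]
  refine integral_mono (hi _) ((hi k).mul_const _) fun r => ?_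
  dsimp only
  rw [← integral_const_mul]
  exact integral_mono (hj _ r) (hl.const_mul _) fun s => sq_norm_mul_app_le k l r s

instance : NonUnitalSeminormedRing (Kernel 𝒜 μ) where
  __ := (inferInstance : NonUnitalRing (Kernel 𝒜 μ))
  __ := AddGroupSeminorm.toSeminormedAddCommGroup (E := Kernel 𝒜 μ)
    { toFun := hsNorm
      map_zero' := by simp [hsNorm]
      add_le' := hsNorm_add_le
      neg' := fun k => by simp [hsNorm] }
  norm_mul_le := hsNorm_mul_le

lemma norm_def (k : Kernel 𝒜 μ) : ‖k‖ = √(∫ r, ∫ s, ‖k.app r s‖ ^ 2 ∂μ ∂μ) := rfl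

instance : NormedSpace ℂ (Kernel 𝒜 μ) where
  norm_smul_le c k := (hsNorm_smul c k).le

instance : NormedStarGroup (Kernel 𝒜 μ) where
  norm_star_le k := (hsNorm_star k).le

end Kernel

variable (𝒜 μ)

/-- The Banach `*`-algebra `HS(𝒜)` of Hilbert–Schmidt kernels: the completion of `k_c(𝒜)` for
`‖·‖₂`. -/
abbrev HS : Type (max u v) := StarCompletion (Kernel 𝒜 μ)

/-- The `C*`-algebra of kernels `k(𝒜) = C*(HS(𝒜))`. -/
abbrev KernelAlgebra : Type (max u v + 1) := Envelope (HS 𝒜 μ)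

variable {𝒜 μ}

/-- The canonical map `k_c(𝒜) → k(𝒜)`. -/
def Kernel.toAlgebra (k : Kernel 𝒜 μ) : KernelAlgebra 𝒜 μ := toEnvelope (StarCompletion.of k)

end HilbertSchmidt

/-! ### The canonical action -/

section Action

variable {G : Type u} [Group G] [TopologicalSpace G] [IsTopologicalGroup G]
  [LocallyCompactSpace G] [T2Space G] [MeasurableSpace G] [BorelSpace G]
  {𝒜 : FellBundle.{u, v} G} {μ : Measure G}

/-- The kernel `β_t(k) (r, s) = Δ(t) k (r t, s t)`. -/
def Kernel.translate (t : G) (k : Kernel 𝒜 μ) : Kernel 𝒜 μ :=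
  .mk' (fun r s => (modular t : ℂ) • Fiber.cast (by group) (k.app (r * t) (s * t)))
    (by
      have h : Continuous fun x : G × G => (k.app (x.1 * t) (x.2 * t)).val :=
        k.continuous_app.comp (Continuous.prodMk (by fun_prop) (by fun_prop))
      refine continuous_iff_continuousAt.2 fun x => ?_
      exact tendsto_smul (φ := fun x : G × G => x.1 * x.2⁻¹)
        (f := fun x => Fiber.cast (by group) (k.app (x.1 * t) (x.2 * t)))
        (a := Fiber.cast (by group) (k.app (x.1 * t) (x.2 * t))) _ (h.tendsto x))
    (by
      obtain ⟨K, hK, h0⟩ := k.exists_compact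
      refine ⟨(fun r => r * t⁻¹) '' K, hK.image (continuous_mul_const _), fun r s h => ?_⟩
      rw [h0, map_zero, smul_zero]
      refine h.imp (fun h h' => h ⟨_, h', by group⟩) (fun h h' => h ⟨_, h', by group⟩))

lemma Kernel.translate_app (t : G) (k : Kernel 𝒜 μ) (r s : G) : (k.translate t).app r s =
    (modular t : ℂ) • Fiber.cast (by group) (k.app (r * t) (s * t)) := rfl

variable [μ.IsHaarMeasure]

variable (𝒜 μ) in
/-- `β_t` as a `*`-homomorphism of `k_c(𝒜)`. -/
def translateHom (t : G) : Kernel 𝒜 μ →⋆ₙₐ[ℂ] Kernel 𝒜 μ where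
  toFun := Kernel.translate t
  map_smul' c k := by
    ext1 r s
    simp only [Kernel.translate_app, Kernel.smul_app, map_smul, MonoidHom.id_apply]
    exact smul_comm _ _ _
  map_zero' := by ext1 r s; simp [Kernel.translate_app]
  map_add' k l := by
    ext1 r s
    simp only [Kernel.translate_app, Kernel.add_app, map_add, smul_add]
  map_mul' k l := by
    ext1 r s
    obtain ⟨K, hK, h0⟩ := k.exists_compact
    have hΔ := (modular_pos t).ne'
    have h1 := integral_mul_right_modular μ
      (f := fun u => mulL (by group : r * t * u⁻¹ * (u * (s * t)⁻¹) = r * s⁻¹)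
        (k.app (r * t) u) (l.app u (s * t)))
      (continuous_val_iff.1 ((Kernel.continuous_mul_app k l).comp
        (Continuous.prodMk (continuous_const (y := (r * t, s * t))) continuous_id)))
      (HasCompactSupport.intro hK fun u hu => by simp [h0 _ _ (Or.inr hu)]) t
    rw [Kernel.translate_app, Kernel.mul_app, Kernel.mul_app]
    have h2 : Fiber.cast (by group) (∫ u, mulL (by group :
        r * t * u⁻¹ * (u * (s * t)⁻¹) = r * t * (s * t)⁻¹)
        (k.app (r * t) u) (l.app u (s * t)) ∂μ) =
        ∫ u, mulL (by group : r * t * u⁻¹ * (u * (s * t)⁻¹) = r * s⁻¹)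
        (k.app (r * t) u) (l.app u (s * t)) ∂μ :=
      ((Fiber.cast (𝒜 := 𝒜) (by group : r * t * (s * t)⁻¹ = r * s⁻¹)
        ).toContinuousLinearEquiv.toContinuousLinearMap.integral_comp_comm
        (Kernel.integrable_mul_app k l (r * t) (s * t) fun u => by group)).symm
    rw [h2]
    have h3 : ∫ u, mulL (by group : r * u⁻¹ * (u * s⁻¹) = r * s⁻¹)
        ((k.translate t).app r u) ((l.translate t).app u s) ∂μ =
        ((modular t : ℂ) * modular t) • ∫ u, mulL (by group :
          r * t * (u * t)⁻¹ * (u * t * (s * t)⁻¹) = r * s⁻¹)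
        (k.app (r * t) (u * t)) (l.app (u * t) (s * t)) ∂μ := by
      rw [← integral_smul]
      refine integral_congr_ae (ae_of_all _ fun u => ?_)
      simp only [Kernel.translate_app, map_smul, smul_apply, smul_smul]
      rfl
    rw [h3, h1, ← Complex.coe_smul, smul_smul]
    congr 1
    push_cast
    have : (modular t : ℂ) ≠ 0 := by exact_mod_cast hΔ
    field_simp
  map_star' k := by
    ext1 r s
    simp only [Kernel.translate_app, Kernel.star_app, map_smulₛₗ, Complex.conj_ofReal]
    rfl

lemma norm_translateHom (t : G) (k : Kernel 𝒜 μ) : ‖translateHom 𝒜 μ t k‖ = ‖k‖ := by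
  have hΔ := (modular_pos t).ne'
  rw [Kernel.norm_def, Kernel.norm_def]
  congr 1
  have e : ∀ r s, ‖(translateHom 𝒜 μ t k).app r s‖ ^ 2 =
      modular t ^ 2 * ‖k.app (r * t) (s * t)‖ ^ 2 := fun r s => by
    change ‖(k.translate t).app r s‖ ^ 2 = _
    rw [Kernel.translate_app, norm_smul, LinearIsometryEquiv.norm_map, mul_pow, Complex.norm_real,
      Real.norm_of_nonneg (modular_pos t).le]
  simp_rw [e, integral_const_mul]
  have h1 : ∀ r, ∫ s, ‖k.app r (s * t)‖ ^ 2 ∂μ = (modular t)⁻¹ * ∫ s, ‖k.app r s‖ ^ 2 ∂μ := by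
    intro r
    obtain ⟨K, hK, h0⟩ := k.exists_compact
    exact integral_mul_right_modular μ (f := fun s => ‖k.app r s‖ ^ 2)
      ((k.normFn.continuous.comp (Continuous.prodMk continuous_const continuous_id)).pow 2)
      (HasCompactSupport.intro hK fun u hu => by simp [h0 _ _ (Or.inr hu)]) t
  simp_rw [h1, integral_const_mul]
  have h2 := integral_mul_right_modular μ (f := fun r => ∫ s, ‖k.app r s‖ ^ 2 ∂μ)
    (by simpa [Kernel.normFn_apply, ← pow_two] using
      continuous_cc_integral (μ := μ) (k.normFn * k.normFn))
    (by simpa [Kernel.normFn_apply, ← pow_two] using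
      hasCompactSupport_cc_integral (μ := μ) (k.normFn * k.normFn)) t
  rw [h2, smul_eq_mul]
  field_simp

variable (𝒜 μ) in
/-- `β_t` as a `*`-homomorphism of `HS(𝒜)`, extended by continuity. -/
def actionHS (t : G) : HS 𝒜 μ →⋆ₙₐ[ℂ] HS 𝒜 μ :=
  StarCompletion.map (translateHom 𝒜 μ t) fun k => (norm_translateHom t k).le

lemma norm_actionHS_le (t : G) (x : HS 𝒜 μ) : ‖actionHS 𝒜 μ t x‖ ≤ ‖x‖ :=
  StarCompletion.norm_map_le _ _ x

variable (𝒜 μ) in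
/-- The canonical action `β` of `G` on the `C*`-algebra of kernels `k(𝒜)`. -/
def action (t : G) : KernelAlgebra 𝒜 μ →⋆ₙₐ[ℂ] KernelAlgebra 𝒜 μ :=
  envelopeMap (actionHS 𝒜 μ t) (norm_actionHS_le t)

lemma action_toAlgebra (t : G) (k : Kernel 𝒜 μ) :
    action 𝒜 μ t k.toAlgebra = (k.translate t).toAlgebra := by
  refine (envelopeMap_toEnvelope (actionHS 𝒜 μ t) (norm_actionHS_le t) (.of k)).trans ?_
  exact congrArg toEnvelope (StarCompletion.map_of (translateHom 𝒜 μ t) _ k)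

end Action

/-! ### The Hilbert modules `L²_t(𝒜)` -/

section HilbertModules

variable {G : Type u} [Group G] [TopologicalSpace G] [IsTopologicalGroup G]

/-- The right translation `r ↦ r t`. -/
def transMap (t : G) : C(G, G) := ⟨fun r => r * t, by fun_prop⟩

variable (𝒜 : FellBundle.{u, v} G) [MeasurableSpace G]

/-- The space `C_c^t(𝒜)` of compactly supported continuous maps `ξ : G → 𝒜` with
`ξ r ∈ A_{r t}`. -/
def CcT (_μ : Measure G) (t : G) : Type (max u v) := 𝒜.Cc (transMap t)

namespace CcT

variable {𝒜} {μ : Measure G} {t : G}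

instance : AddCommGroup (CcT 𝒜 μ t) := inferInstanceAs (AddCommGroup (𝒜.Cc (transMap t)))
instance : Module ℂ (CcT 𝒜 μ t) := inferInstanceAs (Module ℂ (𝒜.Cc (transMap t)))

/-- The value `ξ r ∈ A_{r t}`. -/
def app (ξ : CcT 𝒜 μ t) (r : G) : 𝒜.Fiber (r * t) := ξ.1 r

@[ext] lemma ext {ξ η : CcT 𝒜 μ t} (h : ∀ r, ξ.app r = η.app r) : ξ = η :=
  Subtype.ext (funext h)

@[simp] lemma add_app (ξ η : CcT 𝒜 μ t) (r : G) : (ξ + η).app r = ξ.app r + η.app r := rfl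
@[simp] lemma smul_app (c : ℂ) (ξ : CcT 𝒜 μ t) (r : G) : (c • ξ).app r = c • ξ.app r := rfl

lemma continuous_app (ξ : CcT 𝒜 μ t) : Continuous fun r => (ξ.app r).val := ξ.2.1

lemma exists_compact (ξ : CcT 𝒜 μ t) : ∃ K : Set G, IsCompact K ∧ ∀ r, r ∉ K → ξ.app r = 0 := by
  refine ⟨tsupport fun r => ‖ξ.app r‖, ξ.2.2, fun r hr => ?_⟩
  by_contra h0
  exact hr (subset_closure (by simpa using h0))

/-- Constructor for elements of `C_c^t(𝒜)`. -/
def mk' (f : ∀ r : G, 𝒜.Fiber (r * t)) (hf : Continuous fun r => (f r).val)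
    (hK : ∃ K : Set G, IsCompact K ∧ ∀ r, r ∉ K → f r = 0) : CcT 𝒜 μ t :=
  ⟨f, hf, by
    obtain ⟨K, hK, h0⟩ := hK
    exact HasCompactSupport.intro hK fun r hr => (congrArg norm (h0 r hr)).trans norm_zero⟩

/-- The right action `(ξ a) r = ξ r a` of `A_e`. -/
def rsmul (ξ : CcT 𝒜 μ t) (a : 𝒜.Fiber 1) : CcT 𝒜 μ t :=
  mk' (fun r => mulL (mul_one _) (ξ.app r) a)
    (𝒜.continuous_mul_tot.comp (Continuous.prodMk ξ.continuous_app continuous_const)) (by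
      obtain ⟨K, hK, h0⟩ := ξ.exists_compact
      exact ⟨K, hK, fun r hr => by simp [h0 r hr]⟩)

lemma rsmul_app (ξ : CcT 𝒜 μ t) (a : 𝒜.Fiber 1) (r : G) :
    (ξ.rsmul a).app r = mulL (mul_one _) (ξ.app r) a := rfl

/-- The `A_e`-valued inner product `⟪ξ, η⟫ = ∫ ξ(r)* η(r) dr`. -/
def inner (ξ η : CcT 𝒜 μ t) : 𝒜.Fiber 1 :=
  ∫ r, mulL (inv_mul_cancel (r * t)) (starL rfl (ξ.app r)) (η.app r) ∂μ

variable [T2Space G] [BorelSpace G] [IsFiniteMeasureOnCompacts μ]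

lemma integrable_inner (ξ η : CcT 𝒜 μ t) :
    Integrable (fun r => mulL (inv_mul_cancel (r * t)) (starL rfl (ξ.app r)) (η.app r)) μ := by
  obtain ⟨K, hK, h0⟩ := ξ.exists_compact
  refine integrable_section ?_ hK fun y hy => ?_
  · exact 𝒜.continuous_mul_tot.comp
      (Continuous.prodMk (𝒜.continuous_star_tot.comp ξ.continuous_app) η.continuous_app)
  · rw [h0 _ hy, map_zero, map_zero, zero_apply]

/-- The right `A_e`-module `C_c^t(𝒜)` with its inner product. -/
def core : InnerCore (𝒜.Fiber 1) (CcT 𝒜 μ t) where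
  rsmul := LinearMap.mk₂ ℂ rsmul
    (fun ξ η a => by ext1 r; simp only [rsmul_app, add_app, map_add, add_apply])
    (fun c ξ a => by ext1 r; simp only [rsmul_app, smul_app, map_smul, smul_apply])
    (fun ξ a b => by ext1 r; simp only [rsmul_app, add_app, map_add])
    (fun c ξ a => by ext1 r; simp only [rsmul_app, smul_app, map_smul])
  inner := LinearMap.mk₂'ₛₗ (starRingEnd ℂ) (RingHom.id ℂ) inner
    (fun ξ η ζ => by
      simp only [inner, add_app, map_add, add_apply]
      exact integral_add (integrable_inner ξ ζ) (integrable_inner η ζ))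
    (fun c ξ η => by
      simp only [inner, smul_app, map_smulₛₗ, smul_apply, integral_smul, RingHom.id_apply])
    (fun ξ η ζ => by
      simp only [inner, add_app, map_add]
      exact integral_add (integrable_inner ξ η) (integrable_inner ξ ζ))
    (fun c ξ η => by
      simp only [inner, smul_app, map_smul, integral_smul, RingHom.id_apply])
  rsmul_rsmul ξ a b := by
    ext1 r
    exact BundleFiber.ext (mul_assoc _ _ _)
  inner_rsmul ξ η a := by
    change inner ξ (η.rsmul a) = inner ξ η * a
    rw [fiber_mul_def]
    refine Eq.trans ?_ (((mulL (𝒜 := 𝒜) (mul_one (1 : G))).flip a).integral_comp_comm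
      (integrable_inner ξ η))
    refine integral_congr_ae (ae_of_all _ fun r => ?_)
    exact BundleFiber.ext (mul_assoc _ _ _).symm
  star_inner ξ η := by
    change star (inner ξ η) = inner η ξ
    rw [fiber_star_def]
    refine ((Kernel.starR (𝒜 := 𝒜) (inv_one (G := G))).integral_comp_comm
      (integrable_inner ξ η)).symm.trans ?_
    refine integral_congr_ae (ae_of_all _ fun r => ?_)
    refine BundleFiber.ext ?_
    change star (star (ξ.app r).val * (η.app r).val) = star (η.app r).val * (ξ.app r).val
    rw [star_mul, star_star]
  inner_self_pos ξ := by
    let _ := CStarAlgebra.spectralOrder (𝒜.Fiber 1)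
    let _ := CStarAlgebra.spectralOrderedRing (𝒜.Fiber 1)
    change ∃ c, inner ξ ξ = star c * c
    rw [← CStarAlgebra.nonneg_iff_eq_star_mul_self]
    refine integral_nonneg fun r => ?_
    obtain ⟨c, hc⟩ := 𝒜.fib_star_mul_self_pos (ξ.app r)
    have : mulL (inv_mul_cancel (r * t)) (starL rfl (ξ.app r)) (ξ.app r) = star c * c :=
      BundleFiber.ext hc
    rw [Pi.zero_apply, this]
    exact star_mul_self_nonneg c

instance : SeminormedAddCommGroup (CcT 𝒜 μ t) := core.toSeminormedAddCommGroup

lemma norm_def (ξ : CcT 𝒜 μ t) : ‖ξ‖ = √‖inner ξ ξ‖ := rfl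

instance : NormedSpace ℂ (CcT 𝒜 μ t) where
  norm_smul_le c ξ := by
    have h : inner (c • ξ) (c • ξ) = (star c * c) • inner ξ ξ := by
      change core.inner (c • ξ) (c • ξ) = (star c * c) • core.inner ξ ξ
      rw [map_smul, LinearMap.map_smulₛₗ, LinearMap.smul_apply, smul_smul, mul_comm]
      rfl
    rw [norm_def, norm_def, h, norm_smul, CStarRing.norm_star_mul_self,
      Real.sqrt_mul (mul_self_nonneg _), Real.sqrt_mul_self (norm_nonneg _)]

instance : PreHilbertModule (𝒜.Fiber 1) (CcT 𝒜 μ t) where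
  __ := core
  norm_sq := core.nrm_sq

end CcT

variable (μ : Measure G) [T2Space G] [BorelSpace G] [IsFiniteMeasureOnCompacts μ]

/-- The Hilbert `A_e`-module `L²_t(𝒜)`, the completion of `C_c^t(𝒜)`; `L²(𝒜)` is
`L²_e(𝒜)`. -/
abbrev L2 (t : G) : Type (max u v) := UniformSpace.Completion (CcT 𝒜 μ t)

/-- The `C*`-algebra `I_t(𝒜) = 𝒦(L²_t(𝒜))` of compact operators; `I(𝒜)` is `I_e(𝒜)`. -/
abbrev compactIdeal (t : G) : Type (max u v) :=
  PreHilbertModule.CompactOp (𝒜.Fiber 1) (L2 𝒜 μ t)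

variable {𝒜 μ}

/-- The kernel `⟨ξ, η⟩_l^t (r, s) = ξ(r) η(s)*` for `ξ, η ∈ C_c^t(𝒜)`. -/
def CcT.kernel {t : G} (ξ η : CcT 𝒜 μ t) : Kernel 𝒜 μ :=
  .mk' (fun r s => mulL (by group : r * t * (s * t)⁻¹ = r * s⁻¹) (ξ.app r) (starL rfl (η.app s)))
    (𝒜.continuous_mul_tot.comp (Continuous.prodMk (ξ.continuous_app.comp continuous_fst)
      (𝒜.continuous_star_tot.comp (η.continuous_app.comp continuous_snd)))) (by
      obtain ⟨K, hK, h0⟩ := ξ.exists_compact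
      obtain ⟨L, hL, h0'⟩ := η.exists_compact
      refine ⟨K ∪ L, hK.union hL, fun r s h => ?_⟩
      rcases h with h | h
      · simp [h0 r fun h' => h (Or.inl h')]
      · simp [h0' s fun h' => h (Or.inr h')])

/-- The map `ρ_t : C_c(𝒜) → C_c^t(𝒜)`, `ρ_t(ξ) r = Δ(t) ^ (1 / 2) ξ (r t)`. -/
def CcT.rho [LocallyCompactSpace G] (t : G) (ξ : CcT 𝒜 μ 1) : CcT 𝒜 μ t :=
  .mk' (fun r => (√(modular t) : ℂ) • Fiber.cast (mul_one (r * t)) (ξ.app (r * t)))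
    (by
      have h : Continuous fun r => (ξ.app (r * t)).val :=
        ξ.continuous_app.comp (continuous_mul_const t)
      refine continuous_iff_continuousAt.2 fun r => ?_
      exact tendsto_smul (φ := fun r => r * t)
        (f := fun r => Fiber.cast (mul_one (r * t)) (ξ.app (r * t)))
        (a := Fiber.cast (mul_one (r * t)) (ξ.app (r * t))) _ (h.tendsto r))
    (by
      obtain ⟨K, hK, h0⟩ := ξ.exists_compact
      refine ⟨(fun r => r * t⁻¹) '' K, hK.image (continuous_mul_const _), fun r h => ?_⟩
      rw [h0, map_zero, smul_zero]
      exact fun h' => h ⟨_, h', by group⟩)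

end HilbertModules

end FellBundle

end

noncomputable section

/-!
A kernel `k` acts on `C_c^t(𝒜)` by `(k ξ)(r) = ∫ k(r, s) ξ(s) ds`. By the Cauchy–Schwarz
inequality the orbit map `T : k ↦ k ξ` is bounded, and `‖k ξ‖² = ‖⟨ξ, k* k ξ⟩‖ ≤ ‖ξ‖ ‖T (k* k)‖`
gives `‖T‖² ≤ ‖ξ‖ ‖T‖`, so that `‖k ξ‖ ≤ ‖k‖₂ ‖ξ‖`. Hence `HS(𝒜)` is represented contractively on
`L²_t(𝒜)`, and the norm of `𝕜(𝒜)` dominates the operator norm.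

Conversely, if `k` and `k'` are of finite rank, then `‖k l k'‖₂` is bounded by a multiple of the
operator norm of `l`. Therefore the representation is injective on the closure in `𝕜(𝒜)` of the
kernels of finite rank, hence isometric there, and `ι_t` is its inverse. Finally, `ρ_t` maps the
kernel `ξ(r) η(s)*` to its translate under `β_t`.
-/

lemma opNorm_le_of_sq_norm_le {𝕜 S E : Type*} [NontriviallyNormedField 𝕜]
    [NonUnitalSeminormedRing S] [StarRing S] [NormedStarGroup S] [NormedSpace 𝕜 S]
    [SeminormedAddCommGroup E] [NormedSpace 𝕜 E] (T : S →L[𝕜] E) {c : ℝ} (hc : 0 ≤ c)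
    (h : ∀ k, ‖T k‖ ^ 2 ≤ c * ‖T (star k * k)‖) : ‖T‖ ≤ c := by
  have hbound (k : S) : ‖T k‖ ≤ √(c * ‖T‖) * ‖k‖ := by
    refine le_of_sq_le_sq ?_ (by positivity)
    calc ‖T k‖ ^ 2 ≤ c * ‖T (star k * k)‖ := h k
      _ ≤ c * (‖T‖ * (‖star k‖ * ‖k‖)) := by
        gcongr
        exact T.le_opNorm_of_le (norm_mul_le _ _)
      _ = (√(c * ‖T‖) * ‖k‖) ^ 2 := by
        rw [norm_star, mul_pow, Real.sq_sqrt (by positivity)]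
        ring
  have hsq : ‖T‖ ^ 2 ≤ c * ‖T‖ :=
    (Real.le_sqrt (norm_nonneg _) (by positivity)).1 (T.opNorm_le_bound (Real.sqrt_nonneg _) hbound)
  rcases (norm_nonneg T).eq_or_lt with hT | hT
  · exact hT.symm.trans_le hc
  · exact le_of_mul_le_mul_right (pow_two ‖T‖ ▸ hsq) hT

/-! ### States and the norm of the enveloping algebra -/

section States

lemma eq_ofReal_of_norm_le_of_le_re {z : ℂ} {r : ℝ} (hnorm : ‖z‖ ≤ r) (hre : r ≤ z.re) :
    z = r := by
  have him : z.im = 0 := Complex.abs_re_eq_norm.1 <|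
    le_antisymm (Complex.abs_re_le_norm z) (hnorm.trans (hre.trans (le_abs_self _)))
  exact Complex.ext (le_antisymm ((Complex.re_le_norm z).trans hnorm) hre) him

variable {B : Type*} [CStarAlgebra B]

lemma sq_norm_add_smul_I_le {b : B} (hb : IsSelfAdjoint b) (t : ℝ) :
    ‖b + (t * Complex.I : ℂ) • (1 : B)‖ ^ 2 ≤ ‖b‖ ^ 2 + t ^ 2 := by
  rcases subsingleton_or_nontrivial B with _ | _
  · rw [Subsingleton.elim (b + _) 0, norm_zero, zero_pow two_ne_zero]
    positivity
  have hstar : star (b + (t * Complex.I : ℂ) • (1 : B)) * (b + (t * Complex.I : ℂ) • (1 : B)) =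
      b * b + ((t ^ 2 : ℝ) : ℂ) • (1 : B) := by
    have hconj : star (t * Complex.I : ℂ) = -(t * Complex.I) := by simp
    have hsq : ((t ^ 2 : ℝ) : ℂ) = -((t * Complex.I) * (t * Complex.I)) := by
      push_cast
      linear_combination ((t : ℂ) ^ 2) * Complex.I_mul_I
    rw [star_add, star_smul, hb.star_eq, star_one, hconj, hsq]
    generalize (t * Complex.I : ℂ) = z
    simp only [add_mul, mul_add, smul_mul_assoc, mul_smul_comm, one_mul, mul_one, smul_add,
      neg_smul, mul_smul, neg_mul, smul_neg]
    abel
  rw [pow_two, ← CStarRing.norm_star_mul_self, hstar, pow_two ‖b‖]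
  refine (norm_add_le _ _).trans (add_le_add (norm_mul_le _ _) ?_)
  rw [norm_smul, CStarRing.norm_one, mul_one, Complex.norm_real, Real.norm_of_nonneg (sq_nonneg t)]

lemma im_apply_eq_zero_of_isSelfAdjoint {φ : StrongDual ℂ B} (hφ : ‖φ‖ ≤ 1) (h1 : φ 1 = 1)
    {b : B} (hb : IsSelfAdjoint b) : (φ b).im = 0 := by
  have key (t : ℝ) : (φ b).re ^ 2 + ((φ b).im + t) ^ 2 ≤ ‖b‖ ^ 2 + t ^ 2 := by
    calc (φ b).re ^ 2 + ((φ b).im + t) ^ 2 = ‖φ (b + (t * Complex.I : ℂ) • (1 : B))‖ ^ 2 := by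
          rw [map_add, map_smul, h1, Complex.sq_norm, Complex.normSq_apply]
          simp [pow_two]
      _ ≤ ‖b + (t * Complex.I : ℂ) • (1 : B)‖ ^ 2 := by
          gcongr
          simpa only [one_mul] using φ.le_of_opNorm_le hφ (b + (t * Complex.I : ℂ) • (1 : B))
      _ ≤ ‖b‖ ^ 2 + t ^ 2 := sq_norm_add_smul_I_le hb t
  by_contra him
  have ht : 2 * (φ b).im * ((‖b‖ ^ 2 + 1) / (2 * (φ b).im)) = ‖b‖ ^ 2 + 1 := by field_simp
  nlinarith [key ((‖b‖ ^ 2 + 1) / (2 * (φ b).im)), sq_nonneg (φ b).re, sq_nonneg (φ b).im]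

variable [PartialOrder B] [StarOrderedRing B]

open scoped ComplexOrder in
lemma apply_nonneg_of_opNorm_le_one {φ : StrongDual ℂ B} (hφ : ‖φ‖ ≤ 1) (h1 : φ 1 = 1)
    {b : B} (hb : 0 ≤ b) : 0 ≤ φ b := by
  have hsa : IsSelfAdjoint b := .of_nonneg hb
  have hnorm : ‖algebraMap ℝ B ‖b‖ - b‖ ≤ ‖b‖ :=
    (CStarAlgebra.norm_le_iff_le_algebraMap _ (norm_nonneg b)
      (sub_nonneg.2 hsa.le_algebraMap_norm_self)).2 (sub_le_self _ hb)
  have hφb : φ (algebraMap ℝ B ‖b‖ - b) = ‖b‖ - φ b := by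
    rw [map_sub, Algebra.algebraMap_eq_smul_one, ← Complex.coe_smul, map_smul, h1]
    simp
  have hre : ‖b‖ - (φ b).re ≤ ‖b‖ := by
    calc ‖b‖ - (φ b).re = (φ (algebraMap ℝ B ‖b‖ - b)).re := by simp [hφb]
      _ ≤ ‖φ (algebraMap ℝ B ‖b‖ - b)‖ := Complex.re_le_norm _
      _ ≤ ‖b‖ := (φ.le_of_opNorm_le hφ _).trans (by simpa using hnorm)
  exact Complex.nonneg_iff.2 ⟨by linarith, (im_apply_eq_zero_of_isSelfAdjoint hφ h1 hsa).symm⟩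

lemma norm_one_add_of_nonneg [Nontrivial B] {a : B} (ha : 0 ≤ a) : ‖1 + a‖ = 1 + ‖a‖ := by
  refine le_antisymm ((norm_add_le _ _).trans_eq (by rw [CStarRing.norm_one])) ?_
  have hmem : ‖a‖ + 1 ∈ spectrum ℝ (algebraMap ℝ B 1 + a) :=
    spectrum.add_mem_add_iff.2 (CStarAlgebra.norm_mem_spectrum_of_nonneg ha)
  rw [map_one] at hmem
  rw [add_comm 1 ‖a‖]
  exact (Real.le_norm_self _).trans (spectrum.norm_le_norm_of_mem hmem)

open scoped ComplexOrder in
lemma exists_state_apply_eq_norm [Nontrivial B] {a : B} (ha : 0 ≤ a) :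
    ∃ f : B →ₚ[ℂ] ℂ, f 1 = 1 ∧ f a = ‖a‖ := by
  obtain ⟨φ, hφ, hφa⟩ := exists_dual_vector'' ℂ (1 + a)
  have hle_one : ‖φ 1‖ ≤ 1 := by simpa using φ.le_of_opNorm_le hφ 1
  have hle_norm : ‖φ a‖ ≤ ‖a‖ := by simpa using φ.le_of_opNorm_le hφ a
  have hre : (φ 1).re + (φ a).re = 1 + ‖a‖ := by
    simpa [norm_one_add_of_nonneg ha] using congrArg Complex.re hφa
  have hφ_one : φ 1 = 1 := by
    exact_mod_cast eq_ofReal_of_norm_le_of_le_re hle_one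
      (by linarith [(Complex.re_le_norm (φ a)).trans hle_norm])
  have hφ_a : φ a = ‖a‖ :=
    eq_ofReal_of_norm_le_of_le_re hle_norm (by linarith [(Complex.re_le_norm (φ 1)).trans hle_one])
  exact ⟨.mk₀ φ.toLinearMap fun _ => apply_nonneg_of_opNorm_le_one hφ hφ_one, hφ_one, hφ_a⟩

end States

section Envelope

open scoped ComplexOrder in
lemma exists_rep_norm_eq (B : Type u) [CStarAlgebra B] (x : B) :
    ∃ (H : Type u) (_ : NormedAddCommGroup H) (_ : InnerProductSpace ℂ H) (_ : CompleteSpace H)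
      (π : B →⋆ₙₐ[ℂ] (H →L[ℂ] H)), ‖π x‖ = ‖x‖ := by
  let _ := CStarAlgebra.spectralOrder B
  let _ := CStarAlgebra.spectralOrderedRing B
  rcases subsingleton_or_nontrivial B with _ | _
  · exact ⟨(0 : B →ₚ[ℂ] ℂ).GNS, inferInstance, inferInstance, inferInstance, 0, by
      rw [Subsingleton.elim x 0, map_zero, norm_zero, norm_zero]⟩
  obtain ⟨f, hf_one, hf⟩ := exists_state_apply_eq_norm (star_mul_self_nonneg x)
  refine ⟨f.GNS, inferInstance, inferInstance, inferInstance, f.gnsNonUnitalStarAlgHom,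
    le_antisymm (NonUnitalStarAlgHom.norm_apply_le _ x) ?_⟩
  let Ω : f.GNS := f.toPreGNS 1
  have hΩ : ‖Ω‖ = 1 := by
    simp [Ω, UniformSpace.Completion.norm_coe, PositiveLinearMap.preGNS_norm_def, hf_one]
  have hxΩ : ‖f.gnsNonUnitalStarAlgHom x Ω‖ = ‖x‖ := by
    rw [PositiveLinearMap.gnsNonUnitalStarAlgHom_apply_coe, UniformSpace.Completion.norm_coe,
      PositiveLinearMap.preGNS_norm_def]
    simp only [PositiveLinearMap.leftMulMapPreGNS_apply, PositiveLinearMap.ofPreGNS_toPreGNS,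
      mul_one]
    rw [hf, Complex.ofReal_re, CStarRing.norm_star_mul_self, Real.sqrt_mul_self (norm_nonneg _)]
  simpa only [hxΩ, hΩ, mul_one] using (f.gnsNonUnitalStarAlgHom x).le_opNorm Ω

variable {B : Type u} [NonUnitalNormedRing B] [NormedSpace ℂ B] [StarRing B]

lemma norm_toEnvelope_le (b : B) : ‖toEnvelope b‖ ≤ ‖b‖ :=
  RepProduct.norm_le (x := universalRep B b) (norm_nonneg b) fun ρ => ρ.norm_le b

lemma norm_apply_le_norm_toEnvelope {C : Type u} [CStarAlgebra C] (Φ : B →⋆ₙₐ[ℂ] C)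
    (hΦ : ∀ b, ‖Φ b‖ ≤ ‖b‖) (b : B) : ‖Φ b‖ ≤ ‖toEnvelope b‖ := by
  obtain ⟨H, _, _, _, π, hπ⟩ := exists_rep_norm_eq C (Φ b)
  let ρ : HilbertRep B :=
    { H := H
      π := π.comp Φ
      norm_le := fun b => (NonUnitalStarAlgHom.norm_apply_le π (Φ b)).trans (hΦ b) }
  exact hπ.ge.trans (RepProduct.norm_comp_le (universalRep B b) ρ)

end Envelope

/-! ### Homomorphisms on dense subalgebras -/

section Extension

variable {S C D : Type*} [NonUnitalRing S] [Module ℂ S] [StarRing S]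

lemma exists_nonUnitalStarAlgHom_extension
    [NonUnitalNormedRing C] [NormedSpace ℂ C] [StarRing C] [ContinuousStar C]
    [NonUnitalNormedRing D] [NormedSpace ℂ D] [StarRing D] [ContinuousStar D] [CompleteSpace D]
    (f : S →⋆ₙₐ[ℂ] C) (g : S →⋆ₙₐ[ℂ] D) (hf : DenseRange f) (h : ∀ s, ‖g s‖ ≤ ‖f s‖) :
    ∃ F : C →⋆ₙₐ[ℂ] D, (∀ s, F (f s) = g s) ∧ ∀ x, ‖F x‖ ≤ ‖x‖ := by
  have h' (s : S) : ‖(g : S →ₗ[ℂ] D) s‖ ≤ 1 * ‖(f : S →ₗ[ℂ] C) s‖ := (h s).trans_eq (one_mul _).symm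
  let F := (g : S →ₗ[ℂ] D).extendOfNorm (f : S →ₗ[ℂ] C)
  have hF (s : S) : F (f s) = g s := LinearMap.extendOfNorm_eq hf ⟨1, h'⟩ s
  have hF_mul (x y : C) : F (x * y) = F x * F y := by
    refine hf.induction_on₂ (isClosed_eq (by fun_prop) (by fun_prop)) (fun s s' => ?_) x y
    rw [← map_mul, hF, hF, hF, map_mul]
  have hF_star (x : C) : F (star x) = star (F x) := by
    refine hf.induction_on x (isClosed_eq (by fun_prop) (by fun_prop)) fun s => ?_
    rw [← map_star, hF, hF, map_star]
  refine ⟨{ toFun := F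
            map_smul' := map_smul F
            map_zero' := map_zero F
            map_add' := map_add F
            map_mul' := hF_mul
            map_star' := hF_star }, hF, fun x => ?_⟩
  change ‖F x‖ ≤ ‖x‖
  simpa only [one_mul] using LinearMap.norm_extendOfNorm_apply_le hf 1 h' x

lemma eq_zero_of_forall_mul_mul_eq_zero {C : Type*} [NonUnitalNormedRing C] [StarRing C]
    [CStarRing C] {α : Type*} {f : α → C} (hf : DenseRange f) {x : C}
    (h : ∀ a b, f a * x * f b = 0) : x = 0 := by
  have hmul (y z : C) : y * x * z = 0 :=
    hf.induction_on₂ (isClosed_eq (by fun_prop) continuous_const) h y z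
  rw [← CStarRing.star_mul_self_eq_zero_iff, ← CStarRing.star_mul_self_eq_zero_iff,
    star_mul, star_star]
  exact hmul (star x) (star x * x)

variable [NonUnitalCStarAlgebra C] [NonUnitalCStarAlgebra D]

open scoped CStarAlgebra in
lemma injective_of_forall_isBigO (φ : S →⋆ₙₐ[ℂ] C) (hφ : DenseRange φ) (F : C →⋆ₙₐ[ℂ] D)
    (h : ∀ k k', (fun l => φ (k * l * k')) =O[⊤] fun l => F (φ l)) : Function.Injective F := by
  refine (injective_iff_map_eq_zero F).2 fun x hx => eq_zero_of_forall_mul_mul_eq_zero hφ ?_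
  intro k k'
  have hne : (comap φ (𝓝 x)).NeBot := comap_neBot fun _ hs => hφ.mem_nhds hs
  have hF : Tendsto (fun l => F (φ l)) (comap φ (𝓝 x)) (𝓝 0) := by
    simpa only [hx, Function.comp_def] using
      ((map_continuous F).tendsto x).comp (tendsto_comap (f := φ))
  refine tendsto_nhds_unique (f := fun l => φ (k * l * k')) (l := comap φ (𝓝 x)) ?_
    (((h k k').mono le_top).trans_tendsto hF)
  simp only [map_mul]
  exact (tendsto_comap.const_mul _).mul_const _

lemma norm_eq_norm_of_forall_isBigO (φ : S →⋆ₙₐ[ℂ] C) (ψ : S →⋆ₙₐ[ℂ] D)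
    (hle : ∀ s, ‖ψ s‖ ≤ ‖φ s‖) (h : ∀ k k', (fun l => φ (k * l * k')) =O[⊤] ψ) (s : S) :
    ‖φ s‖ = ‖ψ s‖ := by
  let J := (NonUnitalStarAlgHom.range φ).topologicalClosure
  have : IsClosed (J : Set C) := NonUnitalStarSubalgebra.isClosed_topologicalClosure _
  let φJ : S →⋆ₙₐ[ℂ] J := NonUnitalStarAlgHom.codRestrict φ J fun s =>
    NonUnitalStarSubalgebra.le_topologicalClosure _ ⟨s, rfl⟩
  have hφJ : DenseRange φJ := by
    refine Subtype.dense_iff.2 fun x hx => ?_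
    rwa [← Set.range_comp]
  obtain ⟨F, hF, -⟩ := exists_nonUnitalStarAlgHom_extension φJ ψ hφJ hle
  have hF_inj : Function.Injective F := injective_of_forall_isBigO φJ hφJ F fun k k' => by
    simp only [hF]
    exact Asymptotics.isBigO_norm_left.1 (h k k').norm_left
  rw [← hF, NonUnitalStarAlgHom.norm_map F hF_inj]
  rfl

end Extension

/-! ### The action of kernels on the modules `L²_t(𝒜)` -/

namespace FellBundle

open CompactlySupported PreHilbertModule

section KernelAction

variable {G : Type u} [Group G] [TopologicalSpace G] [IsTopologicalGroup G]
  [MeasurableSpace G] {𝒜 : FellBundle.{u, v} G} {μ : Measure G} {t : G}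

namespace CcT

/-- The function `r ↦ ‖ξ(r)‖` of a section `ξ ∈ C_c^t(𝒜)`, as a compactly supported continuous
function, so that the Cauchy–Schwarz inequality for functionals applies to it. -/
def normFn (ξ : CcT 𝒜 μ t) : C_c(G, ℝ) where
  toFun r := ‖ξ.app r‖
  continuous_toFun := continuous_norm_section (φ := fun r : G => r * t) ξ.continuous_app
  hasCompactSupport' := ξ.2.2

/-- The square `∫ ‖ξ(r)‖² dr` of the scalar `L²`-norm of `ξ ∈ C_c^t(𝒜)`, which in general is
larger than the square `‖∫ ξ(r)* ξ(r) dr‖` of the norm of `ξ` in the Hilbert module. -/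
def normSqIntegral (ξ : CcT 𝒜 μ t) : ℝ := ∫ r, ‖ξ.app r‖ ^ 2 ∂μ

lemma normSqIntegral_nonneg (ξ : CcT 𝒜 μ t) : 0 ≤ ξ.normSqIntegral :=
  integral_nonneg fun _ => sq_nonneg _

variable [BorelSpace G] [IsFiniteMeasureOnCompacts μ]

lemma integrable_norm_sq (ξ : CcT 𝒜 μ t) : Integrable (fun r => ‖ξ.app r‖ ^ 2) μ := by
  simp only [pow_two]
  exact (ξ.normFn * ξ.normFn).continuous.integrable_of_hasCompactSupport
    (ξ.normFn * ξ.normFn).hasCompactSupport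

lemma norm_sq_le_normSqIntegral [T2Space G] (ξ : CcT 𝒜 μ t) : ‖ξ‖ ^ 2 ≤ ξ.normSqIntegral := by
  rw [norm_def, Real.sq_sqrt (norm_nonneg _), inner]
  refine norm_integral_le_of_norm_le ξ.integrable_norm_sq (ae_of_all _ fun r => ?_)
  refine (norm_mulL_le _ _ _).trans_eq ?_
  rw [LinearIsometry.norm_map, pow_two]

lemma normSqIntegral_rsmul_le (ξ : CcT 𝒜 μ t) (a : 𝒜.Fiber 1) :
    (ξ.rsmul a).normSqIntegral ≤ ‖a‖ ^ 2 * ξ.normSqIntegral := by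
  rw [normSqIntegral, normSqIntegral, ← integral_const_mul]
  refine integral_mono (integrable_norm_sq _) (ξ.integrable_norm_sq.const_mul _) fun r => ?_
  dsimp only
  rw [rsmul_app, ← mul_pow, mul_comm]
  gcongr
  exact norm_mulL_le _ _ _

end CcT

namespace Kernel

variable [T2Space G] [BorelSpace G] [IsFiniteMeasureOnCompacts μ]

/-- The action `(k ξ)(r) = ∫ k(r, s) ξ(s) ds` of a kernel on `C_c^t(𝒜)`. -/
def act (k : Kernel 𝒜 μ) (ξ : CcT 𝒜 μ t) : CcT 𝒜 μ t :=
  .mk' (fun r => ∫ s, mulL (by group : r * s⁻¹ * (s * t) = r * t) (k.app r s) (ξ.app s) ∂μ)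
    (by
      obtain ⟨K, hK, hξ⟩ := ξ.exists_compact
      refine continuous_integral_section (φ := fun r : G => r * t) (by fun_prop)
        (F := fun r s => mulL (by group) (k.app r s) (ξ.app s)) ?_ hK fun x y hy => ?_
      · exact 𝒜.continuous_mul_tot.comp
          (k.continuous_app.prodMk (ξ.continuous_app.comp continuous_snd))
      · rw [hξ _ hy, map_zero])
    (by
      obtain ⟨K, hK, hk⟩ := k.exists_compact
      refine ⟨K, hK, fun r hr => integral_eq_zero_of_ae (ae_of_all _ fun s => ?_)⟩
      simp [hk r s (Or.inl hr)])

lemma act_app (k : Kernel 𝒜 μ) (ξ : CcT 𝒜 μ t) (r : G) : (k.act ξ).app r =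
    ∫ s, mulL (by group : r * s⁻¹ * (s * t) = r * t) (k.app r s) (ξ.app s) ∂μ := rfl

lemma integrable_act_app (k : Kernel 𝒜 μ) (ξ : CcT 𝒜 μ t) (r : G) {u : G}
    (h : ∀ s, r * s⁻¹ * (s * t) = u) :
    Integrable (fun s => mulL (h s) (k.app r s) (ξ.app s)) μ := by
  obtain ⟨K, hK, hξ⟩ := ξ.exists_compact
  have hcont : Continuous fun s => (k.app r s).val * (ξ.app s).val :=
    𝒜.continuous_mul_tot.comp
      ((k.continuous_app.comp (continuous_const.prodMk continuous_id)).prodMk ξ.continuous_app)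
  exact integrable_section hcont hK fun y hy => by rw [hξ _ hy, map_zero]

variable (t) in
/-- The bilinear form of the action of kernels on `C_c^t(𝒜)`. -/
def actₗ : Kernel 𝒜 μ →ₗ[ℂ] CcT 𝒜 μ t →ₗ[ℂ] CcT 𝒜 μ t :=
  LinearMap.mk₂ ℂ act
    (fun k l ξ => by
      ext1 r
      simp only [CcT.add_app, act_app, add_app, map_add, _root_.add_apply]
      exact integral_add (integrable_act_app _ _ _ _) (integrable_act_app _ _ _ _))
    (fun c k ξ => by
      ext1 r
      simp only [CcT.smul_app, act_app, smul_app, map_smul, _root_.smul_apply, integral_smul])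
    (fun k ξ η => by
      ext1 r
      simp only [CcT.add_app, act_app, map_add]
      exact integral_add (integrable_act_app _ _ _ _) (integrable_act_app _ _ _ _))
    (fun c k ξ => by
      ext1 r
      simp only [CcT.smul_app, act_app, map_smul, integral_smul])

lemma actₗ_apply (k : Kernel 𝒜 μ) (ξ : CcT 𝒜 μ t) : actₗ t k ξ = k.act ξ := rfl

lemma mulL_mul_app (k l : Kernel 𝒜 μ) (r s : G) {u v : G} (b : 𝒜.Fiber u)
    (h : r * s⁻¹ * u = v) :
    mulL h ((k * l).app r s) b =
      ∫ w, mulL h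
        (mulL (by group : r * w⁻¹ * (w * s⁻¹) = r * s⁻¹) (k.app r w) (l.app w s)) b ∂μ := by
  rw [mul_app]
  exact (((mulL h).flip b).integral_comp_comm (integrable_mul_app k l r s fun _ => by group)).symm

lemma mulL_act_app (k : Kernel 𝒜 μ) (ξ : CcT 𝒜 μ t) (r : G) {u v : G} (b : 𝒜.Fiber u)
    (h : u * (r * t) = v) :
    mulL h b ((k.act ξ).app r) =
      ∫ s, mulL h b (mulL (by group : r * s⁻¹ * (s * t) = r * t) (k.app r s) (ξ.app s)) ∂μ := by
  rw [act_app]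
  exact ((mulL h b).integral_comp_comm (integrable_act_app k ξ r fun _ => by group)).symm

lemma mulL_starL_act_app (k : Kernel 𝒜 μ) (ξ : CcT 𝒜 μ t) (r : G) {u v : G} (b : 𝒜.Fiber u)
    (h : (r * t)⁻¹ * u = v) :
    mulL h (starL rfl ((k.act ξ).app r)) b =
      ∫ s, mulL h (starL rfl
        (mulL (by group : r * s⁻¹ * (s * t) = r * t) (k.app r s) (ξ.app s))) b ∂μ := by
  rw [act_app]
  exact (((((mulL h).flip b).restrictScalars ℝ).comp (starR rfl)).integral_comp_comm
    (integrable_act_app k ξ r fun _ => by group)).symm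

lemma mul_act (k l : Kernel 𝒜 μ) (ξ : CcT 𝒜 μ t) : (k * l).act ξ = k.act (l.act ξ) := by
  ext1 r
  rw [act_app, act_app]
  simp_rw [mulL_mul_app, mulL_act_app]
  rw [integral_integral_swap_of_hasCompactSupport]
  · congr with u
    congr with s
    exact mul_assoc _ _ _
  · exact continuous_val_iff.1 <| 𝒜.continuous_mul_tot.comp <|
      (𝒜.continuous_mul_tot.comp
        ((k.continuous_app.comp (continuous_const.prodMk continuous_snd)).prodMk
          (l.continuous_app.comp (continuous_snd.prodMk continuous_fst)))).prodMk
        (ξ.continuous_app.comp continuous_fst)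
  · obtain ⟨K, hK, hk⟩ := k.exists_compact
    obtain ⟨L, hL, hξ⟩ := ξ.exists_compact
    refine HasCompactSupport.intro (hL.prod hK) fun x hx => ?_
    rcases not_and_or.1 hx with hx | hx
    · simp [Function.uncurry, hξ x.1 hx]
    · simp [Function.uncurry, hk r x.2 (Or.inr hx)]

lemma inner_act_left (k : Kernel 𝒜 μ) (ξ η : CcT 𝒜 μ t) :
    CcT.inner (k.act ξ) η = CcT.inner ξ ((star k).act η) := by
  rw [CcT.inner, CcT.inner]
  simp_rw [mulL_starL_act_app, mulL_act_app]
  rw [integral_integral_swap_of_hasCompactSupport]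
  · congr with s
    congr with r
    change star (_ * _) * _ = star _ * (star _ * _)
    rw [star_mul, mul_assoc]
  · exact continuous_val_iff.1 <| 𝒜.continuous_mul_tot.comp <|
      (𝒜.continuous_star_tot.comp <| 𝒜.continuous_mul_tot.comp <|
        k.continuous_app.prodMk (ξ.continuous_app.comp continuous_snd)).prodMk
        (η.continuous_app.comp continuous_fst)
  · obtain ⟨K, hK, hη⟩ := η.exists_compact
    obtain ⟨L, hL, hξ⟩ := ξ.exists_compact
    refine HasCompactSupport.intro (hK.prod hL) fun x hx => ?_
    rcases not_and_or.1 hx with hx | hx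
    · simp [Function.uncurry, hη x.1 hx]
    · simp [Function.uncurry, hξ x.2 hx]

/-- The function `s ↦ ‖k(r, s)‖` of a kernel `k` at a fixed `r`, as a compactly supported
continuous function. -/
def rowNormFn (k : Kernel 𝒜 μ) (r : G) : C_c(G, ℝ) where
  toFun s := ‖k.app r s‖
  continuous_toFun := k.normFn.continuous.comp (continuous_const.prodMk continuous_id)
  hasCompactSupport' := by
    obtain ⟨K, hK, hk⟩ := k.exists_compact
    exact HasCompactSupport.intro hK fun s hs => by simp [hk r s (Or.inr hs)]

lemma sq_norm_act_app_le (k : Kernel 𝒜 μ) (ξ : CcT 𝒜 μ t) (r : G) :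
    ‖(k.act ξ).app r‖ ^ 2 ≤ (∫ s, ‖k.app r s‖ ^ 2 ∂μ) * ξ.normSqIntegral := by
  let f := k.rowNormFn r * ξ.normFn
  have hle : ‖(k.act ξ).app r‖ ≤ integral₁ μ f := by
    rw [act_app]
    exact norm_integral_le_of_norm_le
      (f.continuous.integrable_of_hasCompactSupport f.hasCompactSupport)
      (ae_of_all _ fun _ => norm_mulL_le _ _ _)
  calc ‖(k.act ξ).app r‖ ^ 2 ≤ integral₁ μ f ^ 2 := by gcongr
    _ ≤ integral₁ μ (k.rowNormFn r * k.rowNormFn r) * integral₁ μ (ξ.normFn * ξ.normFn) :=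
      functional_cauchy_schwarz (integral₁ μ) (fun g hg => integral_nonneg hg) _ _
    _ = (∫ s, ‖k.app r s‖ ^ 2 ∂μ) * ξ.normSqIntegral := by
      simp only [CcT.normSqIntegral, pow_two]
      rfl

lemma norm_sq_eq_integral (k : Kernel 𝒜 μ) : ‖k‖ ^ 2 = ∫ r, ∫ s, ‖k.app r s‖ ^ 2 ∂μ ∂μ := by
  rw [norm_def, Real.sq_sqrt]
  exact integral_nonneg fun r => integral_nonneg fun s => sq_nonneg _

lemma normSqIntegral_act_le (k : Kernel 𝒜 μ) (ξ : CcT 𝒜 μ t) :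
    (k.act ξ).normSqIntegral ≤ ‖k‖ ^ 2 * ξ.normSqIntegral := by
  have hint : Integrable (fun r => ∫ s, ‖k.app r s‖ ^ 2 ∂μ) μ := by
    simpa [normFn_apply, ← pow_two] using integrable_cc_integral (μ := μ) (k.normFn * k.normFn)
  rw [norm_sq_eq_integral, CcT.normSqIntegral, ← integral_mul_const]
  exact integral_mono (CcT.integrable_norm_sq _) (hint.mul_const _) (sq_norm_act_app_le k ξ)

/-- The bounded map `k ↦ k ξ` of a fixed `ξ ∈ C_c^t(𝒜)`. -/
def orbitMap (ξ : CcT 𝒜 μ t) : Kernel 𝒜 μ →L[ℂ] CcT 𝒜 μ t :=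
  ((actₗ t).flip ξ).mkContinuous √ξ.normSqIntegral fun k => by
    refine le_of_sq_le_sq ?_ (by positivity)
    rw [mul_pow, Real.sq_sqrt ξ.normSqIntegral_nonneg, mul_comm]
    exact (CcT.norm_sq_le_normSqIntegral _).trans (normSqIntegral_act_le k ξ)

lemma norm_act_sq_le (k : Kernel 𝒜 μ) (ξ : CcT 𝒜 μ t) :
    ‖k.act ξ‖ ^ 2 ≤ ‖ξ‖ * ‖(star k * k).act ξ‖ := by
  rw [CcT.norm_def (k.act ξ), Real.sq_sqrt (norm_nonneg _), inner_act_left, ← mul_act]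
  exact CcT.core.norm_inner_le ξ ((star k * k).act ξ)

-- The estimate by the scalar `L²`-norm only shows that the orbit map is bounded; squaring
-- replaces that bound by the norm of `ξ` in the Hilbert module.
lemma norm_act_le (k : Kernel 𝒜 μ) (ξ : CcT 𝒜 μ t) : ‖k.act ξ‖ ≤ ‖k‖ * ‖ξ‖ := by
  have horbit : ‖orbitMap ξ‖ ≤ ‖ξ‖ :=
    opNorm_le_of_sq_norm_le (orbitMap ξ) (norm_nonneg ξ) fun k => norm_act_sq_le k ξ
  rw [mul_comm]
  exact (orbitMap ξ).le_of_opNorm_le horbit k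

variable (t) in
/-- The action of kernels on `C_c^t(𝒜)` by bounded operators. -/
def actL : Kernel 𝒜 μ →L[ℂ] CcT 𝒜 μ t →L[ℂ] CcT 𝒜 μ t :=
  (actₗ t).mkContinuous₂ 1 fun k ξ => by
    rw [one_mul, actₗ_apply]
    exact norm_act_le k ξ

lemma actL_apply (k : Kernel 𝒜 μ) (ξ : CcT 𝒜 μ t) : actL t k ξ = k.act ξ := rfl

end Kernel

namespace L2

variable [T2Space G] [BorelSpace G] [IsFiniteMeasureOnCompacts μ]

lemma innerL_coe (ξ η : CcT 𝒜 μ t) :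
    innerL (𝒜.Fiber 1) (ξ : L2 𝒜 μ t) (η : L2 𝒜 μ t) = CcT.inner ξ η :=
  innerCompl_coe (𝒜.Fiber 1) ξ η

lemma rsmulL_coe (ξ : CcT 𝒜 μ t) (a : 𝒜.Fiber 1) :
    rsmulL (𝒜.Fiber 1) (ξ : L2 𝒜 μ t) a = (ξ.rsmul a : CcT 𝒜 μ t) :=
  rsmulCompl_coe (𝒜.Fiber 1) ξ a

lemma adjointable_ext {T S : Adjointable (𝒜.Fiber 1) (L2 𝒜 μ t)}
    (h : ∀ ξ : CcT 𝒜 μ t, T.op (ξ : L2 𝒜 μ t) = S.op (ξ : L2 𝒜 μ t)) : T = S :=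
  Adjointable.ext_op fun x => by
    induction x using UniformSpace.Completion.induction_on with
    | hp => exact isClosed_eq (by fun_prop) (by fun_prop)
    | ih ξ => exact h ξ

end L2

variable [T2Space G] [BorelSpace G] [IsFiniteMeasureOnCompacts μ]

lemma Kernel.innerL_completion_actL (k : Kernel 𝒜 μ) (x y : L2 𝒜 μ t) :
    innerL (𝒜.Fiber 1) ((actL t k).completion x) y =
      innerL (𝒜.Fiber 1) x ((actL t (star k)).completion y) := by
  induction x, y using UniformSpace.Completion.induction_on₂ with
  | hp => exact isClosed_eq (by fun_prop) (by fun_prop)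
  | ih ξ η =>
    simp only [ContinuousLinearMap.completion_apply_coe, actL_apply, L2.innerL_coe]
    exact inner_act_left k ξ η

/-- The adjointable operator on `L²_t(𝒜)` given by a kernel. -/
def Kernel.toAdjointable (t : G) (k : Kernel 𝒜 μ) : Adjointable (𝒜.Fiber 1) (L2 𝒜 μ t) :=
  ⟨(actL t k).completion, (actL t (star k)).completion, k.innerL_completion_actL⟩

lemma Kernel.toAdjointable_op_coe (k : Kernel 𝒜 μ) (ξ : CcT 𝒜 μ t) :
    (k.toAdjointable t).op (ξ : L2 𝒜 μ t) = (k.act ξ : CcT 𝒜 μ t) :=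
  ContinuousLinearMap.completion_apply_coe (actL t k) ξ

variable (𝒜 μ t) in
/-- The representation of `k_c(𝒜)` on `L²_t(𝒜)`. -/
def kernelRep : Kernel 𝒜 μ →⋆ₙₐ[ℂ] Adjointable (𝒜.Fiber 1) (L2 𝒜 μ t) where
  toFun := Kernel.toAdjointable t
  map_smul' c k := L2.adjointable_ext fun ξ => by
    change _ = c • (k.toAdjointable t).op (ξ : L2 𝒜 μ t)
    simp only [Kernel.toAdjointable_op_coe, ← Kernel.actL_apply, map_smul, _root_.smul_apply,
      UniformSpace.Completion.coe_smul]
  map_zero' := L2.adjointable_ext fun ξ => by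
    change _ = (0 : L2 𝒜 μ t)
    simp only [Kernel.toAdjointable_op_coe, ← Kernel.actL_apply, map_zero, _root_.zero_apply,
      UniformSpace.Completion.coe_zero]
  map_add' k l := L2.adjointable_ext fun ξ => by
    change _ = (k.toAdjointable t).op (ξ : L2 𝒜 μ t) + (l.toAdjointable t).op (ξ : L2 𝒜 μ t)
    simp only [Kernel.toAdjointable_op_coe, ← Kernel.actL_apply, map_add, _root_.add_apply,
      UniformSpace.Completion.coe_add]
  map_mul' k l := L2.adjointable_ext fun ξ => by
    change _ = (k.toAdjointable t).op ((l.toAdjointable t).op (ξ : L2 𝒜 μ t))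
    simp only [Kernel.toAdjointable_op_coe, Kernel.mul_act]
  map_star' k := (star_eq_of_inner k.innerL_completion_actL).symm

lemma kernelRep_op_coe (k : Kernel 𝒜 μ) (ξ : CcT 𝒜 μ t) :
    (kernelRep 𝒜 μ t k).op (ξ : L2 𝒜 μ t) = (k.act ξ : CcT 𝒜 μ t) :=
  k.toAdjointable_op_coe ξ

lemma norm_kernelRep_le (k : Kernel 𝒜 μ) : ‖kernelRep 𝒜 μ t k‖ ≤ ‖k‖ := by
  rw [← Adjointable.norm_op]
  refine ContinuousLinearMap.opNorm_le_bound _ (norm_nonneg _) fun x => ?_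
  induction x using UniformSpace.Completion.induction_on with
  | hp => exact isClosed_le (by fun_prop) (by fun_prop)
  | ih ξ =>
    rw [kernelRep_op_coe, UniformSpace.Completion.norm_coe, UniformSpace.Completion.norm_coe]
    exact k.norm_act_le ξ

variable (𝒜 μ) in
/-- The inclusion `k_c(𝒜) → HS(𝒜)` as a `*`-homomorphism. -/
def Kernel.toHS : Kernel 𝒜 μ →⋆ₙₐ[ℂ] HS 𝒜 μ where
  toFun := StarCompletion.of
  map_smul' c k := map_smul _ c k
  map_zero' := map_zero _
  map_add' := map_add _
  map_mul' := StarCompletion.of_mul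
  map_star' := StarCompletion.of_star

variable (𝒜 μ) in
/-- The canonical map `k_c(𝒜) → 𝕜(𝒜)` as a `*`-homomorphism. -/
def Kernel.toAlgebraHom : Kernel 𝒜 μ →⋆ₙₐ[ℂ] KernelAlgebra 𝒜 μ :=
  toEnvelope.comp (toHS 𝒜 μ)

lemma Kernel.norm_toAlgebra_le (k : Kernel 𝒜 μ) : ‖k.toAlgebra‖ ≤ ‖k‖ :=
  (norm_toEnvelope_le _).trans_eq (StarCompletion.norm_of k)

lemma norm_kernelRep_le_norm_toAlgebra (k : Kernel 𝒜 μ) :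
    ‖kernelRep 𝒜 μ t k‖ ≤ ‖k.toAlgebra‖ := by
  have : ContinuousStar (HS 𝒜 μ) :=
    ⟨(StarCompletion.starCompl : HS 𝒜 μ →L⋆[ℂ] HS 𝒜 μ).continuous⟩
  obtain ⟨Φ, hΦ, hΦ_le⟩ := exists_nonUnitalStarAlgHom_extension (Kernel.toHS 𝒜 μ)
    (kernelRep 𝒜 μ t) StarCompletion.denseRange_of fun k =>
      (norm_kernelRep_le k).trans_eq (StarCompletion.norm_of k).symm
  rw [← hΦ]
  exact norm_apply_le_norm_toEnvelope Φ hΦ_le (Kernel.toHS 𝒜 μ k)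

end KernelAction

end FellBundle

/-! ### Density of the rank-one operators -/

namespace PreHilbertModule

section Density

variable {A E D : Type*} [NonUnitalCStarAlgebra A] [NormedAddCommGroup E]
  [NormedSpace ℂ E] [PreHilbertModule A E]

lemma continuous_theta : Continuous fun p : E × E => theta (A := A) p.1 p.2 := by
  refine Continuous.subtype_mk (p := (· ∈ adjointableSubalgebra A E))
    (f := fun p : E × E => (rsmulL A p.1).comp (innerL A p.2)) (by fun_prop) _

variable [CompleteSpace E] {j : D → E}

lemma finiteRank_subset_closure_span_theta (hj : DenseRange j) :
    (finiteRank A E : Set (Adjointable A E)) ⊆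
      closure (Submodule.span ℂ (Set.range fun p : D × D => theta (A := A) (j p.1) (j p.2))) := by
  let P := (Submodule.span ℂ
    (Set.range fun p : D × D => theta (A := A) (j p.1) (j p.2))).topologicalClosure
  have htheta (x y : E) : theta (A := A) x y ∈ P :=
    hj.induction_on₂ (p := fun x y => theta x y ∈ P)
      ((Submodule.isClosed_topologicalClosure _).preimage continuous_theta)
      (fun a b => subset_closure (Submodule.subset_span ⟨(a, b), rfl⟩)) x y
  have hle : Submodule.span ℂ (Set.range fun q : E × E => theta (A := A) q.1 q.2) ≤ P :=
    Submodule.span_le.2 (Set.range_subset_iff.2 fun q => htheta q.1 q.2)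
  exact hle

lemma CompactOp.dense_span_thetaK (hj : DenseRange j) : Dense (Submodule.span ℂ
    (Set.range fun p : D × D => thetaK A (j p.1) (j p.2)) : Set (CompactOp A E)) := by
  let coe : CompactOp A E →ₗ[ℂ] Adjointable A E := (compacts A E).subtype
  have himage : coe '' (Submodule.span ℂ (Set.range fun p : D × D => thetaK A (j p.1) (j p.2))) =
      Submodule.span ℂ (Set.range fun p : D × D => theta (A := A) (j p.1) (j p.2)) := by
    rw [← Submodule.map_coe, Submodule.map_span, ← Set.range_comp]
    rfl
  refine (Subtype.dense_iff (s := (compacts A E : Set (Adjointable A E)))).2 ?_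
  exact (closure_minimal (finiteRank_subset_closure_span_theta hj) isClosed_closure).trans_eq
    (congrArg closure himage.symm)

open scoped CStarAlgebra in
lemma CompactOp.hom_ext_of_thetaK {F : Type*} [NonUnitalCStarAlgebra F] (hj : DenseRange j)
    {f g : CompactOp A E →⋆ₙₐ[ℂ] F}
    (h : ∀ x y, f (thetaK A (j x) (j y)) = g (thetaK A (j x) (j y))) : f = g := by
  have hspan : Set.EqOn f g
      (Submodule.span ℂ (Set.range fun p : D × D => thetaK A (j p.1) (j p.2))) :=
    LinearMap.eqOn_span (f := (f : CompactOp A E →ₗ[ℂ] F)) (g := (g : CompactOp A E →ₗ[ℂ] F))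
      (Set.forall_mem_range.2 fun p => h p.1 p.2)
  exact DFunLike.coe_injective
    (Continuous.ext_on (dense_span_thetaK hj) (map_continuous f) (map_continuous g) hspan)

end Density

end PreHilbertModule

/-! ### Kernels of finite rank -/

namespace FellBundle

open Asymptotics PreHilbertModule

section FiniteRankKernels

variable {G : Type u} [Group G] [TopologicalSpace G] [IsTopologicalGroup G]
  [MeasurableSpace G] {𝒜 : FellBundle.{u, v} G} {μ : Measure G} {t : G}

namespace CcT

lemma kernel_app (ξ η : CcT 𝒜 μ t) (r s : G) : (ξ.kernel η).app r s =
    mulL (by group : r * t * (s * t)⁻¹ = r * s⁻¹) (ξ.app r) (starL rfl (η.app s)) := rfl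

lemma star_kernel (ξ η : CcT 𝒜 μ t) : star (ξ.kernel η) = η.kernel ξ := by
  ext1 r s
  refine BundleFiber.ext ?_
  change star (_ * star _) = _ * star _
  rw [star_mul, star_star]

variable [T2Space G] [BorelSpace G] [IsFiniteMeasureOnCompacts μ]

lemma kernel_act (ξ η ζ : CcT 𝒜 μ t) : (ξ.kernel η).act ζ = ξ.rsmul (inner η ζ) := by
  ext1 r
  rw [Kernel.act_app, rsmul_app, inner,
    ← (mulL (mul_one (r * t)) (ξ.app r)).integral_comp_comm (integrable_inner η ζ)]
  congr with s
  exact mul_assoc _ _ _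

lemma mul_kernel (k : Kernel 𝒜 μ) (ξ η : CcT 𝒜 μ t) : k * ξ.kernel η = (k.act ξ).kernel η := by
  ext1 r s
  have hright := ((mulL (by group : r * t * (s * t)⁻¹ = r * s⁻¹)).flip
    (starL rfl (η.app s))).integral_comp_comm (k.integrable_act_app ξ r fun _ => by group)
  refine Eq.trans ?_ hright
  rw [Kernel.mul_app]
  congr with u
  exact (mul_assoc _ _ _).symm

lemma norm_sq_kernel_le (ξ η : CcT 𝒜 μ t) :
    ‖ξ.kernel η‖ ^ 2 ≤ ξ.normSqIntegral * η.normSqIntegral := by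
  have hrow (r : G) : ∫ s, ‖(ξ.kernel η).app r s‖ ^ 2 ∂μ ≤ ‖ξ.app r‖ ^ 2 * η.normSqIntegral := by
    rw [normSqIntegral, ← integral_const_mul]
    refine integral_mono_of_nonneg (ae_of_all _ fun s => by positivity)
      (η.integrable_norm_sq.const_mul _) (ae_of_all _ fun s => ?_)
    dsimp only
    rw [← mul_pow, kernel_app]
    gcongr
    exact (norm_mulL_le _ _ _).trans_eq (by rw [LinearIsometry.norm_map])
  rw [Kernel.norm_sq_eq_integral, normSqIntegral, ← integral_mul_const]
  exact integral_mono_of_nonneg (ae_of_all _ fun r => integral_nonneg fun s => by positivity)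
    (ξ.integrable_norm_sq.mul_const _) (ae_of_all _ hrow)

end CcT

variable [T2Space G] [BorelSpace G] [IsFiniteMeasureOnCompacts μ]

lemma kernelRep_kernel (ξ η : CcT 𝒜 μ t) :
    kernelRep 𝒜 μ t (ξ.kernel η) = theta (ξ : L2 𝒜 μ t) (η : L2 𝒜 μ t) :=
  L2.adjointable_ext fun ζ => by
    rw [kernelRep_op_coe, theta_op, L2.innerL_coe, L2.rsmulL_coe, CcT.kernel_act]

lemma norm_act_le_kernelRep (k : Kernel 𝒜 μ) (ξ : CcT 𝒜 μ t) :
    ‖k.act ξ‖ ≤ ‖kernelRep 𝒜 μ t k‖ * ‖ξ‖ := by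
  have := (kernelRep 𝒜 μ t k).op.le_opNorm (ξ : L2 𝒜 μ t)
  rwa [kernelRep_op_coe, UniformSpace.Completion.norm_coe, UniformSpace.Completion.norm_coe,
    Adjointable.norm_op] at this

-- The product is the rank-one kernel of `ξ ⟨η, l ξ'⟩` and `η'`, and only the factor
-- `⟨η, l ξ'⟩ ∈ A_e` depends on `l`.
lemma CcT.norm_kernel_mul_mul_kernel_le (ξ η ξ' η' : CcT 𝒜 μ t) (l : Kernel 𝒜 μ) :
    ‖ξ.kernel η * l * ξ'.kernel η'‖ ≤
      √(ξ.normSqIntegral * η'.normSqIntegral) * (‖η‖ * ‖ξ'‖) * ‖kernelRep 𝒜 μ t l‖ := by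
  rw [mul_kernel, Kernel.mul_act, kernel_act]
  set a := inner η (l.act ξ')
  have ha : ‖a‖ ≤ ‖η‖ * (‖kernelRep 𝒜 μ t l‖ * ‖ξ'‖) :=
    (core.norm_inner_le η (l.act ξ')).trans
      (mul_le_mul_of_nonneg_left (norm_act_le_kernelRep l ξ') (norm_nonneg η))
  have hsq : ‖(ξ.rsmul a).kernel η'‖ ^ 2 ≤
      ξ.normSqIntegral * η'.normSqIntegral * ‖a‖ ^ 2 :=
    calc ‖(ξ.rsmul a).kernel η'‖ ^ 2 ≤ (ξ.rsmul a).normSqIntegral * η'.normSqIntegral :=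
          norm_sq_kernel_le _ _
      _ ≤ ‖a‖ ^ 2 * ξ.normSqIntegral * η'.normSqIntegral :=
          mul_le_mul_of_nonneg_right (ξ.normSqIntegral_rsmul_le a) η'.normSqIntegral_nonneg
      _ = ξ.normSqIntegral * η'.normSqIntegral * ‖a‖ ^ 2 := by ring
  calc ‖(ξ.rsmul a).kernel η'‖ ≤ √(ξ.normSqIntegral * η'.normSqIntegral * ‖a‖ ^ 2) :=
        Real.le_sqrt_of_sq_le hsq
    _ = √(ξ.normSqIntegral * η'.normSqIntegral) * ‖a‖ := by
        rw [Real.sqrt_mul (mul_nonneg ξ.normSqIntegral_nonneg η'.normSqIntegral_nonneg),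
          Real.sqrt_sq (norm_nonneg a)]
    _ ≤ √(ξ.normSqIntegral * η'.normSqIntegral) *
          (‖η‖ * (‖kernelRep 𝒜 μ t l‖ * ‖ξ'‖)) := by gcongr
    _ = _ := by ring

variable (𝒜 μ t) in
/-- The `*`-algebra of finite-rank kernels: the linear span of the kernels `ξ(r) η(s)*` with
`ξ, η ∈ C_c^t(𝒜)`. -/
def finiteRankKernels : NonUnitalStarSubalgebra ℂ (Kernel 𝒜 μ) where
  __ := Submodule.span ℂ (Set.range fun p : CcT 𝒜 μ t × CcT 𝒜 μ t => p.1.kernel p.2)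
  mul_mem' := by
    intro k l _ hl
    induction hl using Submodule.span_induction with
    | mem l hl =>
      obtain ⟨p, rfl⟩ := hl
      rw [CcT.mul_kernel]
      exact Submodule.subset_span ⟨(k.act p.1, p.2), rfl⟩
    | zero => rw [mul_zero]; exact Submodule.zero_mem _
    | add x y _ _ hx hy => rw [mul_add]; exact Submodule.add_mem _ hx hy
    | smul c x _ hx => rw [mul_smul_comm]; exact Submodule.smul_mem _ _ hx
  star_mem' := by
    intro l hl
    induction hl using Submodule.span_induction with
    | mem l hl =>
      obtain ⟨p, rfl⟩ := hl
      rw [CcT.star_kernel]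
      exact Submodule.subset_span ⟨(p.2, p.1), rfl⟩
    | zero => rw [star_zero]; exact Submodule.zero_mem _
    | add x y _ _ hx hy => rw [star_add]; exact Submodule.add_mem _ hx hy
    | smul c x _ hx => rw [star_smul]; exact Submodule.smul_mem _ _ hx

lemma kernel_mem_finiteRankKernels (ξ η : CcT 𝒜 μ t) : ξ.kernel η ∈ finiteRankKernels 𝒜 μ t :=
  Submodule.subset_span ⟨(ξ, η), rfl⟩

lemma isBigO_mul_mul_kernelRep {k k' : Kernel 𝒜 μ} (hk : k ∈ finiteRankKernels 𝒜 μ t)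
    (hk' : k' ∈ finiteRankKernels 𝒜 μ t) : (fun l => k * l * k') =O[⊤] kernelRep 𝒜 μ t := by
  induction hk, hk' using Submodule.span_induction₂ with
  | mem_mem k k' hk hk' =>
    obtain ⟨⟨ξ, η⟩, rfl⟩ := hk
    obtain ⟨⟨ξ', η'⟩, rfl⟩ := hk'
    exact isBigO_top.2 ⟨_, ξ.norm_kernel_mul_mul_kernel_le η ξ' η'⟩
  | zero_left k' => simpa only [zero_mul] using isBigO_zero _ _
  | zero_right k => simpa only [mul_zero] using isBigO_zero _ _
  | add_left x y k' _ _ _ hx hy => simpa only [add_mul] using hx.add hy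
  | add_right k x y _ _ _ hx hy => simpa only [mul_add] using hx.add hy
  | smul_left c x k' _ _ hx => simp only [smul_mul_assoc]; exact hx.const_smul_left c
  | smul_right c k x _ _ hx => simp only [mul_smul_comm]; exact hx.const_smul_left c

lemma norm_toAlgebra_eq_norm_kernelRep (k : finiteRankKernels 𝒜 μ t) :
    ‖k.1.toAlgebra‖ = ‖kernelRep 𝒜 μ t k‖ := by
  let incl := NonUnitalStarSubalgebraClass.subtype (finiteRankKernels 𝒜 μ t)
  have hsandwich (k k' : finiteRankKernels 𝒜 μ t) :
      (fun l : finiteRankKernels 𝒜 μ t => (k.1 * l.1 * k'.1).toAlgebra) =O[⊤]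
        fun l => kernelRep 𝒜 μ t l.1 := by
    obtain ⟨C, hC⟩ := isBigO_top.1 (isBigO_mul_mul_kernelRep k.2 k'.2)
    exact isBigO_top.2 ⟨C, fun l => (Kernel.norm_toAlgebra_le _).trans (hC l.1)⟩
  exact norm_eq_norm_of_forall_isBigO ((Kernel.toAlgebraHom 𝒜 μ).comp incl)
    ((kernelRep 𝒜 μ t).comp incl) (fun k => norm_kernelRep_le_norm_toAlgebra k.1) hsandwich k

lemma kernelRep_mem_compacts (k : finiteRankKernels 𝒜 μ t) :
    kernelRep 𝒜 μ t k ∈ compacts (𝒜.Fiber 1) (L2 𝒜 μ t) := by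
  have hle : Submodule.span ℂ (Set.range fun p : CcT 𝒜 μ t × CcT 𝒜 μ t => p.1.kernel p.2) ≤
      (compacts (𝒜.Fiber 1) (L2 𝒜 μ t)).toSubmodule.comap
        (kernelRep 𝒜 μ t : Kernel 𝒜 μ →ₗ[ℂ] Adjointable (𝒜.Fiber 1) (L2 𝒜 μ t)) := by
    refine Submodule.span_le.2 (Set.range_subset_iff.2 fun p => ?_)
    change kernelRep 𝒜 μ t (p.1.kernel p.2) ∈ compacts (𝒜.Fiber 1) (L2 𝒜 μ t)
    rw [kernelRep_kernel]
    exact (thetaK (𝒜.Fiber 1) (p.1 : L2 𝒜 μ t) (p.2 : L2 𝒜 μ t)).2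
  exact hle k.2

variable (𝒜 μ t) in
/-- The representation of the kernels of finite rank by compact operators on `L²_t(𝒜)`. -/
def finiteRankRep : finiteRankKernels 𝒜 μ t →⋆ₙₐ[ℂ] compactIdeal 𝒜 μ t :=
  NonUnitalStarAlgHom.codRestrict
    ((kernelRep 𝒜 μ t).comp (NonUnitalStarSubalgebraClass.subtype (finiteRankKernels 𝒜 μ t)))
    (compacts (𝒜.Fiber 1) (L2 𝒜 μ t)) kernelRep_mem_compacts

lemma finiteRankRep_kernel (ξ η : CcT 𝒜 μ t) :
    finiteRankRep 𝒜 μ t ⟨ξ.kernel η, kernel_mem_finiteRankKernels ξ η⟩ =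
      thetaK (𝒜.Fiber 1) (ξ : L2 𝒜 μ t) (η : L2 𝒜 μ t) :=
  Subtype.ext (kernelRep_kernel ξ η)

lemma denseRange_finiteRankRep : DenseRange (finiteRankRep 𝒜 μ t) := by
  have hdense := CompactOp.dense_span_thetaK (A := 𝒜.Fiber 1) (E := L2 𝒜 μ t)
    (UniformSpace.Completion.denseRange_coe (α := CcT 𝒜 μ t))
  have hle : Submodule.span ℂ (Set.range fun p : CcT 𝒜 μ t × CcT 𝒜 μ t =>
      thetaK (𝒜.Fiber 1) (p.1 : L2 𝒜 μ t) (p.2 : L2 𝒜 μ t)) ≤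
        LinearMap.range
          (finiteRankRep 𝒜 μ t : finiteRankKernels 𝒜 μ t →ₗ[ℂ] compactIdeal 𝒜 μ t) :=
    Submodule.span_le.2 (Set.range_subset_iff.2 fun p => ⟨_, finiteRankRep_kernel p.1 p.2⟩)
  exact hdense.mono hle

variable (𝒜 μ t) in
lemma exists_compactIdeal_embedding : ∃ ι : compactIdeal 𝒜 μ t →⋆ₙₐ[ℂ] KernelAlgebra 𝒜 μ,
    (∀ ξ η : CcT 𝒜 μ t,
      ι (thetaK (𝒜.Fiber 1) (ξ : L2 𝒜 μ t) (η : L2 𝒜 μ t)) = (ξ.kernel η).toAlgebra) ∧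
    ∀ T, ‖ι T‖ = ‖T‖ := by
  have hnorm (k : finiteRankKernels 𝒜 μ t) : ‖k.1.toAlgebra‖ = ‖finiteRankRep 𝒜 μ t k‖ :=
    norm_toAlgebra_eq_norm_kernelRep k
  obtain ⟨ι, hι, -⟩ := exists_nonUnitalStarAlgHom_extension (finiteRankRep 𝒜 μ t)
    ((Kernel.toAlgebraHom 𝒜 μ).comp
      (NonUnitalStarSubalgebraClass.subtype (finiteRankKernels 𝒜 μ t)))
    denseRange_finiteRankRep fun k => (hnorm k).le
  refine ⟨ι, fun ξ η => ?_, fun T => ?_⟩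
  · rw [← finiteRankRep_kernel, hι]
    rfl
  · open scoped CStarAlgebra in
    refine denseRange_finiteRankRep.induction_on (p := fun T => ‖ι T‖ = ‖T‖) T
      (isClosed_eq (map_continuous ι).norm continuous_norm) fun k => ?_
    rw [hι, ← hnorm]
    rfl

end FiniteRankKernels

end FellBundle

/-! ### Conjugation by a unitary of Hilbert modules -/

namespace PreHilbertModule

section Conjugation

variable {A E F : Type*} [NonUnitalCStarAlgebra A] [NormedAddCommGroup E] [NormedSpace ℂ E]
  [PreHilbertModule A E] [NormedAddCommGroup F] [NormedSpace ℂ F] [PreHilbertModule A F]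
  {U : E ≃ₗᵢ[ℂ] F}

lemma innerL_map_left (hU : ∀ x y, innerL A (U x) (U y) = innerL A x y) (x : E) (y : F) :
    innerL A (U x) y = innerL A x (U.symm y) := by
  rw [← hU, U.apply_symm_apply]

lemma innerL_map_right (hU : ∀ x y, innerL A (U x) (U y) = innerL A x y) (x : F) (y : E) :
    innerL A x (U y) = innerL A (U.symm x) y := by
  rw [← hU, U.apply_symm_apply]

lemma innerL_symm_map (hU : ∀ x y, innerL A (U x) (U y) = innerL A x y) (x y : F) :
    innerL A (U.symm x) (U.symm y) = innerL A x y := by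
  rw [← innerL_map_left hU, U.apply_symm_apply]

lemma map_rsmulL (hU : ∀ x y, innerL A (U x) (U y) = innerL A x y) (x : E) (a : A) :
    U (rsmulL A x a) = rsmulL A (U x) a :=
  ext_inner (A := A) fun z => by
    rw [innerL_map_right hU, innerL_rsmulL, innerL_rsmulL, innerL_map_right hU]

lemma innerL_conj (hU : ∀ x y, innerL A (U x) (U y) = innerL A x y) (T : Adjointable A E)
    (x y : F) :
    innerL A (U (T.op (U.symm x))) y = innerL A x (U ((star T).op (U.symm y))) := by
  rw [innerL_map_left hU, inner_star, innerL_map_right hU]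

variable (hU : ∀ x y, innerL A (U x) (U y) = innerL A x y)

/-- The map `T ↦ U T U*` of adjointable operators, for a unitary `U : E → F` of Hilbert modules. -/
def conjAdjointable : Adjointable A E →⋆ₙₐ[ℂ] Adjointable A F where
  toFun T := ⟨(U : E →L[ℂ] F) ∘L T.op ∘L (U.symm : F →L[ℂ] E),
    (U : E →L[ℂ] F) ∘L (star T).op ∘L (U.symm : F →L[ℂ] E), innerL_conj hU T⟩
  map_smul' c _ := Adjointable.ext_op fun _ => map_smul U c _
  map_zero' := Adjointable.ext_op fun _ => map_zero U
  map_add' _ _ := Adjointable.ext_op fun _ => map_add U _ _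
  map_mul' T S := Adjointable.ext_op fun x =>
    congrArg (fun y => U (T.op y)) (U.symm_apply_apply (S.op (U.symm x))).symm
  map_star' T := (star_eq_of_inner (innerL_conj hU T)).symm

lemma conjAdjointable_op (T : Adjointable A E) (x : F) :
    (conjAdjointable hU T).op x = U (T.op (U.symm x)) := rfl

lemma conjAdjointable_theta (x y : E) :
    conjAdjointable hU (theta x y) = theta (U x) (U y) :=
  Adjointable.ext_op fun z => by
    rw [conjAdjointable_op, theta_op, theta_op, map_rsmulL hU, innerL_map_left hU]

variable [CompleteSpace E] [CompleteSpace F]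

open scoped CStarAlgebra in
lemma conjAdjointable_mem_compacts {T : Adjointable A E} (hT : T ∈ compacts A E) :
    conjAdjointable hU T ∈ compacts A F := by
  have hle : Submodule.span ℂ (Set.range fun p : E × E => theta (A := A) p.1 p.2) ≤
      (finiteRank A F).toSubmodule.comap
        (conjAdjointable hU : Adjointable A E →ₗ[ℂ] Adjointable A F) := by
    refine Submodule.span_le.2 (Set.range_subset_iff.2 fun p => ?_)
    exact Submodule.subset_span ⟨(U p.1, U p.2), (conjAdjointable_theta hU p.1 p.2).symm⟩
  exact map_mem_closure (map_continuous (conjAdjointable hU)) hT fun S hS => hle hS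

/-- The isomorphism `T ↦ U T U*` of compact operators, for a unitary `U : E → F` of Hilbert
modules. -/
def conjCompact : CompactOp A E ≃⋆ₐ[ℂ] CompactOp A F where
  toFun T := ⟨conjAdjointable hU T.1, conjAdjointable_mem_compacts hU T.2⟩
  invFun T := ⟨conjAdjointable (innerL_symm_map hU) T.1,
    conjAdjointable_mem_compacts (innerL_symm_map hU) T.2⟩
  left_inv T := Subtype.ext (Adjointable.ext_op fun x => by
    simp only [conjAdjointable_op, LinearIsometryEquiv.symm_symm, U.symm_apply_apply])
  right_inv T := Subtype.ext (Adjointable.ext_op fun x => by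
    simp only [conjAdjointable_op, LinearIsometryEquiv.symm_symm, U.apply_symm_apply])
  map_mul' T S := Subtype.ext (map_mul (conjAdjointable hU) T.1 S.1)
  map_add' T S := Subtype.ext (map_add (conjAdjointable hU) T.1 S.1)
  map_star' T := Subtype.ext (map_star (conjAdjointable hU) T.1)
  map_smul' c T := Subtype.ext (map_smul (conjAdjointable hU) c T.1)

lemma conjCompact_op_map (T : CompactOp A E) (x : E) :
    (conjCompact hU T).op (U x) = U (T.op x) :=
  congrArg (fun y => U (T.op y)) (U.symm_apply_apply x)

lemma conjCompact_thetaK (x y : E) : conjCompact hU (thetaK A x y) = thetaK A (U x) (U y) :=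
  Subtype.ext (conjAdjointable_theta hU x y)

end Conjugation

end PreHilbertModule

/-! ### The unitaries `ρ_t` -/

namespace FellBundle

open PreHilbertModule

section Rho

variable {G : Type u} [Group G] [TopologicalSpace G] [IsTopologicalGroup G]

lemma sqrt_modular_mul_self [LocallyCompactSpace G] (t : G) :
    (√(modular t) : ℂ) * √(modular t) = modular t := by
  exact_mod_cast Real.mul_self_sqrt (modular_pos t).le

lemma sqrt_modular_ne_zero [LocallyCompactSpace G] (t : G) : (√(modular t) : ℂ) ≠ 0 := by
  exact_mod_cast (Real.sqrt_pos.2 (modular_pos t)).ne'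

variable [MeasurableSpace G] {𝒜 : FellBundle.{u, v} G} {μ : Measure G}

lemma CcT.cast_app {t u v w : G} (η : CcT 𝒜 μ t) (h : v = u) (h' : v * t = w) (h'' : u * t = w) :
    Fiber.cast h' (η.app v) = Fiber.cast h'' (η.app u) := by
  subst h
  rfl

variable [LocallyCompactSpace G]

namespace CcT

lemma rho_app (t : G) (ξ : CcT 𝒜 μ 1) (r : G) :
    (ξ.rho t).app r = (√(modular t) : ℂ) • Fiber.cast (mul_one (r * t)) (ξ.app (r * t)) := rfl

/-- The map `(ρ_t⁻¹ η)(r) = Δ(t)^{-1/2} η(r t⁻¹)` from `C_c^t(𝒜)` to `C_c(𝒜)`. -/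
def rhoInv (t : G) (η : CcT 𝒜 μ t) : CcT 𝒜 μ 1 :=
  .mk' (fun r => (√(modular t) : ℂ)⁻¹ •
      Fiber.cast (by group : r * t⁻¹ * t = r * 1) (η.app (r * t⁻¹)))
    (continuous_iff_continuousAt.2 fun r =>
      tendsto_smul (φ := fun r => r * 1)
        (f := fun r => Fiber.cast (by group) (η.app (r * t⁻¹)))
        (a := Fiber.cast (by group : r * t⁻¹ * t = r * 1) (η.app (r * t⁻¹))) _
        ((η.continuous_app.comp (continuous_mul_const t⁻¹)).tendsto r))
    (by
      obtain ⟨K, hK, hη⟩ := η.exists_compact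
      refine ⟨(· * t) '' K, hK.image (continuous_mul_const _), fun r hr => ?_⟩
      rw [hη _ fun h => hr ⟨_, h, by group⟩, map_zero, smul_zero])

lemma rhoInv_app (t : G) (η : CcT 𝒜 μ t) (r : G) : (η.rhoInv t).app r =
    (√(modular t) : ℂ)⁻¹ • Fiber.cast (by group : r * t⁻¹ * t = r * 1) (η.app (r * t⁻¹)) := rfl

lemma rhoInv_rho (t : G) (ξ : CcT 𝒜 μ 1) : (ξ.rho t).rhoInv t = ξ := by
  ext1 r
  rw [rhoInv_app, rho_app, map_smul, inv_smul_smul₀ (sqrt_modular_ne_zero t)]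
  exact ξ.cast_app (by group) (by group) rfl

lemma rho_rhoInv (t : G) (η : CcT 𝒜 μ t) : (η.rhoInv t).rho t = η := by
  ext1 r
  rw [rho_app, rhoInv_app, map_smul, smul_inv_smul₀ (sqrt_modular_ne_zero t)]
  exact η.cast_app (by group) (by group) rfl

variable (𝒜 μ) in
/-- The map `ρ_t` as a linear bijection of `C_c(𝒜)` onto `C_c^t(𝒜)`. -/
def rhoEquiv (t : G) : CcT 𝒜 μ 1 ≃ₗ[ℂ] CcT 𝒜 μ t where
  toFun := rho t
  map_add' ξ η := by
    ext1 r
    simp only [rho_app, add_app, map_add, smul_add]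
  map_smul' c ξ := by
    ext1 r
    simp only [rho_app, smul_app, map_smul, RingHom.id_apply]
    exact smul_comm _ _ _
  invFun := rhoInv t
  left_inv := rhoInv_rho t
  right_inv := rho_rhoInv t

lemma translate_kernel (t : G) (ξ η : CcT 𝒜 μ 1) :
    (ξ.kernel η).translate t = (ξ.rho t).kernel (η.rho t) := by
  ext1 r s
  simp only [kernel_app, rho_app, map_smul, map_smulₛₗ,
    _root_.smul_apply, smul_smul, Complex.conj_ofReal, sqrt_modular_mul_self]
  rfl

variable [BorelSpace G] [μ.IsHaarMeasure]

lemma inner_rho (t : G) (ξ η : CcT 𝒜 μ 1) : inner (ξ.rho t) (η.rho t) = inner ξ η := by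
  let f : G → 𝒜.Fiber 1 := fun r =>
    mulL (inv_mul_cancel (r * 1)) (starL rfl (ξ.app r)) (η.app r)
  have hf : Continuous f := continuous_val_iff.1 <| 𝒜.continuous_mul_tot.comp <|
    (𝒜.continuous_star_tot.comp ξ.continuous_app).prodMk η.continuous_app
  have hf_supp : HasCompactSupport f := by
    obtain ⟨K, hK, hξ⟩ := ξ.exists_compact
    exact HasCompactSupport.intro hK fun r hr => by simp [f, hξ r hr]
  have hrho : inner (ξ.rho t) (η.rho t) = ∫ r, (modular t : ℂ) • f (r * t) ∂μ := by
    refine integral_congr_ae (ae_of_all _ fun r => ?_)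
    simp only [rho_app, map_smul, map_smulₛₗ, _root_.smul_apply, smul_smul, Complex.conj_ofReal,
      sqrt_modular_mul_self]
    rfl
  rw [hrho, integral_smul, integral_mul_right_modular μ hf hf_supp, Complex.coe_smul,
    smul_inv_smul₀ (modular_pos t).ne']
  rfl

lemma norm_rho [T2Space G] (t : G) (ξ : CcT 𝒜 μ 1) : ‖ξ.rho t‖ = ‖ξ‖ := by
  rw [norm_def, norm_def, inner_rho]

end CcT

variable [T2Space G] [BorelSpace G] [μ.IsHaarMeasure]

namespace L2

variable (𝒜 μ) in
/-- The unitary `ρ_t : L²(𝒜) → L²_t(𝒜)`. -/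
def rho (t : G) : L2 𝒜 μ 1 ≃ₗᵢ[ℂ] L2 𝒜 μ t :=
  (CcT.rhoEquiv 𝒜 μ t).extendOfIsometry
    (UniformSpace.Completion.toComplL (𝕜 := ℂ) (E := CcT 𝒜 μ 1)).toLinearMap
    (UniformSpace.Completion.toComplL (𝕜 := ℂ) (E := CcT 𝒜 μ t)).toLinearMap
    UniformSpace.Completion.denseRange_coe UniformSpace.Completion.denseRange_coe fun ξ =>
      (UniformSpace.Completion.norm_coe _).trans <|
        (CcT.norm_rho t ξ).trans (UniformSpace.Completion.norm_coe _).symm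

lemma rho_coe (t : G) (ξ : CcT 𝒜 μ 1) :
    rho 𝒜 μ t (ξ : L2 𝒜 μ 1) = (ξ.rho t : CcT 𝒜 μ t) :=
  LinearEquiv.extendOfIsometry_eq ..

lemma inner_rho (t : G) (x y : L2 𝒜 μ 1) :
    innerL (𝒜.Fiber 1) (rho 𝒜 μ t x) (rho 𝒜 μ t y) = innerL (𝒜.Fiber 1) x y := by
  have hcont : Continuous (rho 𝒜 μ t) := (rho 𝒜 μ t).continuous
  induction x, y using UniformSpace.Completion.induction_on₂ with
  | hp => exact isClosed_eq (by fun_prop) (by fun_prop)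
  | ih ξ η => rw [rho_coe, rho_coe, innerL_coe, innerL_coe, CcT.inner_rho]

end L2

end Rho

end FellBundle

/-! ### Compatibility of the embeddings with `β_t` -/

section Range

variable {R A B C D : Type*} [CommSemiring R]
  [NonUnitalSemiring A] [Module R A] [Star A]
  [NonUnitalSemiring B] [Module R B] [Star B]
  [NonUnitalSemiring C] [Module R C] [StarRing C]
  [NonUnitalSemiring D] [Module R D] [StarRing D]

lemma range_eq_map_range_of_comp_eq (e : A ≃⋆ₐ[R] B) {f : A →⋆ₙₐ[R] C} {g : B →⋆ₙₐ[R] D}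
    {β : C →⋆ₙₐ[R] D} (h : ∀ a, β (f a) = g (e a)) :
    NonUnitalStarAlgHom.range g = (NonUnitalStarAlgHom.range f).map β := by
  refine SetLike.coe_injective ?_
  change Set.range g = β '' Set.range f
  rw [← Set.range_comp, ← e.surjective.range_comp g]
  exact congrArg Set.range (funext fun a => (h a).symm)

end Range

namespace FellBundle

open PreHilbertModule

variable {G : Type u} [Group G] [TopologicalSpace G] [IsTopologicalGroup G]
  [LocallyCompactSpace G] [T2Space G] [MeasurableSpace G] [BorelSpace G]
  {μ : Measure G} [μ.IsHaarMeasure] {𝒜 : FellBundle.{u, v} G}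

lemma action_embedding_eq_embedding_conjCompact {t : G}
    {ι₁ : compactIdeal 𝒜 μ 1 →⋆ₙₐ[ℂ] KernelAlgebra 𝒜 μ}
    {ιₜ : compactIdeal 𝒜 μ t →⋆ₙₐ[ℂ] KernelAlgebra 𝒜 μ}
    (h₁ : ∀ ξ η : CcT 𝒜 μ 1,
      ι₁ (thetaK (𝒜.Fiber 1) (ξ : L2 𝒜 μ 1) (η : L2 𝒜 μ 1)) = (ξ.kernel η).toAlgebra)
    (hₜ : ∀ ξ η : CcT 𝒜 μ t,
      ιₜ (thetaK (𝒜.Fiber 1) (ξ : L2 𝒜 μ t) (η : L2 𝒜 μ t)) = (ξ.kernel η).toAlgebra)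
    (T : compactIdeal 𝒜 μ 1) :
    action 𝒜 μ t (ι₁ T) = ιₜ (conjCompact (L2.inner_rho t) T) := by
  let ρl : compactIdeal 𝒜 μ 1 ≃⋆ₐ[ℂ] compactIdeal 𝒜 μ t := conjCompact (L2.inner_rho t)
  have hcomp : (action 𝒜 μ t).comp ι₁ = ιₜ.comp (ρl : _ →⋆ₙₐ[ℂ] compactIdeal 𝒜 μ t) := by
    refine CompactOp.hom_ext_of_thetaK UniformSpace.Completion.denseRange_coe fun ξ η => ?_
    change action 𝒜 μ t (ι₁ _) = ιₜ (conjCompact (L2.inner_rho t) _)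
    rw [h₁, action_toAlgebra, conjCompact_thetaK, L2.rho_coe, L2.rho_coe, hₜ,
      CcT.translate_kernel]
  exact DFunLike.congr_fun hcomp T

end FellBundle

end

open FellBundle PreHilbertModule in
theorem proposition2p5 {G : Type u} [Group G] [TopologicalSpace G] [IsTopologicalGroup G]
    [LocallyCompactSpace G] [T2Space G] [MeasurableSpace G] [BorelSpace G]
    (μ : Measure G) [μ.IsHaarMeasure] (𝒜 : FellBundle.{u, v} G) :
    ∃ ι : ∀ t : G, compactIdeal 𝒜 μ t →⋆ₙₐ[ℂ] KernelAlgebra 𝒜 μ,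
      (∀ t : G,
        (∀ ξ η : CcT 𝒜 μ t,
          ι t (thetaK (𝒜.Fiber 1) (ξ : L2 𝒜 μ t) (η : L2 𝒜 μ t)) = (ξ.kernel η).toAlgebra) ∧
        (∀ T : compactIdeal 𝒜 μ t, ‖ι t T‖ = ‖T‖) ∧
        (∀ ι' : compactIdeal 𝒜 μ t →⋆ₙₐ[ℂ] KernelAlgebra 𝒜 μ,
          (∀ ξ η : CcT 𝒜 μ t,
            ι' (thetaK (𝒜.Fiber 1) (ξ : L2 𝒜 μ t) (η : L2 𝒜 μ t)) = (ξ.kernel η).toAlgebra) →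
          ι' = ι t)) ∧
      ∀ t : G,
        NonUnitalStarAlgHom.range (ι t) =
          (NonUnitalStarAlgHom.range (ι 1)).map (action 𝒜 μ t) ∧
        ∃ (ρ : L2 𝒜 μ 1 ≃ₗᵢ[ℂ] L2 𝒜 μ t) (ρl : compactIdeal 𝒜 μ 1 ≃⋆ₐ[ℂ] compactIdeal 𝒜 μ t),
          (∀ ξ : CcT 𝒜 μ 1, ρ (ξ : L2 𝒜 μ 1) = (ξ.rho t : L2 𝒜 μ t)) ∧
          (∀ x y : L2 𝒜 μ 1, innerL (𝒜.Fiber 1) (ρ x) (ρ y) = innerL (𝒜.Fiber 1) x y) ∧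
          (∀ (x : L2 𝒜 μ 1) (a : 𝒜.Fiber 1),
            ρ (rsmulL (𝒜.Fiber 1) x a) = rsmulL (𝒜.Fiber 1) (ρ x) a) ∧
          (∀ (T : compactIdeal 𝒜 μ 1) (x : L2 𝒜 μ 1), (ρl T).op (ρ x) = ρ (T.op x)) ∧
          ∀ T : compactIdeal 𝒜 μ 1, action 𝒜 μ t (ι 1 T) = ι t (ρl T) := by
  choose ι hθ hnorm using fun t => exists_compactIdeal_embedding 𝒜 μ t
  refine ⟨ι, fun t => ⟨hθ t, hnorm t, fun ι' hθ' => ?_⟩, fun t => ?_⟩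
  · exact CompactOp.hom_ext_of_thetaK UniformSpace.Completion.denseRange_coe fun ξ η =>
      (hθ' ξ η).trans (hθ t ξ η).symm
  have hβ := action_embedding_eq_embedding_conjCompact (hθ 1) (hθ t)
  exact ⟨range_eq_map_range_of_comp_eq (conjCompact (L2.inner_rho t)) hβ,
    L2.rho 𝒜 μ t, conjCompact (L2.inner_rho t), L2.rho_coe t, L2.inner_rho t,
    map_rsmulL (L2.inner_rho t), conjCompact_op_map (L2.inner_rho t), hβ⟩
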